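/- **Setting.** For a finite set $\Lambda$ with a probability measure $\mu$, $p_\lambda=\mu(\{\lambda\})>0$ for all $\lambda$, let each $\lambda\in\Lambda$ carry integers $2\le m_\lambda<n_\lambda$ and a non-empty digit set $D_\lambda\subseteq\{0,\dots,m_\lambda-1\}\times\{0,\dots,n_\lambda-1\}$, with the maps $f^\lambda_{(a,b)}(x,y)=\big(\tfrac{x+a}{m_\lambda},\tfrac{y+b}{n_\lambda}\big)$, $(a,b)\in D_\lambda$. For $\omega\in\Lambda^{\mathbb N}$ the one-variable random Bedford–McMullen carpet is $$F_\omega=\bigcap_{k\ge1}\ \bigcup_{d_1\in D_{\omega_1},\dots,d_k\in D_{\omega_k}} f^{\omega_1}_{d_1}\circ\dots\circ f^{\omega_k}_{d_k}([0,1]^2),$$ and "almost surely" refers to the product measure $\mu^{\mathbb N}$. Let $B_\lambda$ be the number of distinct first coordinates $a$ of elements of $D_\lambda$ (non-empty columns), $C_\lambda$ the maximal number of elements of $D_\lambda$ with a common first coordinate, and $\log\overline m=\sum_\lambda p_\lambda\log m_\lambda$, $\log\overline n=\sum_\lambda p_\lambda\log n_\lambda$. **Dimensions.** A *dimension function* is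 a function $\phi$ such that on some interval $(0,x_0)$ it is positive and both $\phi(x)$ and $\phi(x)|\log x|$ are monotone. Let $N_r(X)$ be the least number of closed balls of radius $r$ covering $X$. Let $\dim_A^\phi F$ be the infimum of all $s\ge0$ for which there is $K>0$ with $N_r(F\cap B(x,R))\le K(R/r)^s$ for all $x\in F$ and all $0<r=R^{1+\phi(R)}<R<1$. Let $\dim_A F$ be defined in the same way with all $0<r\le R<1$, and let $\dim_{qA}F=\lim_{\theta\uparrow1}\dim_A^{\phi_\theta}F$ with the constant function $\phi_\theta=1/\theta-1$. All asymptotics and inequalities between dimension functions are as $x\downarrow0$; $\varphi=\omega(\phi)$ means $\phi(x)/\varphi(x)\to0$. **Theorem.** (1) Let $\phi$ be a dimension function with $\sum_{k\ge1}e^{-\phi(e^{-k})k}<\infty$. Then, almost surely, for every dimension function $\varphi=\omega(\phi)$ with $\varphi(x)\le\log\overline n/\log\overline m-1$ for all sufficiently small $x>0$, the limit defining $\dim_{qA}F_\omega$ exists and $\dim_A^\varphi F_\omega=\dim_{qA}F_\omega$. (2) Let $\phi$ be a dimension function with $\sum_{k\ge1}e^{-\phi(e^{-k})k}=\infty$.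 Then there is $C>0$ such that, almost surely, $$\dim_A F_\omega=\max_{\lambda\in\Lambda}\frac{\log B_\lambda}{\log m_\lambda}+\max_{\lambda\in\Lambda}\frac{\log C_\lambda}{\log n_\lambda}$$ and $\dim_A^\varphi F_\omega=\dim_A F_\omega$ for every dimension function $\varphi$ with $\varphi(x)\le C\phi(x)$ for all sufficiently small $x>0$ and $\varphi(x)|\log x|\to\infty$ as $x\downarrow0$. -/

import Mathlib

open MeasureTheory Filter Topology Asymptotics Set
open scoped ENNReal NNReal

noncomputable section

namespace RandomCarpet

/-- The Euclidean plane. -/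
abbrev Plane : Type := EuclideanSpace ℝ (Fin 2)

/-! ## Covering numbers, dimension functions and Assouad type dimensions -/

/-- `coveringNum r X` is the least number of closed balls of radius `r` needed to cover `X`
(the centres are arbitrary points of the space). -/
def coveringNum {E : Type*} [PseudoEMetricSpace E] (r : ℝ) (X : Set E) : ℝ≥0∞ :=
  ((Metric.externalCoveringNumber r.toNNReal X : ℕ∞) : ℝ≥0∞)

/-- `f` is monotone on `s`, in one direction or the other. -/
def MonotoneEitherOn (f : ℝ → ℝ) (s : Set ℝ) : Prop :=
  MonotoneOn f s ∨ AntitoneOn f s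

/-- A dimension function: on some interval `(0, x₀)` the function `φ` is positive, and both `φ x`
and `φ x * |log x|` are monotone. Only the behaviour near `0` is constrained, so that
functions such as `log |log x| / |log x|` are included. -/
def IsDimensionFunction (φ : ℝ → ℝ) : Prop :=
  ∃ x₀ : ℝ, 0 < x₀ ∧ x₀ < 1 ∧ (∀ x ∈ Ioo 0 x₀, 0 < φ x) ∧
    MonotoneEitherOn φ (Ioo 0 x₀) ∧
    MonotoneEitherOn (fun x => φ x * |Real.log x|) (Ioo 0 x₀)

/-- The generalised Assouad spectrum of `F` with respect to `φ`: only the scales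
`r = R ^ (1 + φ R)` with `0 < r < R < 1` are used. -/
def genAssouadDim {E : Type*} [PseudoMetricSpace E] (φ : ℝ → ℝ) (F : Set E) : ℝ :=
  sInf {s : ℝ | 0 ≤ s ∧ ∃ C : ℝ, 0 < C ∧ ∀ r R : ℝ, 0 < r → r = R ^ (1 + φ R) → r < R → 0 < R →
    R < 1 → ∀ x ∈ F, coveringNum r (F ∩ Metric.closedBall x R) ≤ ENNReal.ofReal (C * (R / r) ^ s)}

/-- The Assouad dimension of `F`: all pairs of scales `0 < r ≤ R < 1` are used. -/
def assouadDim {E : Type*} [PseudoMetricSpace E] (F : Set E) : ℝ :=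
  sInf {s : ℝ | 0 ≤ s ∧ ∃ C : ℝ, 0 < C ∧ ∀ r R : ℝ, 0 < r → r ≤ R → R < 1 →
    ∀ x ∈ F, coveringNum r (F ∩ Metric.closedBall x R) ≤ ENNReal.ofReal (C * (R / r) ^ s)}

/-- The `θ`-Assouad spectrum, `0 < θ < 1`: here `r = R ^ (1 / θ)`. -/
def assouadSpectrum {E : Type*} [PseudoMetricSpace E] (θ : ℝ) (F : Set E) : ℝ :=
  genAssouadDim (fun _ => 1 / θ - 1) F

/-- `d` is the quasi-Assouad dimension of `F`, that is, the limit of the `θ`-Assouad spectrum as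
`θ` increases to `1` exists and equals `d`. -/
def IsQuasiAssouadDim {E : Type*} [PseudoMetricSpace E] (F : Set E) (d : ℝ) : Prop :=
  Tendsto (fun θ : ℝ => assouadSpectrum θ F) (𝓝[<] 1) (𝓝 d)

/-! ## Bedford-McMullen systems -/

/-- A Bedford-McMullen iterated function system: the unit square is divided into `m` columns of
width `1 / m` and `n` rows of height `1 / n`, `2 ≤ m < n`, and a non-empty set of the resulting
rectangles is kept. The rectangle in column `a` and row `b` has the digit `(a, b)`. -/
structure BMSystem where
  m : ℕ
  n : ℕ
  two_le_m : 2 ≤ m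
  m_lt_n : m < n
  digits : Finset (ℕ × ℕ)
  digits_nonempty : digits.Nonempty
  digits_lt : ∀ d ∈ digits, d.1 < m ∧ d.2 < n

namespace BMSystem

/-- The affine map of the system that sends the unit square onto the rectangle with digit `d`. -/
def map (I : BMSystem) (d : ℕ × ℕ) (x : Plane) : Plane :=
  !₂[(x 0 + d.1) / I.m, (x 1 + d.2) / I.n]

/-- The number of non-empty columns. -/
def B (I : BMSystem) : ℕ := (I.digits.image Prod.fst).card

/-- The maximal number of maps in a column. -/
def C (I : BMSystem) : ℕ :=
  (Finset.range I.m).sup fun a => (I.digits.filter fun d => d.1 = a).card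

end BMSystem

/-- The unit square. -/
def unitSquare : Set Plane := {x | ∀ j, x j ∈ Icc (0 : ℝ) 1}

/-! ## One-variable random carpets -/

/-- The composition `f_{i 0} ∘ ... ∘ f_{i (k - 1)}`, where `f_{i j}` is taken from the system with
index `ω j`. -/
def cylinderMap {Λ : Type*} (I : Λ → BMSystem) (ω : ℕ → Λ) (i : ℕ → ℕ × ℕ) : ℕ → Plane → Plane
  | 0 => id
  | k + 1 => cylinderMap I ω i k ∘ (I (ω k)).map (i k)

/-- The carpet `F_ω`: the intersection over the levels `k` of the unions of all the rectangles of
level `k` (the level `k = 0` contributes the unit square, which contains all the others). -/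
def carpet {Λ : Type*} (I : Λ → BMSystem) (ω : ℕ → Λ) : Set Plane :=
  ⋂ k : ℕ, ⋃ i ∈ {i : ℕ → ℕ × ℕ | ∀ j < k, i j ∈ (I (ω j)).digits},
    cylinderMap I ω i k '' unitSquare

/-- The geometric mean of `X` with respect to `μ`. -/
def geomMean {Λ : Type*} [MeasurableSpace Λ] (μ : Measure Λ) (X : Λ → ℝ) : ℝ :=
  Real.exp (∫ l, Real.log (X l) ∂μ)

/-- The law on `Λ ^ ℕ` of an i.i.d. sequence with common law `μ`. -/
def iidLaw {Λ : Type*} [MeasurableSpace Λ] (μ : Measure Λ) [IsProbabilityMeasure μ] :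
    Measure (ℕ → Λ) :=
  Measure.infinitePi fun _ : ℕ => μ

end RandomCarpet

end

noncomputable section

namespace RandomCarpet

/-! At scale `t` the carpet consists of approximate squares. Such a square is fixed by the column
digits up to the level where the product of the widths reaches `1/t`, and by the row digits up to
the level where the product of the heights reaches `1/t`. Refining a square from scale `R` to scale
`r` appends column digits over a window `[k₁, l₁)` and row digits over a window `[k₂, l₂)`. A column
digit has `B` values. A row digit has at most `C` values, since its column is already known. So the
covering number is, up to a constant, at most the product of the `B` over the first window and of
the `C` over the second (`coveringNum_carpet_le`). The bound is attained around a point coded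
through maximal columns provided `l₂ ≤ k₁`, because then the two choices do not interfere
(`exists_le_coveringNum_carpet`).

Summable case. Hoeffding's inequality and Borel–Cantelli over all windows show that, almost surely,
sums of a centred function over windows are at most `ε` times the length plus a multiple of the
logarithm of the position (`ae_hasSmallWindowSums`). Positions are of order `log (1/R)`, so the
logarithm of the covering number is `(a + c) log (R/r)` up to `ε log (R/r)` and an iterated
logarithm of `1/R`, where `a` and `c` are the quotients of the means of `log B`, `log m` and of `log
C`, `log n`. Summability and monotonicity bound `φ(R) |log R|` below by a multiple of that iterated
logarithm, so for `φ = o(ψ)` the error is negligible against `log (R/r) = ψ(R) |log R|`; for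
constant `ψ` this is clear. The upper bound on `ψ` says that `l₂ ≤ k₁` on average. Hence these
spectra, and the `θ`-spectra for `θ` near `1`, all equal `a + c`.

Divergent case. The sum of the two maxima is a deterministic upper bound. It is attained when `ω` is
constantly a maximiser of `log C / log n` on the row window and of `log B / log m` on the column
window. For runs of length `δ log K` with `δ` small, each of the order of `K / log K` candidate row
levels in `[K/2, K]` succeeds with probability at least a constant times `K^(-1/4)`, so almost
surely every large `K` has such a pair of runs (`exists_ae_hasLongRuns`). The column windows start
at stopping times; independence holds because all row windows end by `K` and all column windows
start at `K` or later (`measure_no_paired_runs_le`). Divergence gives infinitely many `K` with `φ(R)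
|log R| ≤ 3 log K` on the whole range of `R` down to an exponentially small scale in `K`, so the
scales of a small multiple of `φ` fit into the runs. -/

/-! ## Mixed radix expansions -/

/-- The place value of the `k`-th digit in the mixed radix system with bases `b`. -/
def place (b : ℕ → ℕ) (k : ℕ) : ℕ := ∏ j ∈ Finset.range k, b j

/-- The integer with the digits `u 0, …, u (k - 1)`, most significant digit first. -/
def numeral (b u : ℕ → ℕ) : ℕ → ℕ
  | 0 => 0
  | k + 1 => numeral b u k * b k + u k

/-- The point of `[0, 1]` with the mixed radix expansion `u`. -/
def expansion (b u : ℕ → ℕ) : ℝ := ⨆ k, (numeral b u k : ℝ) / place b k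

section MixedRadix

variable {b u v : ℕ → ℕ}

@[simp] lemma place_zero : place b 0 = 1 := by simp [place]

lemma place_succ (k : ℕ) : place b (k + 1) = place b k * b k := by
  simp [place, Finset.prod_range_succ]

lemma two_pow_le_place (hb : ∀ j, 2 ≤ b j) (k : ℕ) : 2 ^ k ≤ place b k := by
  induction k with
  | zero => simp
  | succ k ih => rw [place_succ, pow_succ]; exact Nat.mul_le_mul ih (hb k)

lemma place_pos (hb : ∀ j, 2 ≤ b j) (k : ℕ) : 0 < place b k :=
  lt_of_lt_of_le (by positivity) (two_pow_le_place hb k)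

lemma place_cast_pos (hb : ∀ j, 2 ≤ b j) (k : ℕ) : (0 : ℝ) < place b k := by
  exact_mod_cast place_pos hb k

lemma place_strictMono (hb : ∀ j, 2 ≤ b j) : StrictMono (place b) := by
  refine strictMono_nat_of_lt_succ fun k => ?_
  rw [place_succ]
  nlinarith [hb k, place_pos hb k]

lemma place_le_place {c : ℕ → ℕ} (h : ∀ j, b j ≤ c j) (k : ℕ) : place b k ≤ place c k :=
  Finset.prod_le_prod' fun j _ => h j

lemma numeral_congr {k : ℕ} (h : ∀ j < k, u j = v j) : numeral b u k = numeral b v k := by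
  induction k with
  | zero => rfl
  | succ k ih =>
    simp only [numeral]
    rw [ih fun j hj => h j (by omega), h k (by omega)]

lemma eq_of_numeral_eq {k : ℕ} (hu : ∀ j < k, u j < b j) (hv : ∀ j < k, v j < b j)
    (h : numeral b u k = numeral b v k) : ∀ j < k, u j = v j := by
  induction k with
  | zero => simp
  | succ k ih =>
    simp only [numeral] at h
    have hk : u k = v k := by
      have := congrArg (· % b k) h
      simpa [Nat.mul_comm _ (b k), Nat.mul_add_mod, Nat.mod_eq_of_lt (hu k (by omega)),
        Nat.mod_eq_of_lt (hv k (by omega))] using this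
    have hn : numeral b u k = numeral b v k := by
      rw [hk] at h
      exact Nat.eq_of_mul_eq_mul_right (Nat.zero_lt_of_lt (hv k k.lt_succ_self)) (Nat.add_right_cancel h)
    intro j hj
    rcases Nat.lt_succ_iff_lt_or_eq.1 hj with hj | rfl
    · exact ih (fun j hj => hu j (by omega)) (fun j hj => hv j (by omega)) hn j hj
    · exact hk

/-- The intervals of successive levels are nested, so the supremum of the left ends lies in all of
them. They must be closed on the right, because of digits that are eventually maximal. -/
lemma expansion_mem_Icc (hb : ∀ j, 2 ≤ b j) (hu : ∀ j, u j < b j) (k : ℕ) :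
    expansion b u ∈ Icc ((numeral b u k : ℝ) / place b k) ((numeral b u k + 1 : ℝ) / place b k) := by
  have hpos := place_cast_pos hb
  have hb0 : ∀ j, (0 : ℝ) < b j := fun j => by have := hb j; positivity
  have hmono : Monotone fun k => (numeral b u k : ℝ) / place b k := by
    refine monotone_nat_of_le_succ fun j => ?_
    rw [div_le_div_iff₀ (hpos _) (hpos _), place_succ, numeral]
    push_cast
    nlinarith [hpos j, mul_nonneg (hpos j).le (Nat.cast_nonneg (α := ℝ) (u j))]
  have hanti : Antitone fun k => (numeral b u k + 1 : ℝ) / place b k := by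
    refine antitone_nat_of_succ_le fun j => ?_
    rw [div_le_div_iff₀ (hpos _) (hpos _), place_succ, numeral]
    push_cast
    have : (u j : ℝ) + 1 ≤ b j := by exact_mod_cast hu j
    nlinarith [mul_le_mul_of_nonneg_left this (hpos j).le]
  have hle : ∀ j, (numeral b u j : ℝ) / place b j ≤ (numeral b u j + 1 : ℝ) / place b j := fun j =>
    div_le_div_of_nonneg_right (by linarith) (hpos j).le
  exact mem_iInter.1 (hmono.ciSup_mem_iInter_Icc_of_antitone hanti hle) k

end MixedRadix

/-! ## The rectangles of a carpet -/

section Rectangles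

variable {Λ : Type*} (I : Λ → BMSystem) (ω : ℕ → Λ)

/-- The widths of the columns along `ω`. -/
def cols (j : ℕ) : ℕ := (I (ω j)).m

/-- The heights of the rows along `ω`. -/
def rows (j : ℕ) : ℕ := (I (ω j)).n

lemma two_le_cols (j : ℕ) : 2 ≤ cols I ω j := (I (ω j)).two_le_m

lemma cols_lt_rows (j : ℕ) : cols I ω j < rows I ω j := (I (ω j)).m_lt_n

lemma two_le_rows (j : ℕ) : 2 ≤ rows I ω j := (two_le_cols I ω j).trans (cols_lt_rows I ω j).le

variable {I ω}

lemma cylinderMap_apply_zero (i : ℕ → ℕ × ℕ) (k : ℕ) (x : Plane) :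
    cylinderMap I ω i k x 0 =
      (numeral (cols I ω) (fun j => (i j).1) k + x 0) / place (cols I ω) k := by
  induction k generalizing x with
  | zero => simp [cylinderMap, numeral]
  | succ k ih =>
    have h1 := place_cast_pos (two_le_cols I ω) k
    have h2 : (0 : ℝ) < cols I ω k := by have := two_le_cols I ω k; positivity
    simp only [cylinderMap, Function.comp_apply, ih, numeral, place_succ, BMSystem.map]
    push_cast
    change (_ + (x 0 + ((i k).1 : ℝ)) / (cols I ω k : ℝ)) / _ = _
    field_simp
    ring

lemma cylinderMap_apply_one (i : ℕ → ℕ × ℕ) (k : ℕ) (x : Plane) :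
    cylinderMap I ω i k x 1 =
      (numeral (rows I ω) (fun j => (i j).2) k + x 1) / place (rows I ω) k := by
  induction k generalizing x with
  | zero => simp [cylinderMap, numeral]
  | succ k ih =>
    have h1 := place_cast_pos (two_le_rows I ω) k
    have h2 : (0 : ℝ) < rows I ω k := by have := two_le_rows I ω k; positivity
    simp only [cylinderMap, Function.comp_apply, ih, numeral, place_succ, BMSystem.map]
    push_cast
    change (_ + (x 1 + ((i k).2 : ℝ)) / (rows I ω k : ℝ)) / _ = _
    field_simp
    ring

/-- The two coordinates decouple: one condition involves only column digits, the other only row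
digits. This permits the use of different levels for columns and rows. -/
lemma mem_cylinder_iff (i : ℕ → ℕ × ℕ) (k : ℕ) (x : Plane) :
    x ∈ cylinderMap I ω i k '' unitSquare ↔
      x 0 ∈ Icc ((numeral (cols I ω) (fun j => (i j).1) k : ℝ) / place (cols I ω) k)
        ((numeral (cols I ω) (fun j => (i j).1) k + 1 : ℝ) / place (cols I ω) k) ∧
      x 1 ∈ Icc ((numeral (rows I ω) (fun j => (i j).2) k : ℝ) / place (rows I ω) k)
        ((numeral (rows I ω) (fun j => (i j).2) k + 1 : ℝ) / place (rows I ω) k) := by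
  have h1 := place_cast_pos (two_le_cols I ω) k
  have h2 := place_cast_pos (two_le_rows I ω) k
  constructor
  · rintro ⟨y, hy, rfl⟩
    have hy0 := hy 0
    have hy1 := hy 1
    rw [cylinderMap_apply_zero, cylinderMap_apply_one]
    simp only [mem_Icc] at *
    refine ⟨⟨?_, ?_⟩, ?_, ?_⟩ <;> gcongr <;> linarith
  · rintro ⟨⟨h3, h4⟩, h5, h6⟩
    rw [div_le_iff₀ h1] at h3
    rw [le_div_iff₀ h1] at h4
    rw [div_le_iff₀ h2] at h5
    rw [le_div_iff₀ h2] at h6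
    refine ⟨!₂[x 0 * place (cols I ω) k - numeral (cols I ω) (fun j => (i j).1) k,
      x 1 * place (rows I ω) k - numeral (rows I ω) (fun j => (i j).2) k], ?_, ?_⟩
    · intro j
      fin_cases j
      · exact ⟨by simpa using h3, by simp; linarith⟩
      · exact ⟨by simpa using h5, by simp; linarith⟩
    · ext j
      fin_cases j
      · change cylinderMap I ω i k _ 0 = x 0
        rw [cylinderMap_apply_zero]
        simp [h1.ne']
      · change cylinderMap I ω i k _ 1 = x 1
        rw [cylinderMap_apply_one]
        simp [h2.ne']

/-- The words that are admissible along `ω`. -/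
def IsCode (I : Λ → BMSystem) (ω : ℕ → Λ) (i : ℕ → ℕ × ℕ) : Prop :=
  ∀ j, i j ∈ (I (ω j)).digits

lemma exists_isCode_eq_on {i : ℕ → ℕ × ℕ} {k : ℕ} (h : ∀ j < k, i j ∈ (I (ω j)).digits) :
    ∃ i', IsCode I ω i' ∧ ∀ j < k, i' j = i j := by
  classical
  refine ⟨fun j => if j < k then i j else (I (ω j)).digits_nonempty.choose, fun j => ?_, ?_⟩
  · by_cases hj : j < k
    · simpa [hj] using h j hj
    · simpa [hj] using (I (ω j)).digits_nonempty.choose_spec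
  · intro j hj
    simp [hj]

/-- The point of the carpet with a given code. -/
def codePoint (I : Λ → BMSystem) (ω : ℕ → Λ) (i : ℕ → ℕ × ℕ) : Plane :=
  !₂[expansion (cols I ω) fun j => (i j).1, expansion (rows I ω) fun j => (i j).2]

lemma IsCode.fst_lt {i : ℕ → ℕ × ℕ} (h : IsCode I ω i) (j : ℕ) : (i j).1 < cols I ω j :=
  ((I (ω j)).digits_lt _ (h j)).1

lemma IsCode.snd_lt {i : ℕ → ℕ × ℕ} (h : IsCode I ω i) (j : ℕ) : (i j).2 < rows I ω j :=
  ((I (ω j)).digits_lt _ (h j)).2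

lemma IsCode.codePoint_mem {i : ℕ → ℕ × ℕ} (h : IsCode I ω i) :
    codePoint I ω i ∈ carpet I ω := by
  refine mem_iInter.2 fun k => mem_iUnion₂.2 ⟨i, fun j _ => h j, ?_⟩
  rw [mem_cylinder_iff]
  exact ⟨expansion_mem_Icc (two_le_cols I ω) h.fst_lt k,
    expansion_mem_Icc (two_le_rows I ω) h.snd_lt k⟩

/-- The code may depend on `k`. One level at a time suffices below, so no compactness argument for a
single code of `x` is needed. -/
lemma exists_code_of_mem {x : Plane} (hx : x ∈ carpet I ω) (k : ℕ) :
    ∃ i, IsCode I ω i ∧ x ∈ cylinderMap I ω i k '' unitSquare := by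
  obtain ⟨i, hi, hxi⟩ := mem_iUnion₂.1 (mem_iInter.1 hx k)
  obtain ⟨i', hi', heq⟩ := exists_isCode_eq_on hi
  refine ⟨i', hi', ?_⟩
  rw [mem_cylinder_iff] at hxi ⊢
  rwa [numeral_congr (u := fun j => (i' j).1) (v := fun j => (i j).1) fun j hj => by rw [heq j hj],
    numeral_congr (u := fun j => (i' j).2) (v := fun j => (i j).2) fun j hj => by rw [heq j hj]]

end Rectangles

/-! ## Counting approximate squares -/

lemma exists_finset_nat_Icc (a b : ℝ) (h : a ≤ b) :
    ∃ S : Finset ℕ, (∀ n : ℕ, a ≤ n → n ≤ b → n ∈ S) ∧ (S.card : ℝ) ≤ b - a + 1 := by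
  rcases lt_or_ge b 0 with hb | hb
  · refine ⟨∅, fun n _ hn => absurd (hn.trans_lt hb) (by simp), ?_⟩
    simp
    linarith
  · refine ⟨Finset.Icc ⌈a⌉₊ ⌊b⌋₊, fun n h1 h2 => ?_, ?_⟩
    · exact Finset.mem_Icc.2 ⟨Nat.ceil_le.2 h1, Nat.le_floor h2⟩
    · rw [Nat.card_Icc]
      rcases le_total ⌈a⌉₊ (⌊b⌋₊ + 1) with h' | h'
      · rw [Nat.cast_sub h']
        push_cast
        linarith [Nat.floor_le hb, Nat.le_ceil a]
      · rw [Nat.sub_eq_zero_of_le h']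
        simp
        linarith

/-- The index `A` lies in an interval of length `2rp + 1 ≤ 2κ + 1`. This serves at scale `R` for the
upper estimate and at scale `r` for the lower one. -/
lemma exists_finset_near {p r : ℝ} {κ : ℕ} (hp : 0 < p) (hr : 0 ≤ r) (hle : r * p ≤ κ) (z : ℝ) :
    ∃ S : Finset ℕ, (∀ (A : ℕ) (t : ℝ), |t - z| ≤ r →
      t ∈ Icc ((A : ℝ) / p) ((A + 1 : ℝ) / p) → A ∈ S) ∧ S.card ≤ 2 * κ + 2 := by
  obtain ⟨S, hS, hcard⟩ := exists_finset_nat_Icc ((z - r) * p - 1) ((z + r) * p) (by nlinarith)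
  refine ⟨S, fun A t ht hA => hS A ?_ ?_, ?_⟩
  · have := (le_div_iff₀ hp).1 hA.2
    nlinarith [(abs_le.1 ht).1]
  · have := (div_le_iff₀ hp).1 hA.1
    nlinarith [(abs_le.1 ht).2]
  · have : (S.card : ℝ) ≤ (2 * κ + 2 : ℕ) := by
      push_cast
      nlinarith
    exact_mod_cast this

lemma dist_le_of_abs_sub_le {x y : Plane} {r : ℝ} (h0 : |x 0 - y 0| ≤ r / 2)
    (h1 : |x 1 - y 1| ≤ r / 2) : dist x y ≤ r := by
  have hr : 0 ≤ r := by linarith [abs_nonneg (x 0 - y 0)]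
  rw [EuclideanSpace.dist_eq, Fin.sum_univ_two, Real.dist_eq, Real.dist_eq]
  refine Real.sqrt_le_iff.2 ⟨hr, ?_⟩
  have := pow_le_pow_left₀ (abs_nonneg _) h0 2
  have := pow_le_pow_left₀ (abs_nonneg _) h1 2
  nlinarith

lemma abs_sub_le_of_dist_le {x y : Plane} {r : ℝ} (h : dist x y ≤ r) (j : Fin 2) :
    |x j - y j| ≤ r := by
  rw [dist_eq_norm] at h
  exact (PiLp.norm_apply_le (x - y) j).trans h

section Counting

variable {Λ : Type*} {I : Λ → BMSystem} {ω : ℕ → Λ}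

lemma BMSystem.card_column_le_C (J : BMSystem) (a : ℕ) :
    (J.digits.filter fun d => d.1 = a).card ≤ J.C := by
  by_cases ha : a < J.m
  · exact Finset.le_sup (f := fun a => (J.digits.filter fun d => d.1 = a).card)
      (Finset.mem_range.2 ha)
  · rw [Finset.card_eq_zero.2]
    · exact Nat.zero_le _
    · refine Finset.filter_eq_empty_iff.2 fun d hd h => ha ?_
      exact h ▸ (J.digits_lt d hd).1

lemma BMSystem.exists_card_column_eq_C (J : BMSystem) :
    ∃ a, (J.digits.filter fun d => d.1 = a).card = J.C := by
  obtain ⟨a, -, ha⟩ := Finset.exists_mem_eq_sup (Finset.range J.m)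
    ⟨0, Finset.mem_range.2 (by have := J.two_le_m; omega)⟩
    fun a => (J.digits.filter fun d => d.1 = a).card
  exact ⟨a, ha.symm⟩

lemma BMSystem.one_le_C (J : BMSystem) : 1 ≤ J.C := by
  obtain ⟨d, hd⟩ := J.digits_nonempty
  refine lt_of_lt_of_le (Finset.card_pos.2 ?_) (J.card_column_le_C d.1)
  exact ⟨d, Finset.mem_filter.2 ⟨hd, rfl⟩⟩

lemma BMSystem.one_le_B (J : BMSystem) : 1 ≤ J.B :=
  Finset.card_pos.2 (J.digits_nonempty.image _)

lemma BMSystem.C_le_n (J : BMSystem) : J.C ≤ J.n := by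
  refine Finset.sup_le fun a _ => ?_
  calc _ ≤ (Finset.range J.n).card := by
        refine Finset.card_le_card_of_injOn Prod.snd (fun d hd => ?_) fun d hd e he h => ?_
        · exact Finset.mem_coe.2 (Finset.mem_range.2 (J.digits_lt d (Finset.mem_filter.1 hd).1).2)
        · exact Prod.ext ((Finset.mem_filter.1 hd).2.trans (Finset.mem_filter.1 he).2.symm) h
    _ = J.n := Finset.card_range _

lemma BMSystem.map_mem_unitSquare (J : BMSystem) {d : ℕ × ℕ} (hd : d ∈ J.digits) {z : Plane}
    (hz : z ∈ unitSquare) : J.map d z ∈ unitSquare := by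
  have hlt := J.digits_lt _ hd
  have hm : (0 : ℝ) < J.m := by have := J.two_le_m; positivity
  have hn : (0 : ℝ) < J.n := hm.trans (by exact_mod_cast J.m_lt_n)
  have h1 : (d.1 : ℝ) + 1 ≤ J.m := by exact_mod_cast hlt.1
  have h2 : (d.2 : ℝ) + 1 ≤ J.n := by exact_mod_cast hlt.2
  have z0 := hz 0
  have z1 := hz 1
  intro j
  fin_cases j
  · exact ⟨div_nonneg (add_nonneg z0.1 (Nat.cast_nonneg _)) hm.le,
      (div_le_one hm).2 (by have := z0.2; exact (by linarith : z 0 + (d.1 : ℝ) ≤ J.m))⟩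
  · exact ⟨div_nonneg (add_nonneg z1.1 (Nat.cast_nonneg _)) hn.le,
      (div_le_one hn).2 (by have := z1.2; exact (by linarith : z 1 + (d.2 : ℝ) ≤ J.n))⟩

lemma IsCode.antitone_cylinder {i : ℕ → ℕ × ℕ} (hi : IsCode I ω i) :
    Antitone fun k => cylinderMap I ω i k '' unitSquare := by
  refine antitone_nat_of_succ_le fun k => ?_
  rintro _ ⟨z, hz, rfl⟩
  exact ⟨_, (I (ω k)).map_mem_unitSquare (hi k) hz, rfl⟩

/-- The product of the numbers of non-empty columns over a window of levels. -/
def prodB (I : Λ → BMSystem) (ω : ℕ → Λ) (k l : ℕ) : ℕ := ∏ j ∈ Finset.Ico k l, (I (ω j)).B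

/-- The product of the maximal column sizes over a window of levels. -/
def prodC (I : Λ → BMSystem) (ω : ℕ → Λ) (k l : ℕ) : ℕ := ∏ j ∈ Finset.Ico k l, (I (ω j)).C

/-- The pair of integers that records the column digits up to `k₁` and the row digits up
to `k₂`. -/
def squareIndex (I : Λ → BMSystem) (ω : ℕ → Λ) (k₁ k₂ : ℕ) (i : ℕ → ℕ × ℕ) : ℕ × ℕ :=
  (numeral (cols I ω) (fun j => (i j).1) k₁, numeral (rows I ω) (fun j => (i j).2) k₂)

lemma exists_cover_column_succ {P : (ℕ → ℕ × ℕ) → Prop} {k₁ k₂ N : ℕ}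
    (h : ∃ T : Finset (ℕ × ℕ), T.card ≤ N ∧
      ∀ i, IsCode I ω i → P i → squareIndex I ω k₁ k₂ i ∈ T) :
    ∃ T : Finset (ℕ × ℕ), T.card ≤ N * (I (ω k₁)).B ∧
      ∀ i, IsCode I ω i → P i → squareIndex I ω (k₁ + 1) k₂ i ∈ T := by
  classical
  obtain ⟨T, hT, hmem⟩ := h
  refine ⟨(T ×ˢ (I (ω k₁)).digits.image Prod.fst).image
    fun q => (q.1.1 * cols I ω k₁ + q.2, q.1.2), ?_, fun i hi hPi => ?_⟩
  · refine Finset.card_image_le.trans ?_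
    rw [Finset.card_product]
    exact Nat.mul_le_mul_right _ hT
  · exact Finset.mem_image.2 ⟨(squareIndex I ω k₁ k₂ i, (i k₁).1),
      Finset.mem_product.2 ⟨hmem i hi hPi, Finset.mem_image_of_mem _ (hi k₁)⟩, rfl⟩

/-- Since `k₂ < k₁`, the recorded column integer already determines the column of the digit at level
`k₂`. The row digit then ranges over one column only, which gives the factor `C`. -/
lemma exists_cover_row_succ {P : (ℕ → ℕ × ℕ) → Prop} {k₁ k₂ N : ℕ} (hk : k₂ < k₁)
    (h : ∃ T : Finset (ℕ × ℕ), T.card ≤ N ∧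
      ∀ i, IsCode I ω i → P i → squareIndex I ω k₁ k₂ i ∈ T) :
    ∃ T : Finset (ℕ × ℕ), T.card ≤ N * (I (ω k₂)).C ∧
      ∀ i, IsCode I ω i → P i → squareIndex I ω k₁ (k₂ + 1) i ∈ T := by
  classical
  obtain ⟨T, hT, hmem⟩ := h
  -- Uniqueness of digits makes the column digit a function of `A`; the value `0` is a default for
  -- integers that come from no code.
  have hdig : ∀ A : ℕ, ∃ a : ℕ, ∀ i, IsCode I ω i →
      numeral (cols I ω) (fun j => (i j).1) k₁ = A → (i k₂).1 = a := by
    intro A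
    by_cases hA : ∃ i, IsCode I ω i ∧ numeral (cols I ω) (fun j => (i j).1) k₁ = A
    · obtain ⟨i, hi, hiA⟩ := hA
      exact ⟨(i k₂).1, fun i' hi' h' => eq_of_numeral_eq (fun j _ => hi'.fst_lt j)
        (fun j _ => hi.fst_lt j) (h'.trans hiA.symm) k₂ hk⟩
    · exact ⟨0, fun i hi h' => absurd ⟨i, hi, h'⟩ hA⟩
  choose a ha using hdig
  refine ⟨T.biUnion fun p => ((I (ω k₂)).digits.filter fun d => d.1 = a p.1).image
    fun d => (p.1, p.2 * rows I ω k₂ + d.2), ?_, fun i hi hPi => ?_⟩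
  · refine (Finset.card_biUnion_le_card_mul _ _ _ fun p _ => ?_).trans (Nat.mul_le_mul_right _ hT)
    exact Finset.card_image_le.trans (BMSystem.card_column_le_C _ _)
  · exact Finset.mem_biUnion.2 ⟨_, hmem i hi hPi, Finset.mem_image.2
      ⟨i k₂, Finset.mem_filter.2 ⟨hi k₂, ha _ i hi rfl⟩, rfl⟩⟩

/-- All column digits are appended before any row digit, so that each row step, at a level below `l₂
≤ l₁`, finds its column known. -/
lemma exists_cover_squareIndex {P : (ℕ → ℕ × ℕ) → Prop} {k₁ k₂ l₁ l₂ N : ℕ} (hk₁ : k₁ ≤ l₁)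
    (hk₂ : k₂ ≤ l₂) (hl : l₂ ≤ l₁)
    (h : ∃ T : Finset (ℕ × ℕ), T.card ≤ N ∧
      ∀ i, IsCode I ω i → P i → squareIndex I ω k₁ k₂ i ∈ T) :
    ∃ T : Finset (ℕ × ℕ), T.card ≤ N * (prodB I ω k₁ l₁ * prodC I ω k₂ l₂) ∧
      ∀ i, IsCode I ω i → P i → squareIndex I ω l₁ l₂ i ∈ T := by
  induction l₂, hk₂ using Nat.le_induction with
  | base =>
    have hC : prodC I ω k₂ k₂ = 1 := by simp [prodC]
    rw [hC, mul_one]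
    clear hC hl
    induction l₁, hk₁ using Nat.le_induction with
    | base => simpa [prodB] using h
    | succ l hl ih =>
      have := exists_cover_column_succ ih
      rwa [mul_assoc, prodB, ← Finset.prod_Ico_succ_top hl] at this
  | succ l hkl ih =>
    have := exists_cover_row_succ (Nat.lt_of_succ_le hl) (ih (by omega))
    rwa [mul_assoc, mul_assoc, prodC, ← Finset.prod_Ico_succ_top hkl] at this

/-- The upper estimate for the covering numbers of a carpet. -/
theorem coveringNum_carpet_le {κ k₁ k₂ l₁ l₂ : ℕ} {r R : ℝ} (hk₁ : k₁ ≤ l₁) (hk₂ : k₂ ≤ l₂)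
    (hl : l₂ ≤ l₁) (hr₁ : 1 ≤ r * place (cols I ω) l₁) (hr₂ : 1 ≤ r * place (rows I ω) l₂)
    (hR : 0 < R) (hR₁ : R * place (cols I ω) k₁ ≤ κ) (hR₂ : R * place (rows I ω) k₂ ≤ κ)
    (x : Plane) :
    coveringNum r (carpet I ω ∩ Metric.closedBall x R) ≤
      ((2 * κ + 2) ^ 2 * (prodB I ω k₁ l₁ * prodC I ω k₂ l₂) : ℕ) := by
  classical
  have hM := place_cast_pos (two_le_cols I ω)
  have hN := place_cast_pos (two_le_rows I ω)
  obtain ⟨S₁, hS₁, hc₁⟩ := exists_finset_near (hM k₁) hR.le hR₁ (x 0)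
  obtain ⟨S₂, hS₂, hc₂⟩ := exists_finset_near (hN k₂) hR.le hR₂ (x 1)
  obtain ⟨T, hT, hTmem⟩ := exists_cover_squareIndex (I := I) (ω := ω)
    (P := fun i => squareIndex I ω k₁ k₂ i ∈ S₁ ×ˢ S₂) (N := (2 * κ + 2) ^ 2) hk₁ hk₂ hl
    ⟨S₁ ×ˢ S₂, by rw [Finset.card_product, sq]; exact Nat.mul_le_mul hc₁ hc₂, fun i _ h => h⟩
  -- Centres of rectangles with both sides at most `r`; each rectangle lies in the ball of radius
  -- `r` around its centre.
  let f : ℕ × ℕ → Plane := fun p =>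
    !₂[(p.1 + 1 / 2 : ℝ) / place (cols I ω) l₁, (p.2 + 1 / 2 : ℝ) / place (rows I ω) l₂]
  have hcover : Metric.IsCover r.toNNReal (carpet I ω ∩ Metric.closedBall x R)
      (T.image f : Finset Plane) := by
    rintro y ⟨hy, hyx⟩
    obtain ⟨i, hi, hyi⟩ := exists_code_of_mem hy l₁
    have hmem : ∀ k ≤ l₁, y ∈ cylinderMap I ω i k '' unitSquare := fun k hk =>
      hi.antitone_cylinder hk hyi
    have hk₂' : k₂ ≤ l₁ := hk₂.trans hl
    have h1 := ((mem_cylinder_iff i k₁ y).1 (hmem k₁ hk₁)).1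
    have h2 := ((mem_cylinder_iff i k₂ y).1 (hmem k₂ hk₂')).2
    have hP := hTmem i hi (Finset.mem_product.2
      ⟨hS₁ _ _ (abs_sub_le_of_dist_le hyx 0) h1, hS₂ _ _ (abs_sub_le_of_dist_le hyx 1) h2⟩)
    refine ⟨f (squareIndex I ω l₁ l₂ i), by exact_mod_cast Finset.mem_image_of_mem f hP, ?_⟩
    have h3 := ((mem_cylinder_iff i l₁ y).1 hyi).1
    have h4 := ((mem_cylinder_iff i l₂ y).1 (hmem l₂ hl)).2
    have hside : ∀ (A : ℕ) (p t : ℝ), 0 < p → 1 ≤ r * p → t ∈ Icc ((A : ℝ) / p) ((A + 1 : ℝ) / p) →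
        |t - (A + 1 / 2 : ℝ) / p| ≤ r / 2 := by
      intro A p t hp hrp ht
      have ha := (div_le_iff₀ hp).1 ht.1
      have hb := (le_div_iff₀ hp).1 ht.2
      have : t - (A + 1 / 2 : ℝ) / p = (t * p - (A + 1 / 2)) / p := by field_simp
      rw [this, abs_div, abs_of_pos hp, div_le_iff₀ hp, abs_le]
      constructor <;> linarith
    have := dist_le_of_abs_sub_le (x := y) (y := f (squareIndex I ω l₁ l₂ i))
      (hside _ _ _ (hM l₁) hr₁ h3) (hside _ _ _ (hN l₂) hr₂ h4)
    change edist y _ ≤ _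
    rw [edist_dist]
    exact ENNReal.ofReal_le_ofReal this
  have hle := hcover.externalCoveringNumber_le_encard
  rw [Set.encard_coe_eq_coe_finsetCard] at hle
  have hle' : Metric.externalCoveringNumber r.toNNReal (carpet I ω ∩ Metric.closedBall x R) ≤
      (((2 * κ + 2) ^ 2 * (prodB I ω k₁ l₁ * prodC I ω k₂ l₂) : ℕ) : ℕ∞) :=
    hle.trans (by exact_mod_cast Finset.card_image_le.trans hT)
  unfold coveringNum
  exact_mod_cast ENat.toENNReal_le.2 hle'

end Counting

/-! ### Packing: lower bounds for covering numbers -/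

section Packing

variable {Λ : Type*} {I : Λ → BMSystem} {ω : ℕ → Λ}

/-- The property `P` pins the column at level `k₂` to a maximal one. Moving within that column
produces `C` row digits and leaves the column integer unchanged. -/
lemma exists_packing_row_succ {P : (ℕ → ℕ × ℕ) → Prop} {k₁ k₂ N a : ℕ}
    (ha : ((I (ω k₂)).digits.filter fun d => d.1 = a).card = (I (ω k₂)).C)
    (hP : ∀ i, P i → (i k₂).1 = a)
    (hupd : ∀ i b, P i → P (Function.update i k₂ (a, b)))
    (h : ∃ T : Finset (ℕ × ℕ), N ≤ T.card ∧
      ∀ p ∈ T, ∃ i, IsCode I ω i ∧ P i ∧ squareIndex I ω k₁ k₂ i = p) :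
    ∃ T : Finset (ℕ × ℕ), N * (I (ω k₂)).C ≤ T.card ∧
      ∀ p ∈ T, ∃ i, IsCode I ω i ∧ P i ∧ squareIndex I ω k₁ (k₂ + 1) i = p := by
  classical
  obtain ⟨T, hT, hmem⟩ := h
  refine ⟨(T ×ˢ (I (ω k₂)).digits.filter fun d => d.1 = a).image
    fun q => (q.1.1, q.1.2 * rows I ω k₂ + q.2.2), ?_, fun p hp => ?_⟩
  · rw [Finset.card_image_of_injOn, Finset.card_product, ha]
    · exact Nat.mul_le_mul_right _ hT
    · rintro ⟨p, d⟩ hpd ⟨q, e⟩ hqe heq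
      simp only [Finset.coe_product, Set.mem_prod, Finset.mem_coe, Finset.mem_filter] at hpd hqe
      simp only [Prod.mk.injEq] at heq
      have hd := ((I (ω k₂)).digits_lt d hpd.2.1).2
      have he := ((I (ω k₂)).digits_lt e hqe.2.1).2
      change d.2 < rows I ω k₂ at hd
      change e.2 < rows I ω k₂ at he
      have h2 : d.2 = e.2 := by
        have := congrArg (· % rows I ω k₂) heq.2
        simpa [Nat.mul_comm _ (rows I ω k₂), Nat.mul_add_mod, Nat.mod_eq_of_lt hd,
          Nat.mod_eq_of_lt he] using this
      have h3 : p.2 = q.2 := by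
        have := heq.2
        rw [h2] at this
        exact Nat.eq_of_mul_eq_mul_right (Nat.zero_lt_of_lt hd) (Nat.add_right_cancel this)
      exact Prod.ext (Prod.ext heq.1 h3) (Prod.ext (hpd.2.2.trans hqe.2.2.symm) h2)
  · obtain ⟨⟨q, d⟩, hq, rfl⟩ := Finset.mem_image.1 hp
    obtain ⟨hqT, hd⟩ := Finset.mem_product.1 hq
    obtain ⟨hd, hda⟩ := Finset.mem_filter.1 hd
    obtain ⟨i, hi, hPi, rfl⟩ := hmem q hqT
    have hda' : d = (a, d.2) := Prod.ext hda rfl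
    refine ⟨Function.update i k₂ (a, d.2), fun j => ?_, hupd i _ hPi, ?_⟩
    · rcases eq_or_ne j k₂ with rfl | hj
      · rw [Function.update_self, ← hda']; exact hd
      · rw [Function.update_of_ne hj]; exact hi j
    · simp only [squareIndex, numeral, Function.update_self]
      refine Prod.ext (numeral_congr fun j _ => ?_) ?_
      · rcases eq_or_ne j k₂ with rfl | hj
        · simp [hP i hPi]
        · simp [hj]
      · change numeral _ _ k₂ * _ + d.2 = numeral _ _ k₂ * _ + d.2
        rw [numeral_congr (u := fun j => (Function.update i k₂ (a, d.2) j).2)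
          (v := fun j => (i j).2) fun j hj => by rw [Function.update_of_ne hj.ne]]

/-- Since `k₂ ≤ k₁`, altering the digit at level `k₁` does not touch the row integer, so all `B`
columns are available. -/
lemma exists_packing_column_succ {P : (ℕ → ℕ × ℕ) → Prop} {k₁ k₂ N : ℕ} (hk : k₂ ≤ k₁)
    (hupd : ∀ i d, P i → P (Function.update i k₁ d))
    (h : ∃ T : Finset (ℕ × ℕ), N ≤ T.card ∧
      ∀ p ∈ T, ∃ i, IsCode I ω i ∧ P i ∧ squareIndex I ω k₁ k₂ i = p) :
    ∃ T : Finset (ℕ × ℕ), N * (I (ω k₁)).B ≤ T.card ∧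
      ∀ p ∈ T, ∃ i, IsCode I ω i ∧ P i ∧ squareIndex I ω (k₁ + 1) k₂ i = p := by
  classical
  obtain ⟨T, hT, hmem⟩ := h
  refine ⟨(T ×ˢ (I (ω k₁)).digits.image Prod.fst).image
    fun q => (q.1.1 * cols I ω k₁ + q.2, q.1.2), ?_, fun p hp => ?_⟩
  · rw [Finset.card_image_of_injOn, Finset.card_product]
    · exact Nat.mul_le_mul_right _ hT
    · rintro ⟨p, a⟩ hpa ⟨q, b⟩ hqb heq
      simp only [Finset.coe_product, Set.mem_prod, Finset.mem_coe, Finset.mem_image] at hpa hqb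
      simp only [Prod.mk.injEq] at heq
      obtain ⟨-, d, hd, rfl⟩ := hpa
      obtain ⟨-, e, he, rfl⟩ := hqb
      have hd := ((I (ω k₁)).digits_lt d hd).1
      have he := ((I (ω k₁)).digits_lt e he).1
      change d.1 < cols I ω k₁ at hd
      change e.1 < cols I ω k₁ at he
      have h2 : d.1 = e.1 := by
        have := congrArg (· % cols I ω k₁) heq.1
        simpa [Nat.mul_comm _ (cols I ω k₁), Nat.mul_add_mod, Nat.mod_eq_of_lt hd,
          Nat.mod_eq_of_lt he] using this
      have h3 : p.1 = q.1 := by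
        have := heq.1
        rw [h2] at this
        exact Nat.eq_of_mul_eq_mul_right (Nat.zero_lt_of_lt hd) (Nat.add_right_cancel this)
      exact Prod.ext (Prod.ext h3 heq.2) h2
  · obtain ⟨⟨q, a⟩, hq, rfl⟩ := Finset.mem_image.1 hp
    obtain ⟨hqT, hd⟩ := Finset.mem_product.1 hq
    obtain ⟨d, hdD, rfl⟩ := Finset.mem_image.1 hd
    obtain ⟨i, hi, hPi, rfl⟩ := hmem q hqT
    refine ⟨Function.update i k₁ d, fun j => ?_, hupd i _ hPi, ?_⟩
    · rcases eq_or_ne j k₁ with rfl | hj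
      · rw [Function.update_self]; exact hdD
      · rw [Function.update_of_ne hj]; exact hi j
    · simp only [squareIndex, numeral, Function.update_self]
      refine Prod.ext ?_ (numeral_congr fun j hj => ?_)
      · change numeral _ _ k₁ * _ + d.1 = numeral _ _ k₁ * _ + d.1
        rw [numeral_congr (u := fun j => (Function.update i k₁ d j).1)
          (v := fun j => (i j).1) fun j hj => by rw [Function.update_of_ne hj.ne]]
      · rw [Function.update_of_ne (hj.trans_le hk).ne]

/-- Here `l₂ ≤ k₁` is essential: row freedom is spent at levels below `k₁`, where columns are pinned
to those of `i₀`, and column freedom from `k₁` on. Rows are therefore varied before columns. -/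
lemma exists_packing_squareIndex {i₀ : ℕ → ℕ × ℕ} (hi₀ : IsCode I ω i₀)
    (hmax : ∀ j, ((I (ω j)).digits.filter fun d => d.1 = (i₀ j).1).card = (I (ω j)).C)
    {k₁ k₂ l₁ l₂ : ℕ} (hk₂ : k₂ ≤ l₂) (hl : l₂ ≤ k₁) (hk₁ : k₁ ≤ l₁) :
    ∃ T : Finset (ℕ × ℕ), prodC I ω k₂ l₂ * prodB I ω k₁ l₁ ≤ T.card ∧
      ∀ p ∈ T, ∃ i, IsCode I ω i ∧
        ((∀ j < k₁, (i j).1 = (i₀ j).1) ∧ ∀ j < k₂, (i j).2 = (i₀ j).2) ∧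
        squareIndex I ω l₁ l₂ i = p := by
  induction l₁, hk₁ using Nat.le_induction with
  | base =>
    have hB : prodB I ω k₁ k₁ = 1 := by simp [prodB]
    rw [hB, mul_one]
    clear hB
    induction l₂, hk₂ using Nat.le_induction with
    | base =>
      refine ⟨{squareIndex I ω k₁ k₂ i₀}, by simp [prodC], fun p hp => ?_⟩
      exact ⟨i₀, hi₀, ⟨fun _ _ => rfl, fun _ _ => rfl⟩, (Finset.mem_singleton.1 hp).symm⟩
    | succ l hkl ih =>
      have hlk : l < k₁ := Nat.lt_of_succ_le hl
      have := exists_packing_row_succ (hmax l) (fun i hi => hi.1 l hlk) (fun i b hi => ?_)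
        (ih hlk.le)
      · rwa [prodC, ← Finset.prod_Ico_succ_top hkl] at this
      · refine ⟨fun j hj => ?_, fun j hj => ?_⟩
        · rcases eq_or_ne j l with rfl | hjl
          · simp
          · rw [Function.update_of_ne hjl]; exact hi.1 j hj
        · rw [Function.update_of_ne (by omega)]; exact hi.2 j hj
  | succ l hkl ih =>
    have := exists_packing_column_succ (hl.trans hkl) (fun i d hi => ?_) ih
    · rwa [mul_assoc, prodB, ← Finset.prod_Ico_succ_top hkl] at this
    · refine ⟨fun j hj => ?_, fun j hj => ?_⟩
      · rw [Function.update_of_ne (by omega)]; exact hi.1 j hj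
      · rw [Function.update_of_ne (by omega)]; exact hi.2 j hj

lemma exists_isCode_maximal_columns (I : Λ → BMSystem) (ω : ℕ → Λ) : ∃ i₀, IsCode I ω i₀ ∧
    ∀ j, ((I (ω j)).digits.filter fun d => d.1 = (i₀ j).1).card = (I (ω j)).C := by
  have : ∀ j, ∃ d ∈ (I (ω j)).digits,
      ((I (ω j)).digits.filter fun e => e.1 = d.1).card = (I (ω j)).C := by
    intro j
    obtain ⟨a, ha⟩ := (I (ω j)).exists_card_column_eq_C
    obtain ⟨d, hd⟩ := Finset.card_pos.1 (ha ▸ (I (ω j)).one_le_C)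
    obtain ⟨hdD, rfl⟩ := Finset.mem_filter.1 hd
    exact ⟨d, hdD, ha⟩
  choose i₀ h1 h2 using this
  exact ⟨i₀, h1, h2⟩

/-- Pigeonhole: each ball of a cover contains the images of at most `n` indices. Injectivity of `f`
is not required. -/
lemma le_coveringNum_of_fiber_card_le {E : Type*} [PseudoMetricSpace E] {r : ℝ} (hr : 0 ≤ r)
    {X : Set E} {ι : Type*} (T : Finset ι) (f : ι → E) (hf : ∀ p ∈ T, f p ∈ X) {n : ℕ}
    (hfib : ∀ y : E, ∃ S : Finset ι, S.card ≤ n ∧ ∀ p ∈ T, dist (f p) y ≤ r → p ∈ S) :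
    (T.card : ℝ≥0∞) ≤ n * coveringNum r X := by
  classical
  rcases Nat.eq_zero_or_pos n with rfl | hn
  · rcases T.eq_empty_or_nonempty with rfl | ⟨p, hp⟩
    · simp
    · obtain ⟨S, hS, hmem⟩ := hfib (f p)
      have := hmem p hp (by simpa using hr)
      simp [Finset.card_eq_zero.1 (Nat.le_zero.1 hS)] at this
  rcases T.eq_empty_or_nonempty with rfl | ⟨p₀, -⟩
  · simp
  have : Nonempty E := ⟨f p₀⟩
  -- The upper quotient keeps the count a natural number, so that it can be compared with every
  -- cover, finite or not.
  have key : ((T.card ⌈/⌉ n : ℕ) : ℕ∞) ≤ Metric.externalCoveringNumber r.toNNReal X := by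
    refine le_iInf₂ fun C hC => ?_
    rcases C.finite_or_infinite with hfin | hinf
    · lift C to Finset E using hfin
      rw [Set.encard_coe_eq_coe_finsetCard]
      norm_cast
      rw [ceilDiv_le_iff_le_mul hn]
      have hex : ∀ p ∈ T, ∃ y ∈ C, dist (f p) y ≤ r := by
        intro p hp
        obtain ⟨y, hy, hpy⟩ := hC (hf p hp)
        refine ⟨y, hy, ?_⟩
        change edist (f p) y ≤ _ at hpy
        rw [edist_dist] at hpy
        exact (ENNReal.ofReal_le_ofReal_iff hr).1 hpy
      choose! g hgC hg using hex
      refine Finset.card_le_mul_card_image_of_maps_to (s := T) (t := C) hgC n fun y _ => ?_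
      obtain ⟨S, hS, hmem⟩ := hfib y
      refine (Finset.card_le_card fun p hp => ?_).trans hS
      obtain ⟨hpT, rfl⟩ := Finset.mem_filter.1 hp
      exact hmem p hpT (hg p hpT)
    · simp [hinf.encard_eq]
  have h1 : T.card ≤ n * (T.card ⌈/⌉ n) := by
    simpa using (ceilDiv_le_iff_le_mul hn).1 (le_refl (T.card ⌈/⌉ n))
  calc (T.card : ℝ≥0∞) ≤ ((n * (T.card ⌈/⌉ n) : ℕ) : ℝ≥0∞) := by exact_mod_cast h1
    _ = n * ((((T.card ⌈/⌉ n : ℕ) : ℕ∞)) : ℝ≥0∞) := by push_cast; rfl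
    _ ≤ n * coveringNum r X := by
        unfold coveringNum
        gcongr

/-- The lower estimate for the covering numbers of a carpet. -/
theorem exists_le_coveringNum_carpet (I : Λ → BMSystem) (ω : ℕ → Λ) : ∃ x ∈ carpet I ω,
    ∀ {κ k₁ k₂ l₁ l₂ : ℕ} {r R : ℝ}, k₂ ≤ l₂ → l₂ ≤ k₁ → k₁ ≤ l₁ →
      2 ≤ R * place (cols I ω) k₁ → 2 ≤ R * place (rows I ω) k₂ → 0 ≤ r →
      r * place (cols I ω) l₁ ≤ κ → r * place (rows I ω) l₂ ≤ κ →
      ((prodC I ω k₂ l₂ * prodB I ω k₁ l₁ : ℕ) : ℝ≥0∞) ≤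
        ((2 * κ + 2) ^ 2 : ℕ) * coveringNum r (carpet I ω ∩ Metric.closedBall x R) := by
  classical
  -- One code through a maximal column at every level gives a centre that serves all scales at once.
  obtain ⟨i₀, hi₀, hmax⟩ := exists_isCode_maximal_columns I ω
  refine ⟨codePoint I ω i₀, hi₀.codePoint_mem, ?_⟩
  intro κ k₁ k₂ l₁ l₂ r R hk₂ hl hk₁ hR₁ hR₂ hr hr₁ hr₂
  have hM := place_cast_pos (two_le_cols I ω)
  have hN := place_cast_pos (two_le_rows I ω)
  obtain ⟨T, hT, hex⟩ := exists_packing_squareIndex hi₀ hmax hk₂ hl hk₁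
  choose! c hc hcP hcidx using hex
  have hT' : ((prodC I ω k₂ l₂ * prodB I ω k₁ l₁ : ℕ) : ℝ≥0∞) ≤ T.card := by exact_mod_cast hT
  refine hT'.trans ?_
  refine le_coveringNum_of_fiber_card_le
    (X := carpet I ω ∩ Metric.closedBall (codePoint I ω i₀) R) hr T
    (fun p => codePoint I ω (c p)) (fun p hp => ⟨(hc p hp).codePoint_mem, ?_⟩) fun y => ?_
  · have hside : ∀ (p s t A : ℝ), 0 < p → 2 ≤ R * p → s ∈ Icc (A / p) ((A + 1) / p) →
        t ∈ Icc (A / p) ((A + 1) / p) → |s - t| ≤ R / 2 := by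
      intro p s t A hp hRp hs ht
      have h1 := (div_le_iff₀ hp).1 hs.1
      have h2 := (le_div_iff₀ hp).1 hs.2
      have h3 := (div_le_iff₀ hp).1 ht.1
      have h4 := (le_div_iff₀ hp).1 ht.2
      rw [abs_le]
      constructor <;> by_contra hcon <;> push Not at hcon <;> nlinarith
    refine dist_le_of_abs_sub_le ?_ ?_
    · refine hside _ _ _ _ (hM k₁) hR₁
        (expansion_mem_Icc (two_le_cols I ω) (hc p hp).fst_lt k₁) ?_
      rw [numeral_congr (u := fun j => (c p j).1) (v := fun j => (i₀ j).1) (hcP p hp).1]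
      exact expansion_mem_Icc (two_le_cols I ω) hi₀.fst_lt k₁
    · refine hside _ _ _ _ (hN k₂) hR₂
        (expansion_mem_Icc (two_le_rows I ω) (hc p hp).snd_lt k₂) ?_
      rw [numeral_congr (u := fun j => (c p j).2) (v := fun j => (i₀ j).2) (hcP p hp).2]
      exact expansion_mem_Icc (two_le_rows I ω) hi₀.snd_lt k₂
  · obtain ⟨S₁, hS₁, hc₁⟩ := exists_finset_near (hM l₁) hr hr₁ (y 0)
    obtain ⟨S₂, hS₂, hc₂⟩ := exists_finset_near (hN l₂) hr hr₂ (y 1)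
    refine ⟨S₁ ×ˢ S₂, ?_, fun p hp hdist => ?_⟩
    · rw [Finset.card_product, sq]
      exact Nat.mul_le_mul hc₁ hc₂
    · rw [← hcidx p hp]
      exact Finset.mem_product.2
        ⟨hS₁ _ _ (abs_sub_le_of_dist_le hdist 0)
          (expansion_mem_Icc (two_le_cols I ω) (hc p hp).fst_lt l₁),
        hS₂ _ _ (abs_sub_le_of_dist_le hdist 1)
          (expansion_mem_Icc (two_le_rows I ω) (hc p hp).snd_lt l₂)⟩

end Packing

/-! ## Uniform deviation estimates for windows of an i.i.d. sequence -/

section Deviations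

variable {Λ : Type*} [Fintype Λ] [MeasurableSpace Λ] [MeasurableSingletonClass Λ]
  (μ : Measure Λ) [IsProbabilityMeasure μ]

instance : IsProbabilityMeasure (iidLaw μ) := by unfold iidLaw; infer_instance

lemma hasSubgaussianMGF_eval {Z : Λ → ℝ} (hZ : ∫ l, Z l ∂μ = 0) {D : ℝ} (hD : ∀ l, |Z l| ≤ D)
    (j : ℕ) :
    ProbabilityTheory.HasSubgaussianMGF (fun ω : ℕ → Λ => Z (ω j)) (‖D‖₊ ^ 2) (iidLaw μ) := by
  have hmap : (iidLaw μ).map (fun ω : ℕ → Λ => ω j) = μ := Measure.infinitePi_map_eval _ j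
  have hmeas : Measurable Z := .of_discrete
  have h := ProbabilityTheory.hasSubgaussianMGF_of_mem_Icc_of_integral_eq_zero (μ := iidLaw μ)
    (X := fun ω : ℕ → Λ => Z (ω j)) (a := -D) (b := D)
    (hmeas.comp (measurable_pi_apply j)).aemeasurable (ae_of_all _ fun ω => abs_le.1 (hD (ω j))) ?_
  · have h2 : ‖D - -D‖₊ / 2 = ‖D‖₊ := by
      rw [sub_neg_eq_add, ← two_mul, nnnorm_mul]
      simp
    rwa [h2] at h
  · have := integral_map (μ := iidLaw μ) (φ := fun ω : ℕ → Λ => ω j) (f := Z)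
      (measurable_pi_apply j).aemeasurable hmeas.aestronglyMeasurable
    rw [hmap, hZ] at this
    exact this.symm

omit [Fintype Λ] [MeasurableSingletonClass Λ] in
lemma iIndepFun_coordinates :
    ProbabilityTheory.iIndepFun (fun (j : ℕ) (ω : ℕ → Λ) => ω j) (iidLaw μ) :=
  ProbabilityTheory.iIndepFun_infinitePi (P := fun _ : ℕ => μ) (X := fun _ => id)
    fun _ => measurable_id

lemma iIndepFun_eval (Z : Λ → ℝ) :
    ProbabilityTheory.iIndepFun (fun (j : ℕ) (ω : ℕ → Λ) => Z (ω j)) (iidLaw μ) := by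
  have hmeas : Measurable Z := .of_discrete
  exact ProbabilityTheory.iIndepFun_infinitePi (P := fun _ : ℕ => μ) (X := fun _ => Z)
    fun _ => hmeas

/-- Hoeffding gives the exponent `-(εL + a)² / (2LD²)`. After expansion of the square, the cross
term decays in `a` at a rate independent of `L`, and the term in `a²` is dropped. -/
lemma measure_window_sum_ge_le {Z : Λ → ℝ} (hZ : ∫ l, Z l ∂μ = 0) {D : ℝ} (hD0 : 0 < D)
    (hD : ∀ l, |Z l| ≤ D) {ε a : ℝ} (hε : 0 < ε) (ha : 0 ≤ a) (k L : ℕ) :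
    (iidLaw μ).real {ω | ε * L + a ≤ ∑ j ∈ Finset.Ico k (k + L), Z (ω j)} ≤
      Real.exp (-(ε ^ 2 / (2 * D ^ 2)) * L) * Real.exp (-(ε / D ^ 2) * a) := by
  rcases Nat.eq_zero_or_pos L with rfl | hL
  · simp only [Nat.cast_zero, mul_zero, zero_add, add_zero, Finset.Ico_self, Finset.sum_empty,
      Real.exp_zero, one_mul]
    rcases ha.eq_or_lt with rfl | ha
    · simp
    · simp only [not_le.2 ha, ofPred_false, measureReal_empty]
      positivity
  · have hL' : (0 : ℝ) < L := by exact_mod_cast hL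
    have h := ProbabilityTheory.HasSubgaussianMGF.measure_sum_ge_le_of_iIndepFun
      (iIndepFun_eval μ Z) (s := Finset.Ico k (k + L)) (c := fun _ => ‖D‖₊ ^ 2)
      (fun j _ => hasSubgaussianMGF_eval μ hZ hD j) (ε := ε * L + a) (by positivity)
    refine h.trans ?_
    rw [← Real.exp_add, Real.exp_le_exp]
    simp only [Finset.sum_const, Nat.card_Ico, add_tsub_cancel_left, nsmul_eq_mul,
      NNReal.coe_mul, NNReal.coe_natCast, NNReal.coe_pow, coe_nnnorm, Real.norm_eq_abs, sq_abs]
    rw [div_le_iff₀ (by positivity)]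
    have : (-(ε ^ 2 / (2 * D ^ 2)) * L + -(ε / D ^ 2) * a) * (2 * (L * D ^ 2)) =
      -(ε * L) ^ 2 - 2 * (ε * L) * a := by field_simp; ring
    rw [this]
    nlinarith [sq_nonneg a]

lemma ae_window_sum_le {Z : Λ → ℝ} (hZ : ∫ l, Z l ∂μ = 0) {ε : ℝ} (hε : 0 < ε) :
    ∀ᵐ ω ∂(iidLaw μ), ∃ A : ℝ, 0 ≤ A ∧ ∀ k L : ℕ,
      ∑ j ∈ Finset.Ico k (k + L), Z (ω j) ≤ ε * L + A * (1 + Real.log (k + 1)) := by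
  obtain ⟨D, hD0, hD⟩ : ∃ D : ℝ, 0 < D ∧ ∀ l, |Z l| ≤ D :=
    ⟨1 + ∑ l, |Z l|, by positivity, fun l => by
      linarith [Finset.single_le_sum (f := fun l => |Z l|) (fun l _ => abs_nonneg _)
        (Finset.mem_univ l)]⟩
  set q := ε ^ 2 / (2 * D ^ 2) with hq
  have hq0 : 0 < q := by positivity
  -- Chosen so that `(ε / D²) A₀ = 2`: the bad windows at position `k` then have probability at most
  -- `(k + 1)⁻² exp (-qL)`, summable over both indices.
  set A₀ := 2 * D ^ 2 / ε with hA₀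
  have hA₀pos : 0 < A₀ := by positivity
  have hlog : ∀ k : ℕ, 0 ≤ Real.log ((k : ℝ) + 1) := fun k =>
    Real.log_nonneg (by linarith [Nat.cast_nonneg (α := ℝ) k])
  let s : ℕ × ℕ → Set (ℕ → Λ) := fun p =>
    {ω | ε * p.2 + A₀ * Real.log (p.1 + 1) ≤ ∑ j ∈ Finset.Ico p.1 (p.1 + p.2), Z (ω j)}
  have hbound : ∀ p : ℕ × ℕ, (iidLaw μ).real (s p) ≤
      1 / ((p.1 : ℝ) + 1) ^ 2 * Real.exp (-q) ^ p.2 := by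
    intro p
    refine (measure_window_sum_ge_le μ hZ hD0 hD hε (mul_nonneg hA₀pos.le (hlog p.1))
      p.1 p.2).trans (le_of_eq ?_)
    have h1 : -(ε / D ^ 2) * (A₀ * Real.log (p.1 + 1)) = -(2 * Real.log (p.1 + 1)) := by
      rw [hA₀]; field_simp
    rw [h1, ← Real.exp_nat_mul, mul_comm (p.2 : ℝ), mul_comm, Real.exp_neg, mul_comm (2 : ℝ),
      Real.exp_mul, Real.exp_log (by positivity), one_div]
    norm_cast
  have hsum : Summable fun p : ℕ × ℕ => 1 / ((p.1 : ℝ) + 1) ^ 2 * Real.exp (-q) ^ p.2 := by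
    refine Summable.mul_of_nonneg (f := fun k : ℕ => 1 / ((k : ℝ) + 1) ^ 2)
      (g := fun L : ℕ => Real.exp (-q) ^ L) ?_ ?_ (fun k => by positivity) fun k => by positivity
    · have := (summable_nat_add_iff 1).2 (Real.summable_one_div_nat_pow.2 one_lt_two)
      simpa using this
    · exact summable_geometric_of_lt_one (Real.exp_pos _).le (Real.exp_lt_one_iff.2 (by linarith))
  have hfin : ∑' p, (iidLaw μ) (s p) ≠ ∞ := by
    have hs' : Summable fun p => (iidLaw μ).real (s p) :=
      Summable.of_nonneg_of_le (fun _ => measureReal_nonneg) hbound hsum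
    have : ∀ p, (iidLaw μ) (s p) = ENNReal.ofReal ((iidLaw μ).real (s p)) := fun p => by simp
    simp_rw [this]
    exact hs'.tsum_ofReal_ne_top
  filter_upwards [ae_finite_setOfPred_mem hfin] with ω hω
  -- By Borel–Cantelli only finitely many windows are bad; a bound `K` for their sums is absorbed
  -- into `A`.
  obtain ⟨K, hK⟩ := (hω.image fun p : ℕ × ℕ => ∑ j ∈ Finset.Ico p.1 (p.1 + p.2), Z (ω j)).bddAbove
  refine ⟨max A₀ K, le_max_of_le_left hA₀pos.le, fun k L => ?_⟩
  have hA : 0 ≤ max A₀ K := le_max_of_le_left hA₀pos.le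
  have hεL : 0 ≤ ε * L := by positivity
  by_cases hmem : ω ∈ s (k, L)
  · have : ∑ j ∈ Finset.Ico k (k + L), Z (ω j) ≤ K := hK ⟨(k, L), hmem, rfl⟩
    nlinarith [le_max_right A₀ K, mul_nonneg hA (hlog k)]
  · simp only [s, mem_ofPred_eq, not_le] at hmem
    nlinarith [mul_le_mul_of_nonneg_right (le_max_left A₀ K) (hlog k)]

/-- The sums of `Z` over all windows of the sequence `ω` are at most a small multiple of the length
plus a multiple of the logarithm of the position. -/
def HasSmallWindowSums (Z : Λ → ℝ) (ω : ℕ → Λ) : Prop :=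
  ∀ ε : ℝ, 0 < ε → ∃ A : ℝ, 0 ≤ A ∧ ∀ k l : ℕ, k ≤ l →
    |∑ j ∈ Finset.Ico k l, Z (ω j)| ≤ ε * ((l : ℝ) - k) + A * (1 + Real.log (k + 1))

/-- The values `ε = 1 / (n + 1)` suffice, so a single null set serves all `ε`; the lower bounds come
from `-Z`. -/
theorem ae_hasSmallWindowSums {Z : Λ → ℝ} (hZ : ∫ l, Z l ∂μ = 0) :
    ∀ᵐ ω ∂(iidLaw μ), HasSmallWindowSums Z ω := by
  have h1 : ∀ᵐ ω ∂(iidLaw μ), ∀ n : ℕ, ∃ A : ℝ, 0 ≤ A ∧ ∀ k L : ℕ,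
      ∑ j ∈ Finset.Ico k (k + L), Z (ω j) ≤ 1 / ((n : ℝ) + 1) * L + A * (1 + Real.log (k + 1)) :=
    ae_all_iff.2 fun n => ae_window_sum_le μ hZ (by positivity)
  have h2 : ∀ᵐ ω ∂(iidLaw μ), ∀ n : ℕ, ∃ A : ℝ, 0 ≤ A ∧ ∀ k L : ℕ,
      ∑ j ∈ Finset.Ico k (k + L), -Z (ω j) ≤ 1 / ((n : ℝ) + 1) * L + A * (1 + Real.log (k + 1)) :=
    ae_all_iff.2 fun n => ae_window_sum_le μ (Z := fun l => -Z l)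
      (by rw [integral_neg, hZ, neg_zero]) (by positivity)
  filter_upwards [h1, h2] with ω hω₁ hω₂ ε hε
  obtain ⟨n, hn⟩ := exists_nat_one_div_lt hε
  obtain ⟨A, hA0, hA⟩ := hω₁ n
  obtain ⟨A', hA0', hA'⟩ := hω₂ n
  refine ⟨A + A', by positivity, fun k l hkl => ?_⟩
  obtain ⟨L, rfl⟩ := Nat.exists_eq_add_of_le hkl
  have h1 := hA k L
  have h2 := hA' k L
  rw [Finset.sum_neg_distrib] at h2
  have hlog : 0 ≤ Real.log ((k : ℝ) + 1) :=
    Real.log_nonneg (by linarith [Nat.cast_nonneg (α := ℝ) k])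
  have hL : 1 / ((n : ℝ) + 1) * L ≤ ε * L := by gcongr
  have e : ((k + L : ℕ) : ℝ) - k = L := by push_cast; ring
  rw [e, abs_le]
  constructor <;> nlinarith [mul_nonneg hA0 hlog, mul_nonneg hA0' hlog]

end Deviations

/-! ## Levels -/

/-- The first level at which the place value is at least `t`. -/
def level (b : ℕ → ℕ) (t : ℝ) : ℕ := sInf {k | t ≤ place b k}

section Level

variable {b : ℕ → ℕ} (hb : ∀ j, 2 ≤ b j)
include hb

lemma le_place_level (t : ℝ) : t ≤ place b (level b t) := by
  refine Nat.sInf_mem (s := {k : ℕ | t ≤ place b k}) ?_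
  obtain ⟨k, hk⟩ := pow_unbounded_of_one_lt t one_lt_two
  refine ⟨k, hk.le.trans ?_⟩
  exact_mod_cast two_pow_le_place hb k

omit hb in
lemma level_le {t : ℝ} {k : ℕ} (h : t ≤ place b k) : level b t ≤ k := Nat.sInf_le h

omit hb in
lemma place_lt_of_lt_level {t : ℝ} {k : ℕ} (h : k < level b t) : (place b k : ℝ) < t :=
  not_le.1 fun h' => (level_le h').not_gt h

lemma level_mono {s t : ℝ} (h : s ≤ t) : level b s ≤ level b t :=
  level_le (h.trans (le_place_level hb t))

lemma place_level_le {β : ℕ} (hβ : ∀ j, b j ≤ β) {t : ℝ} (ht : 1 ≤ t) :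
    (place b (level b t) : ℝ) ≤ β * t := by
  have hβ1 : (1 : ℝ) ≤ β := by exact_mod_cast (one_le_two.trans (hb 0)).trans (hβ 0)
  rcases Nat.eq_zero_or_pos (level b t) with h | h
  · rw [h]
    simp only [place_zero, Nat.cast_one]
    nlinarith
  · obtain ⟨k, hk⟩ := Nat.exists_eq_succ_of_ne_zero h.ne'
    have hlt := place_lt_of_lt_level (b := b) (t := t) (k := k) (by omega)
    have h2 : (b k : ℝ) ≤ β := by exact_mod_cast hβ k
    rw [hk, Nat.succ_eq_add_one, place_succ]
    push_cast
    nlinarith [Nat.cast_nonneg (α := ℝ) (place b k)]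

lemma level_place (k : ℕ) : level b (place b k) = k := by
  refine le_antisymm (level_le le_rfl) ?_
  have h := le_place_level hb (place b k)
  exact (place_strictMono hb).le_iff_le.1 (by exact_mod_cast h)

end Level

/-! ## Independence of a run from the past -/

section Runs

variable {Λ : Type*}

/-- The sequence `ω` is constantly `c` on the window of length `L` that starts at `k`. -/
def IsRun (c : Λ) (k L : ℕ) (ω : ℕ → Λ) : Prop := ∀ j, k ≤ j → j < k + L → ω j = c

/-- The function `f` is determined by the part of the sequence before the stopping time `τ`. -/
def DeterminedBefore {β : Type*} (τ : (ℕ → Λ) → ℕ) (f : (ℕ → Λ) → β) : Prop :=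
  ∀ ω ω' : ℕ → Λ, (∀ j < τ ω, ω j = ω' j) → f ω' = f ω

open Classical in
/-- The indicator function of a property, with values in the extended nonnegative reals. -/
def ind (P : (ℕ → Λ) → Prop) (ω : ℕ → Λ) : ℝ≥0∞ := if P ω then 1 else 0

lemma ind_le_one (P : (ℕ → Λ) → Prop) (ω : ℕ → Λ) : ind P ω ≤ 1 := by
  unfold ind; split_ifs <;> simp

lemma ind_congr {P Q : (ℕ → Λ) → Prop} {ω ω' : ℕ → Λ} (h : P ω ↔ Q ω') :
    ind P ω = ind Q ω' := by
  unfold ind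
  by_cases hP : P ω
  · rw [if_pos hP, if_pos (h.1 hP)]
  · rw [if_neg hP, if_neg fun hQ => hP (h.2 hQ)]

lemma DeterminedBefore.mul {τ : (ℕ → Λ) → ℕ} {f g : (ℕ → Λ) → ℝ≥0∞} (hf : DeterminedBefore τ f)
    (hg : DeterminedBefore τ g) : DeterminedBefore τ fun ω => f ω * g ω := fun ω ω' h => by
  simp only [hf ω ω' h, hg ω ω' h]

variable [Fintype Λ] [MeasurableSpace Λ] [MeasurableSingletonClass Λ]
  (μ : Measure Λ) [IsProbabilityMeasure μ]

omit [Fintype Λ] [MeasurableSpace Λ] [MeasurableSingletonClass Λ] in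
lemma DeterminedBefore.exists_eq_comp {β : Type*} [Nonempty β] {k : ℕ} {f : (ℕ → Λ) → β}
    (hf : DeterminedBefore (fun _ => k) f) :
    ∃ g : (Finset.range k → Λ) → β, f = fun ω => g fun i => ω i := by
  have h : DependsOn f (Finset.range k : Set ℕ) := fun ω ω' h =>
    (hf ω ω' fun j hj => h j (by simpa using hj)).symm
  obtain ⟨g, hg⟩ := dependsOn_iff_exists_comp.1 h
  exact ⟨g, hg⟩

omit [Fintype Λ] in
lemma DeterminedBefore.measurable_const [Finite Λ] {β : Type*} [Nonempty β] [MeasurableSpace β]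
    {k : ℕ} {f : (ℕ → Λ) → β} (hf : DeterminedBefore (fun _ => k) f) : Measurable f := by
  obtain ⟨g, rfl⟩ := hf.exists_eq_comp
  have hg : Measurable g := .of_discrete
  exact hg.comp (by fun_prop)

omit [Fintype Λ] in
lemma iidLaw_isRun (c : Λ) (k L : ℕ) : iidLaw μ {ω | IsRun c k L ω} = μ {c} ^ L := by
  have : {ω : ℕ → Λ | IsRun c k L ω} = Set.pi (Finset.Ico k (k + L) : Set ℕ) fun _ => {c} := by
    ext ω
    simp [IsRun, Set.mem_pi]
  rw [this]
  unfold iidLaw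
  rw [Measure.infinitePi_pi _ fun _ _ => measurableSet_singleton c]
  simp

lemma measurable_ind_isRun (c : Λ) (k L : ℕ) : Measurable (ind (IsRun c k L)) := by
  refine DeterminedBefore.measurable_const (k := k + L) fun ω ω' h => ?_
  have : IsRun c k L ω' ↔ IsRun c k L ω := by
    refine forall_congr' fun j => forall_congr' fun _ => forall_congr' fun hj => ?_
    rw [h j hj]
  exact ind_congr this

/-- The two factors depend on disjoint blocks of coordinates, before `k` and from `k` on, and are
therefore independent. -/
lemma lintegral_mul_ind_isRun_of_const {k : ℕ} {f : (ℕ → Λ) → ℝ≥0∞}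
    (hf : DeterminedBefore (fun _ => k) f) (c : Λ) (L : ℕ) :
    ∫⁻ ω, f ω * ind (IsRun c k L) ω ∂(iidLaw μ) = μ {c} ^ L * ∫⁻ ω, f ω ∂(iidLaw μ) := by
  classical
  have hmeas := hf.measurable_const
  have hind : ∫⁻ ω, ind (IsRun c k L) ω ∂(iidLaw μ) = μ {c} ^ L := by
    rw [← iidLaw_isRun μ c k L, ← lintegral_indicator_one₀]
    · rfl
    · refine MeasurableSet.nullMeasurableSet ?_
      have : {ω : ℕ → Λ | IsRun c k L ω} = ind (IsRun c k L) ⁻¹' {1} := by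
        ext ω
        simp [ind]
      rw [this]
      exact measurable_ind_isRun c k L (measurableSet_singleton 1)
  have hindep : ProbabilityTheory.IndepFun f (ind (IsRun c k L)) (iidLaw μ) := by
    have h := ProbabilityTheory.iIndepFun.indepFun_finset (Finset.range k) (Finset.Ico k (k + L))
      (by
        rw [Finset.disjoint_left]
        intro j hj hj'
        simp at hj hj'
        omega)
      (iIndepFun_coordinates μ) (fun j => measurable_pi_apply j)
    obtain ⟨g, rfl⟩ := hf.exists_eq_comp
    have hg : Measurable g := .of_discrete
    let u : (Finset.Ico k (k + L) → Λ) → ℝ≥0∞ := fun y => if ∀ i, y i = c then 1 else 0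
    have hu : Measurable u := .of_discrete
    have hcomp : ind (IsRun c k L) = u ∘ fun (ω : ℕ → Λ) (i : Finset.Ico k (k + L)) => ω i := by
      ext ω
      simp only [ind, IsRun, u, Function.comp_apply, Subtype.forall, Finset.mem_Ico, and_imp]
      congr
    rw [hcomp]
    exact h.comp hg hu
  have := ProbabilityTheory.lintegral_mul_eq_lintegral_mul_lintegral_of_indepFun hmeas
    (measurable_ind_isRun c k L) hindep
  simp only [Pi.mul_apply] at this
  rw [this, hind, mul_comm]

omit [Fintype Λ] [MeasurableSpace Λ] [MeasurableSingletonClass Λ] in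
-- Whether `τ = k` is decided by the coordinates before `k`, and on that event so is `f`. This
-- reduces stopping times to fixed times.
lemma DeterminedBefore.ind_eq_mul {τ : (ℕ → Λ) → ℕ} (hτ : DeterminedBefore τ τ)
    {f : (ℕ → Λ) → ℝ≥0∞} (hf : DeterminedBefore τ f) (k : ℕ) :
    DeterminedBefore (fun _ => k) fun ω => f ω * ind (fun ω => τ ω = k) ω := by
  intro ω ω' h
  by_cases h1 : τ ω = k
  · have e := hτ ω ω' (by rwa [h1])
    simp [ind, e, h1, hf ω ω' (by rwa [h1])]
  · by_cases h2 : τ ω' = k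
    · exact absurd (hτ ω' ω (by rw [h2]; exact fun j hj => (h j hj).symm)) (by rw [h2]; exact h1)
    · simp [ind, h1, h2]

omit [Fintype Λ] [MeasurableSpace Λ] [MeasurableSingletonClass Λ] in
lemma eq_tsum_mul_ind (τ : (ℕ → Λ) → ℕ) (f : (ℕ → Λ) → ℝ≥0∞) (ω : ℕ → Λ) :
    f ω = ∑' k, f ω * ind (fun ω => τ ω = k) ω := by
  rw [tsum_eq_single (τ ω)]
  · simp [ind]
  · intro k hk
    simp [ind, hk.symm]

lemma DeterminedBefore.measurable {τ : (ℕ → Λ) → ℕ} (hτ : DeterminedBefore τ τ)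
    {f : (ℕ → Λ) → ℝ≥0∞} (hf : DeterminedBefore τ f) : Measurable f := by
  rw [show f = fun ω => ∑' k, f ω * ind (fun ω => τ ω = k) ω from
    funext fun ω => eq_tsum_mul_ind τ f ω]
  exact Measurable.tsum fun k => (hτ.ind_eq_mul hf k).measurable_const

/-- A run that starts at a stopping time is independent of the past. -/
lemma lintegral_mul_ind_isRun {τ : (ℕ → Λ) → ℕ} (hτ : DeterminedBefore τ τ)
    {f : (ℕ → Λ) → ℝ≥0∞} (hf : DeterminedBefore τ f) (c : Λ) (L : ℕ) :
    ∫⁻ ω, f ω * ind (fun ω => IsRun c (τ ω) L ω) ω ∂(iidLaw μ) =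
      μ {c} ^ L * ∫⁻ ω, f ω ∂(iidLaw μ) := by
  -- Split according to the value `k` of the stopping time; each piece is an instance of the case of
  -- a fixed time.
  have h1 : ∀ ω, f ω * ind (fun ω => IsRun c (τ ω) L ω) ω =
      ∑' k, f ω * ind (fun ω => τ ω = k) ω * ind (IsRun c k L) ω := by
    intro ω
    rw [tsum_eq_single (τ ω)]
    · simp [ind]
    · intro k hk
      simp [ind, hk.symm]
  simp_rw [h1]
  have hmeas : ∀ k, Measurable fun ω => f ω * ind (fun ω => τ ω = k) ω * ind (IsRun c k L) ω :=
    fun k => (hτ.ind_eq_mul hf k).measurable_const.mul (measurable_ind_isRun c k L)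
  rw [lintegral_tsum fun k => (hmeas k).aemeasurable]
  simp_rw [lintegral_mul_ind_isRun_of_const μ (hτ.ind_eq_mul hf _)]
  rw [ENNReal.tsum_mul_left, ← lintegral_tsum fun k =>
    (hτ.ind_eq_mul hf k).measurable_const.aemeasurable]
  simp_rw [← eq_tsum_mul_ind]

end Runs

/-! ### Pairs of runs at fixed and at stopping times -/

section PairedRuns

variable {Λ : Type*}

lemma DeterminedBefore.mono {β : Type*} {σ τ : (ℕ → Λ) → ℕ} {f : (ℕ → Λ) → β}
    (hf : DeterminedBefore σ f) (h : ∀ ω, σ ω ≤ τ ω) : DeterminedBefore τ f :=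
  fun ω ω' hω => hf ω ω' fun j hj => hω j (hj.trans_le (h ω))

lemma determinedBefore_ind_isRun (c : Λ) (k L : ℕ) :
    DeterminedBefore (fun _ => k + L) (ind (IsRun c k L)) := by
  intro ω ω' h
  refine ind_congr (forall_congr' fun j => forall_congr' fun _ => forall_congr' fun hj => ?_)
  rw [h j hj]

lemma DeterminedBefore.ind_isRun {τ : (ℕ → Λ) → ℕ} (hτ : DeterminedBefore τ τ) (c : Λ) (L : ℕ) :
    DeterminedBefore (fun ω => τ ω + L) (ind fun ω => IsRun c (τ ω) L ω) := by
  intro ω ω' h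
  have e := hτ ω ω' fun j hj => h j (Nat.lt_add_right L hj)
  refine ind_congr ?_
  rw [e]
  refine forall_congr' fun j => forall_congr' fun _ => forall_congr' fun hj => ?_
  rw [h j hj]

lemma DeterminedBefore.const_sub {τ : (ℕ → Λ) → ℕ} {f : (ℕ → Λ) → ℝ≥0∞}
    (hf : DeterminedBefore τ f) (a b : ℝ≥0∞) : DeterminedBefore τ fun ω => a - b * f ω :=
  fun ω ω' h => by simp only [hf ω ω' h]

lemma determinedBefore_finset_prod {τ : (ℕ → Λ) → ℕ} {ι : Type*} {s : Finset ι}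
    {f : ι → (ℕ → Λ) → ℝ≥0∞} (h : ∀ i ∈ s, DeterminedBefore τ (f i)) :
    DeterminedBefore τ fun ω => ∏ i ∈ s, f i ω :=
  fun ω ω' hω => Finset.prod_congr rfl fun i hi => h i hi ω ω' hω

lemma mul_one_sub_add_mul (F x : ℝ≥0∞) (hx : x ≤ 1) : F * (1 - x) + F * x = F := by
  rw [← mul_add, tsub_add_cancel_of_le hx, mul_one]

variable [Fintype Λ] [MeasurableSpace Λ] [MeasurableSingletonClass Λ]
  (μ : Measure Λ) [IsProbabilityMeasure μ]

/-- Under the integral, the indicator of a run may be replaced by its probability, because the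
weights are known before the run starts. As subtraction truncates, both sides are completed to `∫ F`
by the same finite term, which is then cancelled. -/
lemma lintegral_mul_one_sub_ind {τ : (ℕ → Λ) → ℕ} (hτ : DeterminedBefore τ τ)
    {F w : (ℕ → Λ) → ℝ≥0∞} (hF : DeterminedBefore τ F) (hw : DeterminedBefore τ w)
    (hF1 : ∀ ω, F ω ≤ 1) (hw1 : ∀ ω, w ω ≤ 1) (c : Λ) (L : ℕ) :
    ∫⁻ ω, F ω * (1 - w ω * ind (fun ω => IsRun c (τ ω) L ω) ω) ∂(iidLaw μ) =
      ∫⁻ ω, F ω * (1 - μ {c} ^ L * w ω) ∂(iidLaw μ) := by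
  have hq : μ {c} ^ L ≤ 1 := pow_le_one₀ zero_le prob_le_one
  have hFw := hF.mul hw
  have hFwm : Measurable fun ω => F ω * w ω := hτ.measurable hFw
  have hvm : Measurable (ind fun ω => IsRun c (τ ω) L ω) :=
    DeterminedBefore.measurable (τ := fun ω => τ ω + L)
      (fun ω ω' h => congrArg (· + L) (hτ ω ω' fun j hj => h j (Nat.lt_add_right L hj))) (hτ.ind_isRun c L)
  have hFwvm : Measurable fun ω => F ω * w ω * ind (fun ω => IsRun c (τ ω) L ω) ω := hFwm.mul hvm
  have h1 : ∫⁻ ω, F ω * (1 - w ω * ind (fun ω => IsRun c (τ ω) L ω) ω) ∂(iidLaw μ) +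
      μ {c} ^ L * ∫⁻ ω, F ω * w ω ∂(iidLaw μ) = ∫⁻ ω, F ω ∂(iidLaw μ) := by
    rw [← lintegral_mul_ind_isRun μ hτ hFw c L, ← lintegral_add_right _ hFwvm]
    refine lintegral_congr fun ω => ?_
    rw [mul_assoc]
    exact mul_one_sub_add_mul _ _ (mul_le_one₀ (hw1 ω) zero_le (ind_le_one _ ω))
  have h2 : ∫⁻ ω, F ω * (1 - μ {c} ^ L * w ω) ∂(iidLaw μ) +
      μ {c} ^ L * ∫⁻ ω, F ω * w ω ∂(iidLaw μ) = ∫⁻ ω, F ω ∂(iidLaw μ) := by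
    rw [← lintegral_const_mul _ hFwm, ← lintegral_add_right _ (hFwm.const_mul _)]
    refine lintegral_congr fun ω => ?_
    rw [mul_left_comm]
    exact mul_one_sub_add_mul _ _ (mul_le_one₀ hq zero_le (hw1 ω))
  have hfin : μ {c} ^ L * ∫⁻ ω, F ω * w ω ∂(iidLaw μ) ≠ ∞ := by
    refine ne_top_of_le_ne_top ENNReal.one_ne_top (mul_le_one₀ hq zero_le ?_)
    calc ∫⁻ ω, F ω * w ω ∂(iidLaw μ) ≤ ∫⁻ _, 1 ∂(iidLaw μ) :=
          lintegral_mono fun ω => mul_le_one₀ (hF1 ω) zero_le (hw1 ω)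
      _ = 1 := by simp
  exact (ENNReal.add_left_inj hfin).1 (h1.trans h2.symm)

/-- Runs of `c` at fixed positions and runs of `b` at later stopping times: the probability that
they never occur simultaneously. -/
theorem measure_no_paired_runs_le (b c : Λ) {τ : ℕ → (ℕ → Λ) → ℕ} {κ : ℕ → ℕ} {K L n : ℕ}
    (hτ : ∀ i, DeterminedBefore (τ i) (τ i)) (hK : ∀ i ω, K ≤ τ i ω)
    (hτs : ∀ i ω, τ i ω + L ≤ τ (i + 1) ω) (hκs : ∀ i, κ i + L ≤ κ (i + 1))
    (hκ : ∀ i < n, κ i + L ≤ K) :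
    iidLaw μ {ω | ∀ i < n, ¬ (IsRun c (κ i) L ω ∧ IsRun b (τ i ω) L ω)} ≤
      (1 - μ {b} ^ L * μ {c} ^ L) ^ n := by
  set q := μ {b} ^ L with hq
  have hq1 : q ≤ 1 := pow_le_one₀ zero_le prob_le_one
  set w : ℕ → (ℕ → Λ) → ℝ≥0∞ := fun i => ind (IsRun c (κ i) L) with hw
  set v : ℕ → (ℕ → Λ) → ℝ≥0∞ := fun i => ind fun ω => IsRun b (τ i ω) L ω with hv
  have hτmono : ∀ ω, Monotone fun i => τ i ω := fun ω =>
    monotone_nat_of_le_succ fun i => by have := hτs i ω; omega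
  have hκmono : Monotone κ := monotone_nat_of_le_succ fun i => by have := hκs i; omega
  have hτlt : ∀ {i m}, i < m → ∀ ω, τ i ω + L ≤ τ m ω := fun {i m} him ω =>
    (hτs i ω).trans (hτmono ω him)
  have hκlt : ∀ {i m}, i < m → κ i + L ≤ κ m := fun {i m} him => (hκs i).trans (hκmono him)
  have hwK : ∀ i < n, DeterminedBefore (fun _ => K) (w i) := fun i hi =>
    (determinedBefore_ind_isRun c (κ i) L).mono fun _ => hκ i hi
  have hfail : ∀ m ≤ n, ∀ i < m, DeterminedBefore (τ m) fun ω => 1 - w i ω * v i ω := by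
    intro m hm i hi
    have h1 := (hwK i (by omega)).mono (τ := τ m) (hK m)
    have h2 := ((hτ i).ind_isRun b L).mono (τ := τ m) (hτlt hi)
    intro ω ω' h
    simp only [hv, h1 ω ω' h, h2 ω ω' h]
  -- The runs at stopping times are integrated out, the last one first. The factor `1 - q w` that
  -- replaces one depends only on coordinates before `K` and joins `f`; this is why the claim is
  -- made for general `f`.
  have claim₁ : ∀ m ≤ n, ∀ f : (ℕ → Λ) → ℝ≥0∞, DeterminedBefore (fun _ => K) f →
      (∀ ω, f ω ≤ 1) →
      ∫⁻ ω, f ω * ∏ i ∈ Finset.range m, (1 - w i ω * v i ω) ∂(iidLaw μ) =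
        ∫⁻ ω, f ω * ∏ i ∈ Finset.range m, (1 - q * w i ω) ∂(iidLaw μ) := by
    intro m
    induction m with
    | zero => simp
    | succ m ih =>
      intro hm f hf hf1
      have h1 := lintegral_mul_one_sub_ind μ (hτ m)
        (F := fun ω => f ω * ∏ i ∈ Finset.range m, (1 - w i ω * v i ω)) (w := w m)
        ((hf.mono (hK m)).mul (determinedBefore_finset_prod fun i hi =>
          hfail m (by omega) i (Finset.mem_range.1 hi)))
        ((hwK m (by omega)).mono (hK m))
        (fun ω => mul_le_one₀ (hf1 ω) zero_le (Finset.prod_le_one' fun i _ => tsub_le_self))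
        (fun ω => ind_le_one _ ω) b L
      have h2 := ih (by omega) (fun ω => f ω * (1 - q * w m ω))
        (hf.mul ((hwK m (by omega)).const_sub 1 q))
        fun ω => mul_le_one₀ (hf1 ω) zero_le tsub_le_self
      simp only [Finset.prod_range_succ]
      calc _ = ∫⁻ ω, f ω * (∏ i ∈ Finset.range m, (1 - w i ω * v i ω)) * (1 - w m ω * v m ω)
            ∂(iidLaw μ) := by simp only [mul_assoc]
        _ = _ := h1
        _ = ∫⁻ ω, f ω * (1 - q * w m ω) * ∏ i ∈ Finset.range m, (1 - w i ω * v i ω)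
            ∂(iidLaw μ) := lintegral_congr fun ω => by rw [mul_right_comm]
        _ = _ := h2
        _ = _ := lintegral_congr fun ω => by rw [mul_assoc, mul_comm (1 - q * w m ω)]
  -- Only runs at fixed positions with disjoint windows are left. The same replacement applies with
  -- a constant time and the constant weight `q`.
  have claim₂ : ∀ m ≤ n, ∫⁻ ω, ∏ i ∈ Finset.range m, (1 - q * w i ω) ∂(iidLaw μ) =
      (1 - q * μ {c} ^ L) ^ m := by
    intro m
    induction m with
    | zero => simp
    | succ m ih =>
      intro hm
      have hdet : DeterminedBefore (fun _ => κ m)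
          fun ω => ∏ i ∈ Finset.range m, (1 - q * w i ω) :=
        determinedBefore_finset_prod fun i hi => DeterminedBefore.const_sub
          ((determinedBefore_ind_isRun c (κ i) L).mono fun _ => hκlt (Finset.mem_range.1 hi)) 1 q
      have h := lintegral_mul_one_sub_ind μ (τ := fun _ => κ m) (fun _ _ _ => rfl) hdet
        (w := fun _ => q) (fun _ _ _ => rfl)
        (fun ω => Finset.prod_le_one' fun i _ => tsub_le_self) (fun _ => hq1) c L
      simp only [Finset.prod_range_succ]
      refine h.trans ?_
      rw [lintegral_mul_const _ hdet.measurable_const, ih (by omega), mul_comm q, pow_succ]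
  have hmeas : Measurable fun ω => ∏ i ∈ Finset.range n, (1 - w i ω * v i ω) :=
    (hτ n).measurable (determinedBefore_finset_prod fun i hi =>
      hfail n le_rfl i (Finset.mem_range.1 hi))
  refine (meas_le_lintegral₀ hmeas.aemeasurable fun ω hω => ?_).trans
    (le_of_eq ?_)
  · rw [Finset.prod_eq_one]
    intro i hi
    have := hω i (Finset.mem_range.1 hi)
    rcases not_and_or.1 this with h | h <;> simp [hw, hv, ind, h]
  · rw [← claim₂ n le_rfl]
    simpa using claim₁ n le_rfl (fun _ => 1) (fun _ _ _ => rfl) fun _ => le_rfl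

end PairedRuns

/-! ### Comparison of place values -/

section PlaceBounds

variable {b : ℕ → ℕ}

lemma place_add_le {β : ℕ} (hβ : ∀ j, b j ≤ β) (k d : ℕ) :
    place b (k + d) ≤ place b k * β ^ d := by
  induction d with
  | zero => simp
  | succ d ih =>
    rw [← add_assoc, place_succ, pow_succ, ← mul_assoc]
    exact Nat.mul_le_mul ih (hβ _)

lemma le_place_add (hb : ∀ j, 2 ≤ b j) (k d : ℕ) : place b k * 2 ^ d ≤ place b (k + d) := by
  induction d with
  | zero => simp
  | succ d ih =>
    rw [← add_assoc, place_succ, pow_succ, ← mul_assoc]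
    exact Nat.mul_le_mul ih (hb _)

/-- For integers `b < c ≤ β` one has `b (β + 1) ≤ c β`, so the larger base gains at least a factor
`1 + 1/β` at each level. -/
lemma place_mul_pow_le {c : ℕ → ℕ} {β : ℕ} (hβ : ∀ j, c j ≤ β) (h : ∀ j, b j < c j) (k : ℕ) :
    place b k * (β + 1) ^ k ≤ place c k * β ^ k := by
  induction k with
  | zero => simp
  | succ k ih =>
    have h1 : b k * (β + 1) ≤ c k * β := by nlinarith [h k, hβ k]
    calc place b (k + 1) * (β + 1) ^ (k + 1) = place b k * (β + 1) ^ k * (b k * (β + 1)) := by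
          rw [place_succ]; ring
      _ ≤ place c k * β ^ k * (c k * β) := Nat.mul_le_mul ih h1
      _ = place c (k + 1) * β ^ (k + 1) := by rw [place_succ]; ring

lemma level_congr {b' : ℕ → ℕ} (hb : ∀ j, 2 ≤ b j) (hb' : ∀ j, 2 ≤ b' j) {t : ℝ}
    (h : ∀ j < level b t, b j = b' j) : level b' t = level b t := by
  have hp : ∀ k ≤ level b t, place b k = place b' k := fun k hk =>
    Finset.prod_congr rfl fun j hj => h j ((Finset.mem_range.1 hj).trans_le hk)
  have h1 : level b' t ≤ level b t := level_le (by
    rw [← hp _ le_rfl]; exact le_place_level hb t)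
  refine le_antisymm h1 (level_le ?_)
  rw [hp _ h1]
  exact le_place_level hb' t

/-- With `(1 + 1/β)^q > β`, every `q` levels of gain pay for one additional level in the smaller
base. Thus column levels exceed the matching row levels by a positive proportion. -/
lemma exists_place_le_place_of_le (β : ℕ) (hβ : 0 < β) : ∃ q : ℕ, ∀ b c : ℕ → ℕ,
    (∀ j, c j ≤ β) → (∀ j, b j < c j) → ∀ k d, q * d ≤ k → place b (k + d) ≤ place c k := by
  have hβ' : (0 : ℝ) < β := by exact_mod_cast hβ
  have hγ : (1 : ℝ) < (β + 1) / β := by rw [lt_div_iff₀ hβ']; linarith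
  obtain ⟨q, hq⟩ := pow_unbounded_of_one_lt (β : ℝ) hγ
  refine ⟨q, fun b c hc hbc k d hd => ?_⟩
  have h1 : (place b (k + d) : ℝ) ≤ place b k * β ^ d := by
    exact_mod_cast place_add_le (fun j => (hbc j).le.trans (hc j)) k d
  have h2 : (place b k : ℝ) * (β + 1) ^ k ≤ place c k * β ^ k := by
    exact_mod_cast place_mul_pow_le hc hbc k
  have h3 : (β : ℝ) ^ d ≤ ((β + 1) / β) ^ k :=
    calc (β : ℝ) ^ d ≤ (((β + 1) / β) ^ q) ^ d := by gcongr
      _ = ((β + 1) / β) ^ (q * d) := by rw [pow_mul]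
      _ ≤ _ := pow_le_pow_right₀ hγ.le hd
  have h4 : (place b (k + d) : ℝ) ≤ place c k := by
    calc (place b (k + d) : ℝ) ≤ place b k * ((β + 1) / β) ^ k := h1.trans (by gcongr)
      _ = place b k * (β + 1) ^ k / β ^ k := by rw [div_pow]; ring
      _ ≤ place c k := by rwa [div_le_iff₀ (by positivity)]
  exact_mod_cast h4

end PlaceBounds

/-! ### Long runs at pairs of comparable levels -/

section LongRuns

/-- An upper bound for all the bases. -/
def maxBase {Λ : Type*} [Fintype Λ] (I : Λ → BMSystem) : ℕ := Finset.univ.sup fun l => (I l).n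

variable {Λ : Type*} [Fintype Λ]

lemma rows_le_maxBase (I : Λ → BMSystem) (ω : ℕ → Λ) (j : ℕ) : rows I ω j ≤ maxBase I :=
  Finset.le_sup (f := fun l => (I l).n) (Finset.mem_univ _)

lemma cols_le_maxBase (I : Λ → BMSystem) (ω : ℕ → Λ) (j : ℕ) : cols I ω j ≤ maxBase I :=
  (cols_lt_rows I ω j).le.trans (rows_le_maxBase I ω j)

/-- The column level whose scale is comparable to the row scale of level `k`. -/
def columnLevel (I : Λ → BMSystem) (k : ℕ) (ω : ℕ → Λ) : ℕ :=
  level (cols I ω) (place (rows I ω) k)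

omit [Fintype Λ] in
lemma le_columnLevel (I : Λ → BMSystem) (k : ℕ) (ω : ℕ → Λ) : k ≤ columnLevel I k ω := by
  have h1 : (place (cols I ω) k : ℝ) ≤ place (rows I ω) k := by
    exact_mod_cast place_le_place (fun j => (cols_lt_rows I ω j).le) k
  have h2 := h1.trans (le_place_level (two_le_cols I ω) (place (rows I ω) k))
  exact (place_strictMono (two_le_cols I ω)).le_iff_le.1 (by exact_mod_cast h2)

omit [Fintype Λ] in
-- The column level is at least `k`, so the coordinates before it determine the row scale at level
-- `k` as well as its first passage by the column scales: it is a stopping time.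
lemma determinedBefore_columnLevel (I : Λ → BMSystem) (k : ℕ) :
    DeterminedBefore (columnLevel I k) (columnLevel I k) := by
  intro ω ω' h
  have hk := le_columnLevel I k ω
  have hrows : place (rows I ω') k = place (rows I ω) k :=
    Finset.prod_congr rfl fun j hj => by
      rw [rows, rows, h j ((Finset.mem_range.1 hj).trans_le hk)]
  unfold columnLevel at *
  rw [hrows]
  exact level_congr (two_le_cols I ω) (two_le_cols I ω') fun j hj => by
    rw [cols, cols, h j hj]

/-- Advancing `g (L + 1)` row levels multiplies the row place value by at least `maxBase I ^ (L +
1)`. This covers `L` column levels and the overshoot of one base in the definition of the level, so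
successive column windows are disjoint. -/
lemma columnLevel_add_le (I : Λ → BMSystem) {g : ℕ} (hg : maxBase I ≤ 2 ^ g) (k L : ℕ)
    (ω : ℕ → Λ) : columnLevel I k ω + L ≤ columnLevel I (k + g * (L + 1)) ω := by
  by_contra hcon
  push Not at hcon
  have hM := place_strictMono (two_le_cols I ω)
  have h1 : (place (rows I ω) (k + g * (L + 1)) : ℝ) ≤ _ :=
    le_place_level (two_le_cols I ω) _
  have h2 : place (rows I ω) (k + g * (L + 1)) ≤
      place (cols I ω) (columnLevel I (k + g * (L + 1)) ω) := by exact_mod_cast h1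
  have h3 := h2.trans_lt (hM hcon)
  have h4 := place_add_le (cols_le_maxBase I ω) (columnLevel I k ω) L
  have h5 : place (cols I ω) (columnLevel I k ω) ≤ maxBase I * place (rows I ω) k := by
    have := place_level_le (two_le_cols I ω) (cols_le_maxBase I ω) (t := place (rows I ω) k)
      (by exact_mod_cast place_pos (two_le_rows I ω) k)
    exact_mod_cast this
  have h6 := le_place_add (two_le_rows I ω) k (g * (L + 1))
  have h7 : place (cols I ω) (columnLevel I k ω + L) ≤
      place (rows I ω) k * 2 ^ (g * (L + 1)) :=
    calc _ ≤ maxBase I * place (rows I ω) k * maxBase I ^ L := h4.trans (by gcongr)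
      _ = place (rows I ω) k * maxBase I ^ (L + 1) := by ring
      _ ≤ place (rows I ω) k * (2 ^ g) ^ (L + 1) := by gcongr
      _ = _ := by rw [pow_mul]
  omega

variable [MeasurableSpace Λ] [MeasurableSingletonClass Λ]
  (μ : Measure Λ) [IsProbabilityMeasure μ]

/-- The candidates are `n` row levels spaced by `s = g (L + 1)` just below `K`. Their row windows
end by `K`, and their column windows start at `K` or later. -/
lemma exists_paired_runs_failure_bound (I : Λ → BMSystem) (b c : Λ) :
    ∃ D : ℕ, 0 < D ∧ ∀ K L : ℕ, iidLaw μ {ω | ¬ ∃ k : ℕ, K ≤ 2 * k ∧ k + L ≤ K ∧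
      K ≤ columnLevel I k ω ∧ IsRun c k L ω ∧ IsRun b (columnLevel I k ω) L ω} ≤
      (1 - μ {b} ^ L * μ {c} ^ L) ^ (K / (D * (L + 1))) := by
  have hβ : 0 < maxBase I :=
    lt_of_lt_of_le two_pos ((two_le_rows I (fun _ => b) 0).trans (rows_le_maxBase I (fun _ => b) 0))
  obtain ⟨q, hq⟩ := exists_place_le_place_of_le (maxBase I) hβ
  obtain ⟨g, hg⟩ : ∃ g, maxBase I ≤ 2 ^ g := ⟨_, Nat.lt_two_pow_self.le⟩
  have hg1 : 1 ≤ g := by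
    rcases Nat.eq_zero_or_pos g with rfl | h
    · have := (two_le_rows I (fun _ => b) 0).trans (rows_le_maxBase I (fun _ => b) 0)
      omega
    · exact h
  -- This choice gives `2 (q + 1) n s ≤ K`: all candidates are at least `K / 2`, and already the
  -- lowest, `K - n s`, is large enough for its column level to reach `K`.
  refine ⟨2 * (q + 1) * g, by positivity, fun K L => ?_⟩
  set s := g * (L + 1) with hs
  set n := K / (2 * (q + 1) * g * (L + 1)) with hn
  have hns : 2 * (q + 1) * (n * s) ≤ K :=
    calc _ = n * (2 * (q + 1) * g * (L + 1)) := by rw [hs]; ring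
      _ ≤ K := Nat.div_mul_le_self _ _
  have hns' : 2 * (q * (n * s)) + 2 * (n * s) ≤ K := by nlinarith
  have hLs : L + 1 ≤ s := Nat.le_mul_of_pos_left _ hg1
  have hKmin : ∀ i ω, K ≤ columnLevel I (K - n * s + i * s) ω := by
    intro i ω
    have h1 := hq (cols I ω) (rows I ω) (rows_le_maxBase I ω) (cols_lt_rows I ω) (K - n * s)
      (n * s) (by omega)
    rw [Nat.sub_add_cancel (by omega)] at h1
    have h2 := (place_strictMono (two_le_rows I ω)).monotone (Nat.le_add_right (K - n * s) (i * s))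
    have h3 := le_place_level (two_le_cols I ω) (place (rows I ω) (K - n * s + i * s))
    exact (place_strictMono (two_le_cols I ω)).le_iff_le.1
      ((h1.trans h2).trans (by exact_mod_cast h3))
  refine (measure_mono ?_).trans (measure_no_paired_runs_le μ b c (K := K) (L := L) (n := n)
    (κ := fun i => K - n * s + i * s) (τ := fun i => columnLevel I (K - n * s + i * s))
    (fun i => determinedBefore_columnLevel I _) hKmin (fun i ω => ?_) (fun i => ?_) fun i hi => ?_)
  · intro ω hω i hi hruns
    refine hω ⟨_, ?_, ?_, hKmin i ω, hruns⟩
    · have : 0 ≤ i * s := Nat.zero_le _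
      omega
    · have : (i + 1) * s ≤ n * s := Nat.mul_le_mul_right _ hi
      rw [add_mul, one_mul] at this
      omega
  · have := columnLevel_add_le I hg (K - n * s + i * s) L ω
    rwa [add_assoc, ← hs, show i * s + s = (i + 1) * s by ring] at this
  · rw [add_mul, one_mul]
    omega
  · have : (i + 1) * s ≤ n * s := Nat.mul_le_mul_right _ hi
    rw [add_mul, one_mul] at this
    omega

/-- For small `δ` a trial succeeds with probability at least `p K^(-1/4)`, while there are at least
`K^(3/4) / (2D)` trials. Failure has probability at most `exp (-p √K / (2D))`. -/
lemma eventually_pow_le_one_div_sq {p : ℝ} (hp0 : 0 < p) (hp1 : p ≤ 1) {D : ℕ} (hD : 0 < D) :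
    ∃ δ : ℝ, 0 < δ ∧ ∀ᶠ K : ℕ in atTop,
      (1 - p ^ ⌈δ * Real.log K⌉₊) ^ (K / (D * (⌈δ * Real.log K⌉₊ + 1))) ≤ 1 / (K : ℝ) ^ 2 := by
  have hlogp : Real.log p ≤ 0 := Real.log_nonpos hp0.le hp1
  have hden : 0 < 4 * (1 - Real.log p) := by linarith
  -- This makes `p ^ (δ log K) ≥ K^(-1/4)`; the summand `1` keeps the denominator positive when `p =
  -- 1`.
  set δ : ℝ := 1 / (4 * (1 - Real.log p)) with hδ
  have hδ0 : 0 < δ := by positivity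
  have hδp : -(1 / 4) ≤ δ * Real.log p := by
    rw [hδ, div_mul_eq_mul_div, le_div_iff₀ hden]
    linarith
  have hD' : (0 : ℝ) < D := by exact_mod_cast hD
  have hlo : (fun x : ℝ => Real.log x) =o[atTop] fun x : ℝ => x ^ (1 / 4 : ℝ) :=
    isLittleO_log_rpow_atTop (by norm_num)
  have hε : 0 < min (1 / (2 * δ)) (p / D / 4) := by positivity
  have hev := tendsto_natCast_atTop_atTop.eventually (hlo.bound hε)
  have hpow : Tendsto (fun K : ℕ => (K : ℝ) ^ (1 / 4 : ℝ)) atTop atTop :=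
    (tendsto_rpow_atTop (by norm_num)).comp tendsto_natCast_atTop_atTop
  refine ⟨δ, hδ0, ?_⟩
  filter_upwards [hev, hpow.eventually_ge_atTop 4, hpow.eventually_ge_atTop (2 * D),
    eventually_ge_atTop 2] with K hK hK4 hKD hK2
  have hK0 : (0 : ℝ) < K := by positivity
  have hK1 : (1 : ℝ) ≤ K := by exact_mod_cast (by omega : 1 ≤ K)
  set X := (K : ℝ) ^ (1 / 4 : ℝ) with hX
  have hX0 : 0 < X := by positivity
  have hX4 : X ^ 4 = K := by
    rw [hX, ← Real.rpow_natCast, ← Real.rpow_mul hK0.le]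
    norm_num
  have hlog0 : 0 ≤ Real.log K := Real.log_nonneg hK1
  rw [Real.norm_of_nonneg hlog0, Real.norm_of_nonneg hX0.le] at hK
  have hlog1 : Real.log K ≤ 1 / (2 * δ) * X := hK.trans (by gcongr; exact min_le_left _ _)
  have hlog2 : Real.log K ≤ p / D / 4 * X := hK.trans (by gcongr; exact min_le_right _ _)
  set L := ⌈δ * Real.log K⌉₊ with hL
  have hLlt : (L : ℝ) < δ * Real.log K + 1 := Nat.ceil_lt_add_one (by positivity)
  have hLX : (L : ℝ) + 1 ≤ X := by
    have : δ * Real.log K ≤ X / 2 := by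
      calc δ * Real.log K ≤ δ * (1 / (2 * δ) * X) := by gcongr
        _ = X / 2 := by field_simp
    linarith
  have hpL : p / X ≤ p ^ L := by
    have h1 : p ^ (δ * Real.log K + 1) ≤ p ^ L := by
      rw [← Real.rpow_natCast]
      exact Real.rpow_le_rpow_of_exponent_ge hp0 hp1 hLlt.le
    refine le_trans ?_ h1
    rw [Real.rpow_add hp0, Real.rpow_one, div_eq_inv_mul]
    gcongr
    rw [hX, ← Real.rpow_neg hK0.le, Real.rpow_def_of_pos hp0, Real.rpow_def_of_pos hK0]
    refine Real.exp_le_exp.2 ?_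
    nlinarith
  set n := K / (D * (L + 1)) with hn
  have hnX : X ^ 3 / (2 * D) ≤ n := by
    have h1 : (K : ℝ) < (D * (L + 1)) * (n + 1) := by
      have := Nat.lt_mul_div_succ K (b := D * (L + 1)) (by positivity)
      exact_mod_cast this
    have h2 : X ^ 4 < D * X * (n + 1) := by
      rw [hX4]
      exact h1.trans_le (by gcongr)
    have h3 : X ^ 3 < D * (n + 1) := by nlinarith
    rw [div_le_iff₀ (by positivity)]
    nlinarith [mul_pos hX0 hX0]
  have hpL1 : p ^ L ≤ 1 := pow_le_one₀ hp0.le hp1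
  calc (1 - p ^ L) ^ n ≤ Real.exp (-p ^ L) ^ n := by
        gcongr
        linarith [Real.add_one_le_exp (-p ^ L)]
    _ = Real.exp (-(n * p ^ L)) := by rw [← Real.exp_nat_mul]; ring_nf
    _ ≤ Real.exp (-(2 * Real.log K)) := by
        refine Real.exp_le_exp.2 (neg_le_neg ?_)
        calc 2 * Real.log K ≤ 2 * (p / D / 4 * X) := by gcongr
          _ ≤ X ^ 3 / (2 * D) * (p / X) := by
            have : X ^ 3 / (2 * D) * (p / X) = p / D / 2 * (X * X) := by field_simp
            rw [this]
            have : p / D / 2 * X ≤ p / D / 2 * (X * X) := by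
              gcongr
              nlinarith
            linarith
          _ ≤ n * p ^ L := by gcongr
    _ = 1 / (K : ℝ) ^ 2 := by
        rw [Real.exp_neg, mul_comm, Real.exp_mul, Real.exp_log hK0, one_div]
        norm_cast

/-- The event that there are long runs at pairs of comparable row and column levels. -/
def HasLongRuns (I : Λ → BMSystem) (b c : Λ) (δ : ℝ) (ω : ℕ → Λ) : Prop :=
  ∀ᶠ K : ℕ in atTop, ∃ k L : ℕ, δ * Real.log K ≤ L ∧ K ≤ 2 * k ∧ k + L ≤ K ∧
    K ≤ columnLevel I k ω ∧ IsRun c k L ω ∧ IsRun b (columnLevel I k ω) L ω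

/-- The failure probabilities are eventually at most `1 / K²`, so Borel–Cantelli applies. Positivity
of the masses makes `δ` available. -/
theorem exists_ae_hasLongRuns (hμ : ∀ l : Λ, 0 < μ {l}) (I : Λ → BMSystem) (b c : Λ) :
    ∃ δ : ℝ, 0 < δ ∧ ∀ᵐ ω ∂(iidLaw μ), HasLongRuns I b c δ ω := by
  obtain ⟨D, hD, hbound⟩ := exists_paired_runs_failure_bound μ I b c
  have hpos : ∀ l, 0 < μ.real {l} := fun l => ENNReal.toReal_pos (hμ l).ne' (by simp)
  have hle : ∀ l, μ.real {l} ≤ 1 := fun l => measureReal_le_one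
  obtain ⟨δ, hδ, hev⟩ := eventually_pow_le_one_div_sq (p := μ.real {b} * μ.real {c})
    (mul_pos (hpos b) (hpos c)) (mul_le_one₀ (hle b) (hpos c).le (hle c)) hD
  refine ⟨δ, hδ, ?_⟩
  set F : ℕ → Set (ℕ → Λ) := fun K => {ω | ¬ ∃ k : ℕ, K ≤ 2 * k ∧ k + ⌈δ * Real.log K⌉₊ ≤ K ∧
    K ≤ columnLevel I k ω ∧ IsRun c k ⌈δ * Real.log K⌉₊ ω ∧
    IsRun b (columnLevel I k ω) ⌈δ * Real.log K⌉₊ ω} with hF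
  have hreal : ∀ᶠ K : ℕ in atTop, (iidLaw μ).real (F K) ≤ 1 / (K : ℝ) ^ 2 := by
    filter_upwards [hev] with K hK
    refine le_trans ?_ hK
    have h := ENNReal.toReal_mono (by finiteness) (hbound K ⌈δ * Real.log K⌉₊)
    refine h.trans (le_of_eq ?_)
    rw [ENNReal.toReal_pow, ENNReal.toReal_sub_of_le _ ENNReal.one_ne_top, ENNReal.toReal_mul,
      ENNReal.toReal_pow, ENNReal.toReal_pow, mul_pow]
    · rfl
    · exact mul_le_one₀ (pow_le_one₀ zero_le prob_le_one) zero_le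
        (pow_le_one₀ zero_le prob_le_one)
  have hsum : Summable fun K => (iidLaw μ).real (F K) := by
    refine Summable.of_norm_bounded_eventually_nat (Real.summable_one_div_nat_pow.2 one_lt_two) ?_
    filter_upwards [hreal] with K hK
    rwa [Real.norm_of_nonneg measureReal_nonneg]
  have hfin : ∑' K, (iidLaw μ) (F K) ≠ ∞ := by
    have : ∀ K, (iidLaw μ) (F K) = ENNReal.ofReal ((iidLaw μ).real (F K)) := fun K => by simp
    simp_rw [this]
    exact hsum.tsum_ofReal_ne_top
  filter_upwards [ae_eventually_notMem hfin] with ω hω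
  refine hω.mono fun K hK => ?_
  simp only [hF, mem_ofPred_eq, not_not] at hK
  obtain ⟨k, hk⟩ := hK
  exact ⟨k, _, Nat.le_ceil _, hk⟩

end LongRuns

/-! ## Growth of products over windows -/

/-- An iterated logarithm that is at least `1` on `[1, ∞)`. -/
def logLog (T : ℝ) : ℝ := 1 + Real.log (1 + Real.log T)

lemma one_le_logLog {T : ℝ} (hT : 1 ≤ T) : 1 ≤ logLog T := by
  have := Real.log_nonneg (by linarith [Real.log_nonneg hT] : 1 ≤ 1 + Real.log T)
  unfold logLog
  linarith

lemma logLog_mono {S T : ℝ} (hS : 1 ≤ S) (h : S ≤ T) : logLog S ≤ logLog T := by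
  have h0 := Real.log_nonneg hS
  have h1 := Real.log_le_log (by linarith) h
  have := Real.log_le_log (by linarith) (by linarith : 1 + Real.log S ≤ 1 + Real.log T)
  unfold logLog
  linarith

lemma logLog_two_mul_le {T : ℝ} (hT : 1 ≤ T) : logLog (2 * T) ≤ 2 * logLog T := by
  have h0 := Real.log_nonneg hT
  have h1 : Real.log 2 ≤ 1 := by linarith [Real.log_two_lt_d9]
  have h2 : Real.log (1 + Real.log (2 * T)) ≤ Real.log (2 * (1 + Real.log T)) := by
    rw [Real.log_mul two_ne_zero (by linarith)]
    refine Real.log_le_log ?_ (by linarith)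
    linarith [Real.log_two_gt_d9]
  rw [Real.log_mul two_ne_zero (by linarith : 1 + Real.log T ≠ 0)] at h2
  have := one_le_logLog hT
  unfold logLog at *
  linarith

section Growth

variable {Λ : Type*}

lemma log_place {b : ℕ → ℕ} (hb : ∀ j, 2 ≤ b j) (k : ℕ) :
    Real.log (place b k) = ∑ j ∈ Finset.range k, Real.log (b j) := by
  unfold place
  push_cast
  rw [Real.log_prod fun j _ => by have := hb j; positivity]

lemma log_place_sub {b : ℕ → ℕ} (hb : ∀ j, 2 ≤ b j) {k l : ℕ} (h : k ≤ l) :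
    Real.log (place b l) - Real.log (place b k) = ∑ j ∈ Finset.Ico k l, Real.log (b j) := by
  rw [log_place hb, log_place hb, Finset.sum_Ico_eq_sub _ h]

lemma half_lt_log_two : (1 / 2 : ℝ) < Real.log 2 := by linarith [Real.log_two_gt_d9]

lemma sub_le_two_mul_log_place_sub {b : ℕ → ℕ} (hb : ∀ j, 2 ≤ b j) {k l : ℕ} (h : k ≤ l) :
    (l : ℝ) - k ≤ 2 * (Real.log (place b l) - Real.log (place b k)) := by
  rw [log_place_sub hb h]
  have h1 : ∑ j ∈ Finset.Ico k l, (1 / 2 : ℝ) ≤ ∑ j ∈ Finset.Ico k l, Real.log (b j) := by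
    refine Finset.sum_le_sum fun j _ => half_lt_log_two.le.trans ?_
    exact Real.log_le_log two_pos (by exact_mod_cast hb j)
  rw [Finset.sum_const, Nat.card_Ico, nsmul_eq_mul, Nat.cast_sub h] at h1
  linarith

lemma log_place_level_mem {b : ℕ → ℕ} (hb : ∀ j, 2 ≤ b j) {β : ℕ} (hβ : ∀ j, b j ≤ β) {t : ℝ}
    (ht : 1 ≤ t) : Real.log t ≤ Real.log (place b (level b t)) ∧
      Real.log (place b (level b t)) ≤ Real.log β + Real.log t := by
  have h1 := le_place_level hb t
  have h2 := place_level_le hb hβ ht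
  have hβ0 : (0 : ℝ) < β := by
    have := (hb 0).trans (hβ 0)
    positivity
  refine ⟨Real.log_le_log (by linarith) h1, ?_⟩
  rw [← Real.log_mul hβ0.ne' (by linarith)]
  exact Real.log_le_log (by linarith) h2

/-- The growth of a product over the levels between two scales. -/
lemma HasSmallWindowSums.growth {ω : ℕ → Λ} {X : Λ → ℝ} {w : Λ → ℕ} {ρ : ℝ} {b : ℕ → ℕ}
    (hZ : HasSmallWindowSums (fun l => X l - ρ * Real.log (w l)) ω) (hbw : ∀ j, b j = w (ω j))
    (hb : ∀ j, 2 ≤ b j) {β : ℕ} (hβ : ∀ j, b j ≤ β) {ε : ℝ} (hε : 0 < ε) :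
    ∃ A : ℝ, 0 ≤ A ∧ ∀ T t : ℝ, 1 ≤ T → T ≤ t →
      |∑ j ∈ Finset.Ico (level b T) (level b t), X (ω j) - ρ * (Real.log t - Real.log T)| ≤
        ε * (Real.log t - Real.log T) + A * logLog T := by
  obtain ⟨A, hA0, hA⟩ := hZ (ε / 2) (by positivity)
  have hβ1 : (1 : ℝ) ≤ β := by exact_mod_cast (one_le_two.trans (hb 0)).trans (hβ 0)
  have hlβ := Real.log_nonneg hβ1
  have hc : 0 ≤ Real.log (2 * Real.log β + 2) := Real.log_nonneg (by linarith)
  refine ⟨ε * Real.log β + A * (1 + Real.log (2 * Real.log β + 2)) + |ρ| * Real.log β,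
    by positivity, fun T t hT hTt => ?_⟩
  set k := level b T with hk
  set l := level b t with hl
  have hkl : k ≤ l := level_mono hb hTt
  obtain ⟨hk1, hk2⟩ := log_place_level_mem hb hβ hT
  obtain ⟨hl1, hl2⟩ := log_place_level_mem hb hβ (hT.trans hTt)
  rw [← hk] at hk1 hk2
  rw [← hl] at hl1 hl2
  have hlen := sub_le_two_mul_log_place_sub hb hkl
  have hpos := sub_le_two_mul_log_place_sub hb (Nat.zero_le k)
  simp only [place_zero, Nat.cast_one, Real.log_one, sub_zero, Nat.cast_zero] at hpos
  have hlT := Real.log_nonneg hT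
  have hY : 0 ≤ Real.log t - Real.log T := sub_nonneg.2 (Real.log_le_log (by linarith) hTt)
  -- The level of `T` is at most a multiple of `log β + log T`, so an error logarithmic in the
  -- position becomes an iterated logarithm of `T`.
  have hlogk : Real.log ((k : ℝ) + 1) ≤
      Real.log (2 * Real.log β + 2) + Real.log (1 + Real.log T) := by
    rw [← Real.log_mul (by linarith) (by linarith)]
    refine Real.log_le_log (by positivity) ?_
    nlinarith [mul_nonneg hlβ hlT]
  -- The subtracted means telescope to a difference of logarithms of place values, which is known up
  -- to `log β`.
  have hsplit : ∑ j ∈ Finset.Ico k l, X (ω j) =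
      ∑ j ∈ Finset.Ico k l, (X (ω j) - ρ * Real.log (w (ω j))) +
        ρ * (Real.log (place b l) - Real.log (place b k)) := by
    rw [log_place_sub hb hkl, Finset.mul_sum, ← Finset.sum_add_distrib]
    refine Finset.sum_congr rfl fun j _ => ?_
    rw [hbw]
    ring
  have hdiff : |(Real.log (place b l) - Real.log (place b k)) - (Real.log t - Real.log T)| ≤
      Real.log β := by
    rw [abs_le]
    constructor <;> linarith
  have hwin := hA k l hkl
  have hLL := one_le_logLog hT
  have hLLdef : Real.log (1 + Real.log T) = logLog T - 1 := by unfold logLog; ring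
  rw [hLLdef] at hlogk
  have h1 : ε / 2 * ((l : ℝ) - k) ≤ ε * (Real.log t - Real.log T) + ε * Real.log β := by
    have : (l : ℝ) - k ≤ 2 * (Real.log t - Real.log T + Real.log β) := by linarith
    nlinarith
  have h2 : A * (1 + Real.log (k + 1)) ≤ A * (1 + Real.log (2 * Real.log β + 2)) * logLog T := by
    rw [mul_assoc]
    refine mul_le_mul_of_nonneg_left ?_ hA0
    nlinarith
  have h3 : |ρ * ((Real.log (place b l) - Real.log (place b k)) - (Real.log t - Real.log T))| ≤
      |ρ| * Real.log β := by
    rw [abs_mul]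
    exact mul_le_mul_of_nonneg_left hdiff (abs_nonneg _)
  have h4 : ε * Real.log β + |ρ| * Real.log β ≤
      (ε * Real.log β + |ρ| * Real.log β) * logLog T :=
    le_mul_of_one_le_right (by positivity) hLL
  calc _ = |∑ j ∈ Finset.Ico k l, (X (ω j) - ρ * Real.log (w (ω j))) +
        ρ * ((Real.log (place b l) - Real.log (place b k)) - (Real.log t - Real.log T))| := by
        rw [hsplit]
        congr 1
        ring
    _ ≤ ε / 2 * ((l : ℝ) - k) + A * (1 + Real.log (k + 1)) + |ρ| * Real.log β :=
        (abs_add_le _ _).trans (add_le_add hwin h3)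
    _ ≤ _ := by linarith

end Growth

/-! ## Covering numbers in terms of scales -/

section Scales

variable {Λ : Type*} [Fintype Λ] (I : Λ → BMSystem) (ω : ℕ → Λ)

omit [Fintype Λ] in
lemma log_prodB (k l : ℕ) :
    Real.log (prodB I ω k l : ℝ) = ∑ j ∈ Finset.Ico k l, Real.log ((I (ω j)).B : ℝ) := by
  unfold prodB
  push_cast
  rw [Real.log_prod fun j _ => by have := (I (ω j)).one_le_B; positivity]

omit [Fintype Λ] in
lemma log_prodC (k l : ℕ) :
    Real.log (prodC I ω k l : ℝ) = ∑ j ∈ Finset.Ico k l, Real.log ((I (ω j)).C : ℝ) := by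
  unfold prodC
  push_cast
  rw [Real.log_prod fun j _ => by have := (I (ω j)).one_le_C; positivity]

omit [Fintype Λ] in
lemma prodB_pos (k l : ℕ) : 0 < prodB I ω k l := Finset.prod_pos fun j _ => (I (ω j)).one_le_B

omit [Fintype Λ] in
lemma prodC_pos (k l : ℕ) : 0 < prodC I ω k l := Finset.prod_pos fun j _ => (I (ω j)).one_le_C

/-- The logarithm of the constant in the covering estimates. -/
def logConst : ℝ := Real.log (((2 * maxBase I + 2) ^ 2 : ℕ) : ℝ)

lemma logConst_nonneg : 0 ≤ logConst I :=
  Real.log_nonneg (by exact_mod_cast Nat.one_le_pow _ _ (by omega))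

lemma coveringNum_carpet_le_exp {r R : ℝ} (hr : 0 < r) (hrR : r ≤ R) (hR : R < 1) (x : Plane) :
    coveringNum r (carpet I ω ∩ Metric.closedBall x R) ≤ ENNReal.ofReal (Real.exp (logConst I +
      ∑ j ∈ Finset.Ico (level (cols I ω) R⁻¹) (level (cols I ω) r⁻¹), Real.log ((I (ω j)).B : ℝ) +
      ∑ j ∈ Finset.Ico (level (rows I ω) R⁻¹) (level (rows I ω) r⁻¹),
        Real.log ((I (ω j)).C : ℝ))) := by
  have hR0 : 0 < R := hr.trans_le hrR
  have hinv : R⁻¹ ≤ r⁻¹ := inv_anti₀ hr hrR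
  have h1 := level_mono (two_le_cols I ω) hinv
  have h2 := level_mono (two_le_rows I ω) hinv
  have h3 : level (rows I ω) r⁻¹ ≤ level (cols I ω) r⁻¹ := level_le
    ((le_place_level (two_le_cols I ω) r⁻¹).trans
      (by exact_mod_cast place_le_place (fun j => (cols_lt_rows I ω j).le) _))
  have hbig : ∀ b : ℕ → ℕ, (∀ j, 2 ≤ b j) → 1 ≤ r * place b (level b r⁻¹) := by
    intro b hb
    have := mul_le_mul_of_nonneg_left (le_place_level hb r⁻¹) hr.le
    rwa [mul_inv_cancel₀ hr.ne'] at this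
  have hsmall : ∀ b : ℕ → ℕ, (∀ j, 2 ≤ b j) → (∀ j, b j ≤ maxBase I) →
      R * place b (level b R⁻¹) ≤ maxBase I := by
    intro b hb hβ
    have := mul_le_mul_of_nonneg_left
      (place_level_le hb hβ (t := R⁻¹) (by rw [one_le_inv₀ hR0]; exact hR.le)) hR0.le
    rwa [mul_left_comm, mul_inv_cancel₀ hR0.ne', mul_one] at this
  refine (coveringNum_carpet_le h1 h2 h3 (hbig _ (two_le_cols I ω)) (hbig _ (two_le_rows I ω)) hR0
    (hsmall _ (two_le_cols I ω) (cols_le_maxBase I ω))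
    (hsmall _ (two_le_rows I ω) (rows_le_maxBase I ω)) x).trans ?_
  rw [← log_prodB, ← log_prodC, Real.exp_add, Real.exp_add, logConst, Real.exp_log (by positivity),
    Real.exp_log (by exact_mod_cast prodB_pos I ω _ _),
    Real.exp_log (by exact_mod_cast prodC_pos I ω _ _), ← ENNReal.ofReal_natCast]
  refine ENNReal.ofReal_le_ofReal (le_of_eq ?_)
  push_cast
  ring

lemma exists_exp_le_coveringNum_carpet : ∃ x ∈ carpet I ω, ∀ {k₁ k₂ l₁ l₂ : ℕ} {r R : ℝ},
    k₂ ≤ l₂ → l₂ ≤ k₁ → k₁ ≤ l₁ →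
    2 ≤ R * place (cols I ω) k₁ → 2 ≤ R * place (rows I ω) k₂ → 0 ≤ r →
    r * place (cols I ω) l₁ ≤ maxBase I → r * place (rows I ω) l₂ ≤ maxBase I →
    ENNReal.ofReal (Real.exp (∑ j ∈ Finset.Ico k₁ l₁, Real.log ((I (ω j)).B : ℝ) +
      ∑ j ∈ Finset.Ico k₂ l₂, Real.log ((I (ω j)).C : ℝ) - logConst I)) ≤
        coveringNum r (carpet I ω ∩ Metric.closedBall x R) := by
  obtain ⟨x, hx, h⟩ := exists_le_coveringNum_carpet I ω
  refine ⟨x, hx, fun {k₁ k₂ l₁ l₂ r R} h1 h2 h3 h4 h5 h6 h7 h8 => ?_⟩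
  have key := h h1 h2 h3 h4 h5 h6 h7 h8
  set Q : ℕ := (2 * maxBase I + 2) ^ 2 with hQ
  have hQ0 : 0 < Q := by positivity
  have hQ1 : (Q : ℝ≥0∞) ≠ 0 := by exact_mod_cast hQ0.ne'
  have hQ2 : (Q : ℝ≥0∞) ≠ ∞ := ENNReal.natCast_ne_top Q
  rw [← log_prodB, ← log_prodC, Real.exp_sub, Real.exp_add, logConst,
    Real.exp_log (by exact_mod_cast prodB_pos I ω _ _),
    Real.exp_log (by exact_mod_cast prodC_pos I ω _ _), Real.exp_log (by exact_mod_cast hQ0),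
    ENNReal.ofReal_div_of_pos (by exact_mod_cast hQ0)]
  refine ENNReal.div_le_of_le_mul' ?_
  rw [ENNReal.ofReal_natCast]
  refine le_trans (le_of_eq ?_) key
  rw [← ENNReal.ofReal_natCast]
  push_cast
  ring_nf

end Scales

/-! ## Typical covering numbers -/

section Typical

variable {Λ : Type*} [Fintype Λ] (I : Λ → BMSystem) (ω : ℕ → Λ)

/-- The sequence `ω` has the almost sure growth rates: `a` for the number of columns and `c` for
the maximal column sizes, relative to the widths and the heights, and `ρ` for the logarithms of the
widths relative to the logarithms of the heights. -/
structure IsTypical (a c ρ : ℝ) : Prop where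
  columns : HasSmallWindowSums (fun l => Real.log ((I l).B : ℝ) - a * Real.log ((I l).m : ℝ)) ω
  column_sizes : HasSmallWindowSums (fun l => Real.log ((I l).C : ℝ) - c * Real.log ((I l).n : ℝ)) ω
  widths : HasSmallWindowSums (fun l => Real.log ((I l).m : ℝ) - ρ * Real.log ((I l).n : ℝ)) ω

variable {I ω} {a c ρ : ℝ}

lemma IsTypical.coveringNum_le (h : IsTypical I ω a c ρ) {ε : ℝ} (hε : 0 < ε) :
    ∃ A : ℝ, 0 ≤ A ∧ ∀ r R : ℝ, 0 < r → r ≤ R → R < 1 → ∀ x : Plane,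
      coveringNum r (carpet I ω ∩ Metric.closedBall x R) ≤
        ENNReal.ofReal (Real.exp ((a + c + ε) * Real.log (R / r) + A * logLog R⁻¹)) := by
  obtain ⟨A₁, hA₁, h₁⟩ := h.columns.growth (b := cols I ω) (fun _ => rfl) (two_le_cols I ω)
    (cols_le_maxBase I ω) (half_pos hε)
  obtain ⟨A₂, hA₂, h₂⟩ := h.column_sizes.growth (b := rows I ω) (fun _ => rfl) (two_le_rows I ω)
    (rows_le_maxBase I ω) (half_pos hε)
  have hc := logConst_nonneg I
  refine ⟨A₁ + A₂ + logConst I, by positivity, fun r R hr hrR hR x => ?_⟩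
  have hR0 := hr.trans_le hrR
  have hR1 : 1 ≤ R⁻¹ := (one_le_inv₀ hR0).2 hR.le
  refine (coveringNum_carpet_le_exp I ω hr hrR hR x).trans (ENNReal.ofReal_le_ofReal
    (Real.exp_le_exp.2 ?_))
  have e1 := (abs_le.1 (h₁ R⁻¹ r⁻¹ hR1 (inv_anti₀ hr hrR))).2
  have e2 := (abs_le.1 (h₂ R⁻¹ r⁻¹ hR1 (inv_anti₀ hr hrR))).2
  have hlog : Real.log r⁻¹ - Real.log R⁻¹ = Real.log (R / r) := by
    rw [Real.log_inv, Real.log_inv, Real.log_div hR0.ne' hr.ne']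
    ring
  rw [hlog] at e1 e2
  have := le_mul_of_one_le_right hc (one_le_logLog hR1)
  linarith

/-- Packing needs the row window to end before the column window starts, and `ρ log (1/r) ≤ log
(1/R)` ensures this only on average. The row window is cut at the start of the column window, and
the growth law of the widths shows that the discarded part is negligible. -/
lemma IsTypical.exists_le_coveringNum (h : IsTypical I ω a c ρ) (hρ1 : ρ < 1)
    {ε : ℝ} (hε : 0 < ε) : ∃ A : ℝ, 0 ≤ A ∧ ∃ x ∈ carpet I ω, ∀ r R : ℝ, 0 < r → 2 * r ≤ R →
      R < 1 → ρ * Real.log r⁻¹ ≤ Real.log R⁻¹ →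
      ENNReal.ofReal (Real.exp ((a + c - ε) * Real.log (R / r) - A * logLog R⁻¹)) ≤
        coveringNum r (carpet I ω ∩ Metric.closedBall x R) := by
  set β := maxBase I with hβ
  have hβ1 : (1 : ℝ) ≤ β := by
    exact_mod_cast (one_le_two.trans (two_le_cols I ω 0)).trans (cols_le_maxBase I ω 0)
  have hlβ : 0 ≤ Real.log β := Real.log_nonneg hβ1
  -- Ensures `2 log β · ε₂ ≤ ε / 4`, the share of the error left to the discarded levels.
  set ε₂ : ℝ := ε / (8 * (Real.log β + 1)) with hε₂
  have hε₂0 : 0 < ε₂ := by positivity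
  set s : ℝ := min 1 ε₂ with hs
  have hs0 : 0 < s := lt_min one_pos hε₂0
  -- With this tolerance the excess is governed by `ρ + s (1 - ρ) = (1 - s) ρ + s`. By the
  -- hypothesis on `r` and `R`, all terms in `log (1/R)` then cancel and only `s log (R/r)` and a
  -- constant remain; `s ≤ 1` keeps the combination convex.
  have hε₁ : 0 < s * (1 - ρ) := mul_pos hs0 (by linarith)
  obtain ⟨A₁, hA₁, h₁⟩ := h.columns.growth (b := cols I ω) (fun _ => rfl) (two_le_cols I ω)
    (cols_le_maxBase I ω) (by positivity : 0 < ε / 4)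
  obtain ⟨A₂, hA₂, h₂⟩ := h.column_sizes.growth (b := rows I ω) (fun _ => rfl) (two_le_rows I ω)
    (rows_le_maxBase I ω) (by positivity : 0 < ε / 4)
  obtain ⟨A₃, hA₃, h₃⟩ := h.widths.growth (b := rows I ω) (fun _ => rfl) (two_le_rows I ω)
    (rows_le_maxBase I ω) hε₁
  obtain ⟨x, hx, hlow⟩ := exists_exp_le_coveringNum_carpet I ω
  have hc := logConst_nonneg I
  refine ⟨2 * (A₁ + A₂) + 2 * Real.log β * A₃ + logConst I + |a + c|, by positivity, x, hx,
    fun r R hr hrR hR hρ => ?_⟩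
  have hR0 : 0 < R := by linarith
  have hR1 : 1 ≤ R⁻¹ := (one_le_inv₀ hR0).2 hR.le
  have hT : 2 * R⁻¹ ≤ r⁻¹ := by
    rw [← div_eq_mul_inv, div_le_iff₀ hR0, inv_mul_eq_div, le_div_iff₀ hr]
    exact hrR
  have hT1 : 1 ≤ 2 * R⁻¹ := by linarith
  -- Starting from `2/R` instead of `1/R` makes the sides of the initial square at most `R/2`, so
  -- that it fits into the ball.
  set k₁ := level (cols I ω) (2 * R⁻¹) with hk₁
  set l₁ := level (cols I ω) r⁻¹ with hl₁
  set k₂ := level (rows I ω) (2 * R⁻¹) with hk₂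
  set l₂ := level (rows I ω) r⁻¹ with hl₂
  have hkk : k₂ ≤ k₁ := level_le ((le_place_level (two_le_cols I ω) _).trans
      (by exact_mod_cast place_le_place (fun j => (cols_lt_rows I ω j).le) _))
  have hkl₁ : k₁ ≤ l₁ := level_mono (two_le_cols I ω) hT
  have hkl₂ : k₂ ≤ l₂ := level_mono (two_le_rows I ω) hT
  set l := min l₂ k₁ with hl
  have hkl : k₂ ≤ l := le_min hkl₂ hkk
  have hbig : ∀ b : ℕ → ℕ, (∀ j, 2 ≤ b j) → 2 ≤ R * place b (level b (2 * R⁻¹)) := by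
    intro b hb
    have := mul_le_mul_of_nonneg_left (le_place_level hb (2 * R⁻¹)) hR0.le
    rwa [mul_left_comm, mul_inv_cancel₀ hR0.ne', mul_one] at this
  have hr1 : 1 ≤ r⁻¹ := by linarith
  have hsmall : ∀ b : ℕ → ℕ, (∀ j, 2 ≤ b j) → (∀ j, b j ≤ β) →
      r * place b (level b r⁻¹) ≤ β := by
    intro b hb hβ
    have := mul_le_mul_of_nonneg_left (place_level_le hb hβ hr1) hr.le
    rwa [mul_left_comm, mul_inv_cancel₀ hr.ne', mul_one] at this
  have hl_small : r * place (rows I ω) l ≤ β := by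
    refine le_trans ?_ (hsmall _ (two_le_rows I ω) (rows_le_maxBase I ω))
    gcongr
    exact (place_strictMono (two_le_rows I ω)).monotone (min_le_left _ _)
  refine le_trans (ENNReal.ofReal_le_ofReal (Real.exp_le_exp.2 ?_))
    (hlow hkl (min_le_right _ _) hkl₁ (hbig _ (two_le_cols I ω)) (hbig _ (two_le_rows I ω)) hr.le
      (hsmall _ (two_le_cols I ω) (cols_le_maxBase I ω)) hl_small)
  have e1 := (abs_le.1 (h₁ (2 * R⁻¹) r⁻¹ hT1 hT)).1
  have e2 := (abs_le.1 (h₂ (2 * R⁻¹) r⁻¹ hT1 hT)).1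
  have hlog : Real.log r⁻¹ - Real.log (2 * R⁻¹) = Real.log (R / r) - Real.log 2 := by
    rw [Real.log_mul two_ne_zero (by positivity), Real.log_inv, Real.log_inv,
      Real.log_div hR0.ne' hr.ne']
    ring
  rw [hlog] at e1 e2
  set Y := Real.log (R / r) with hY
  have hlog2 : Real.log 2 ≤ 1 := by linarith [Real.log_two_lt_d9]
  have hlog2' := half_lt_log_two
  have hY2 : Real.log 2 ≤ Y := Real.log_le_log two_pos (by rwa [le_div_iff₀ hr])
  have hH := logLog_two_mul_le hR1
  have hH1 := one_le_logLog hR1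
  have hsplit : ∑ j ∈ Finset.Ico k₂ l, Real.log ((I (ω j)).C : ℝ) +
      ∑ j ∈ Finset.Ico l l₂, Real.log ((I (ω j)).C : ℝ) =
      ∑ j ∈ Finset.Ico k₂ l₂, Real.log ((I (ω j)).C : ℝ) :=
    Finset.sum_Ico_consecutive _ hkl (min_le_left _ _)
  have hexc : ∑ j ∈ Finset.Ico l l₂, Real.log ((I (ω j)).C : ℝ) ≤
      2 * Real.log β * (ε₂ * Y + A₃) := by
    rcases le_total l₂ k₁ with hle | hle
    · rw [hl, min_eq_left hle, Finset.Ico_self, Finset.sum_empty]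
      have : 0 ≤ Y := by linarith
      positivity
    · rw [hl, min_eq_right hle]
      -- The widths are compared from level `0` on, with `T = 1`, so no iterated logarithm enters
      -- here.
      have hlevel1 : level (rows I ω) 1 = 0 := Nat.le_zero.1 (level_le (by simp))
      have e3 := (abs_le.1 (h₃ 1 r⁻¹ le_rfl hr1)).2
      rw [hlevel1, ← hl₂] at e3
      change ∑ j ∈ Finset.Ico 0 l₂, Real.log (cols I ω j : ℝ) - _ ≤ _ at e3
      rw [← log_place_sub (two_le_cols I ω) (Nat.zero_le l₂)] at e3
      have hll1 : logLog 1 = 1 := by simp [logLog]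
      simp only [place_zero, Nat.cast_one, Real.log_one, sub_zero, hll1, mul_one] at e3
      have e4 := (log_place_level_mem (two_le_cols I ω) (cols_le_maxBase I ω) hT1).1
      rw [← hk₁, Real.log_mul two_ne_zero (by positivity)] at e4
      have e5 := sub_le_two_mul_log_place_sub (two_le_cols I ω) hle
      have hlr : Real.log r⁻¹ = Real.log R⁻¹ + Y := by
        rw [hY, Real.log_inv, Real.log_inv, Real.log_div hR0.ne' hr.ne']
        ring
      have hlR : 0 ≤ Real.log R⁻¹ := Real.log_nonneg hR1
      rw [hlr] at hρ e3
      have hs1 : s ≤ 1 := min_le_left _ _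
      have hs2 : s ≤ ε₂ := min_le_right _ _
      have e6 : Real.log (place (cols I ω) l₂) - Real.log (place (cols I ω) k₁) ≤
          ε₂ * Y + A₃ := by
        have f1 : (1 - s) * (ρ * (Real.log R⁻¹ + Y)) ≤ (1 - s) * Real.log R⁻¹ :=
          mul_le_mul_of_nonneg_left hρ (by linarith)
        have f2 : s * Y ≤ ε₂ * Y := mul_le_mul_of_nonneg_right hs2 (by linarith)
        linarith
      have e7 : ∑ j ∈ Finset.Ico k₁ l₂, Real.log ((I (ω j)).C : ℝ) ≤
          ((l₂ : ℝ) - k₁) * Real.log β := by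
        have : ∑ j ∈ Finset.Ico k₁ l₂, Real.log ((I (ω j)).C : ℝ) ≤
            ∑ j ∈ Finset.Ico k₁ l₂, Real.log β := by
          refine Finset.sum_le_sum fun j _ => Real.log_le_log ?_ ?_
          · exact_mod_cast (I (ω j)).one_le_C
          · exact_mod_cast (I (ω j)).C_le_n.trans (rows_le_maxBase I ω j)
        rwa [Finset.sum_const, Nat.card_Ico, nsmul_eq_mul, Nat.cast_sub hle] at this
      calc _ ≤ ((l₂ : ℝ) - k₁) * Real.log β := e7
        _ ≤ 2 * (ε₂ * Y + A₃) * Real.log β := by gcongr; linarith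
        _ = _ := by ring
  have hε₂Y : 2 * Real.log β * (ε₂ * Y) ≤ ε / 4 * Y := by
    have : 2 * Real.log β * ε₂ ≤ ε / 4 := by
      rw [hε₂, mul_div_assoc', div_le_iff₀ (by positivity)]
      nlinarith
    calc _ = 2 * Real.log β * ε₂ * Y := by ring
      _ ≤ _ := by
        gcongr
        linarith
  have g1 : A₁ * logLog (2 * R⁻¹) ≤ A₁ * (2 * logLog R⁻¹) := mul_le_mul_of_nonneg_left hH hA₁
  have g2 : A₂ * logLog (2 * R⁻¹) ≤ A₂ * (2 * logLog R⁻¹) := mul_le_mul_of_nonneg_left hH hA₂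
  have g3 : (2 * Real.log β * A₃ + logConst I + |a + c|) ≤
      (2 * Real.log β * A₃ + logConst I + |a + c|) * logLog R⁻¹ :=
    le_mul_of_one_le_right (by positivity) hH1
  have g4 : (a + c) * Real.log 2 ≤ |a + c| := by
    calc (a + c) * Real.log 2 ≤ |a + c| * Real.log 2 := by gcongr; exact le_abs_self _
      _ ≤ |a + c| := mul_le_of_le_one_right (abs_nonneg _) hlog2
  have g5 : ε / 4 * Real.log 2 ≥ 0 := by positivity
  have g6 : 0 ≤ ε * Y := by
    have : 0 ≤ Y := by linarith
    positivity
  nlinarith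

end Typical

/-! ## Dimensions from covering numbers -/

section Dimensions

variable {E : Type*} [PseudoMetricSpace E] {F : Set E} {d : ℝ} {ψ : ℝ → ℝ}

lemma log_div_rpow {R p : ℝ} (hR : 0 < R) :
    Real.log (R / R ^ (1 + p)) = p * Real.log R⁻¹ := by
  rw [Real.log_div hR.ne' (Real.rpow_pos_of_pos hR _).ne', Real.log_rpow hR, Real.log_inv]
  ring

lemma rpow_eq_exp_mul_log {R r s : ℝ} (hR : 0 < R) (hr : 0 < r) :
    (R / r) ^ s = Real.exp (s * Real.log (R / r)) := by
  rw [Real.rpow_def_of_pos (div_pos hR hr), mul_comm]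

/-- The generalised Assouad spectrum is determined by covering estimates with errors that are
negligible at the scales under consideration. -/
theorem genAssouadDim_eq (hd : 0 ≤ d)
    (hU : ∀ ε : ℝ, 0 < ε → ∃ A : ℝ, 0 ≤ A ∧ ∀ r R : ℝ, 0 < r → r ≤ R → R < 1 → ∀ x ∈ F,
      coveringNum r (F ∩ Metric.closedBall x R) ≤
        ENNReal.ofReal (Real.exp ((d + ε) * Real.log (R / r) + A * logLog R⁻¹)))
    (hL : ∀ ε : ℝ, 0 < ε → ∃ A : ℝ, 0 ≤ A ∧ ∀ᶠ R in 𝓝[>] (0 : ℝ), ∃ x ∈ F,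
      ENNReal.ofReal (Real.exp ((d - ε) * (ψ R * Real.log R⁻¹) - A * logLog R⁻¹)) ≤
        coveringNum (R ^ (1 + ψ R)) (F ∩ Metric.closedBall x R))
    (hY : ∀ M : ℝ, ∀ᶠ R in 𝓝[>] (0 : ℝ), M * logLog R⁻¹ ≤ ψ R * Real.log R⁻¹) :
    genAssouadDim ψ F = d := by
  have hsmall : ∀ᶠ R in 𝓝[>] (0 : ℝ), 0 < R ∧ R < 1 := Ioo_mem_nhdsGT one_pos
  have hmem : ∀ ε : ℝ, 0 < ε → d + 2 * ε ∈ {s : ℝ | 0 ≤ s ∧ ∃ C : ℝ, 0 < C ∧ ∀ r R : ℝ, 0 < r →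
      r = R ^ (1 + ψ R) → r < R → 0 < R → R < 1 → ∀ x ∈ F,
      coveringNum r (F ∩ Metric.closedBall x R) ≤ ENNReal.ofReal (C * (R / r) ^ s)} := by
    intro ε hε
    obtain ⟨A, hA0, hA⟩ := hU ε hε
    refine ⟨by positivity, ?_⟩
    -- For `R` below this threshold the error is at most `ε log (R/r)`; for larger `R` it is bounded
    -- and goes into the constant.
    obtain ⟨δ, hδ0, hδ⟩ := (mem_nhdsGT_iff_exists_Ioo_subset' (zero_lt_one (α := ℝ))).1
      ((hY (A / ε)).and hsmall)
    have hδ0 : 0 < δ := hδ0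
    set δ' := min δ (1 / 2) with hδ'
    have hδ'0 : 0 < δ' := lt_min hδ0 (by norm_num)
    have hδ'1 : 1 ≤ δ'⁻¹ := (one_le_inv₀ hδ'0).2 ((min_le_right _ _).trans (by norm_num))
    refine ⟨Real.exp (A * logLog δ'⁻¹), Real.exp_pos _, fun r R hr hrR hlt hR hR1 x hx => ?_⟩
    refine (hA r R hr hlt.le hR1 x hx).trans (ENNReal.ofReal_le_ofReal ?_)
    rw [rpow_eq_exp_mul_log hR hr, ← Real.exp_add, Real.exp_le_exp]
    have hYpos : 0 ≤ Real.log (R / r) := Real.log_nonneg ((one_le_div hr).2 hlt.le)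
    have hK : 0 ≤ A * logLog δ'⁻¹ := mul_nonneg hA0 (by linarith [one_le_logLog hδ'1])
    suffices A * logLog R⁻¹ ≤ A * logLog δ'⁻¹ + ε * Real.log (R / r) by linarith
    rcases lt_or_ge R δ' with h | h
    · have := (hδ ⟨hR, h.trans_le (min_le_left _ _)⟩).1
      rw [← log_div_rpow hR, ← hrR, div_mul_eq_mul_div, div_le_iff₀ hε] at this
      linarith
    · have : logLog R⁻¹ ≤ logLog δ'⁻¹ :=
        logLog_mono ((one_le_inv₀ hR).2 hR1.le) (inv_anti₀ hδ'0 h)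
      have := mul_le_mul_of_nonneg_left this hA0
      nlinarith
  refine le_antisymm ?_ ?_
  · refine le_of_forall_pos_le_add fun ε hε => ?_
    have := csInf_le ⟨0, fun s hs => hs.1⟩ (hmem (ε / 2) (half_pos hε))
    calc genAssouadDim ψ F ≤ d + 2 * (ε / 2) := this
      _ = d + ε := by ring
  · refine le_csInf ⟨_, hmem 1 one_pos⟩ ?_
    rintro s ⟨hs0, C, hC, hCs⟩
    refine le_of_forall_pos_le_add fun ε hε => ?_
    by_contra hcon
    push Not at hcon
    obtain ⟨A, hA0, hA⟩ := hL (ε / 2) (half_pos hε)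
    have hgap : 0 < d - ε - s := by linarith
    -- At such a scale the error is at most `(ε/2) Y`, and `(d - ε - s) Y` exceeds `|log C|`, which
    -- contradicts the assumed upper bound.
    obtain ⟨R, ⟨⟨⟨hRL, hRM⟩, hRM'⟩, hR, hR1⟩⟩ := ((((hA.and (hY (2 * A / ε))).and
      (hY ((|Real.log C| + 1) / (d - ε - s))))).and hsmall).exists
    obtain ⟨x, hx, hRL⟩ := hRL
    have hH1 := one_le_logLog ((one_le_inv₀ hR).2 hR1.le)
    set Y := ψ R * Real.log R⁻¹ with hYdef
    rw [div_mul_eq_mul_div, div_le_iff₀ hε] at hRM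
    rw [div_mul_eq_mul_div, div_le_iff₀ hgap] at hRM'
    have hbig : |Real.log C| + 1 ≤ Y * (d - ε - s) :=
      (le_mul_of_one_le_right (by positivity) hH1).trans hRM'
    have hYpos : 0 < Y := by
      by_contra hneg
      push Not at hneg
      nlinarith [abs_nonneg (Real.log C)]
    have hr : 0 < R ^ (1 + ψ R) := Real.rpow_pos_of_pos hR _
    have hlogdiv : Real.log (R / R ^ (1 + ψ R)) = Y := log_div_rpow hR
    have hlt : R ^ (1 + ψ R) < R := by
      by_contra hge
      push Not at hge
      have : Real.log (R / R ^ (1 + ψ R)) ≤ 0 :=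
        Real.log_nonpos (by positivity) ((div_le_one hr).2 hge)
      linarith
    have hfin := hRL.trans (hCs _ R hr rfl hlt hR hR1 x hx)
    rw [rpow_eq_exp_mul_log hR hr, hlogdiv] at hfin
    have hfin' := (ENNReal.ofReal_le_ofReal_iff (by positivity)).1 hfin
    rw [← Real.exp_log hC, ← Real.exp_add, Real.exp_le_exp] at hfin'
    nlinarith [le_abs_self (Real.log C)]

end Dimensions

/-! ## Dimension functions and the summability condition -/

section DimensionFunctions

variable {φ ψ : ℝ → ℝ}

lemma tendsto_log_inv_nhdsGT_zero :
    Tendsto (fun x : ℝ => Real.log x⁻¹) (𝓝[>] 0) atTop :=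
  Real.tendsto_log_atTop.comp tendsto_inv_nhdsGT_zero

lemma abs_log_eq_log_inv {x : ℝ} (h0 : 0 < x) (h1 : x < 1) : |Real.log x| = Real.log x⁻¹ := by
  rw [Real.log_inv, abs_of_neg (Real.log_neg h0 h1)]

lemma mul_eq_mul_abs_log (k : ℕ) : φ (Real.exp (-((k : ℝ) + 1))) * ((k : ℝ) + 1) =
    φ (Real.exp (-((k : ℝ) + 1))) * |Real.log (Real.exp (-((k : ℝ) + 1)))| := by
  rw [Real.log_exp, abs_neg, abs_of_nonneg (by positivity)]

lemma eventually_exp_neg_lt {x₀ : ℝ} (hx₀ : 0 < x₀) :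
    ∀ᶠ k : ℕ in atTop, Real.exp (-((k : ℝ) + 1)) < x₀ := by
  have h : Tendsto (fun k : ℕ => Real.exp (-((k : ℝ) + 1))) atTop (𝓝 0) :=
    Real.tendsto_exp_neg_atTop_nhds_zero.comp
      (tendsto_atTop_add_const_right _ _ tendsto_natCast_atTop_atTop)
  exact h.eventually_lt_const hx₀

/-- If the series converges then the dimension function decays at most slightly faster than
`log |log x| / |log x|`. -/
lemma IsDimensionFunction.exists_log_le (hφ : IsDimensionFunction φ)
    (hsum : Summable fun k : ℕ => Real.exp (-(φ (Real.exp (-((k : ℝ) + 1))) * ((k : ℝ) + 1)))) :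
    ∃ S c : ℝ, 0 < S ∧ ∀ᶠ x in 𝓝[>] (0 : ℝ),
      Real.log ((Real.log x⁻¹ - c) / S) ≤ φ x * Real.log x⁻¹ := by
  obtain ⟨x₀, hx₀, hx₁, -, -, hmon⟩ := hφ
  obtain ⟨k₀, hk₀⟩ := eventually_atTop.1 (eventually_exp_neg_lt hx₀)
  have hmem : ∀ k ≥ k₀, Real.exp (-((k : ℝ) + 1)) ∈ Ioo 0 x₀ := fun k hk =>
    ⟨Real.exp_pos _, hk₀ k hk⟩
  simp_rw [mul_eq_mul_abs_log] at hsum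
  rcases hmon with hmon | hanti
  -- If `φ(x) |log x|` decreases as `x` tends to `0`, the terms of the series stay away from `0`.
  · exfalso
    have h0 := hsum.tendsto_atTop_zero
    set ε := Real.exp (-(φ (Real.exp (-((k₀ : ℝ) + 1))) *
      |Real.log (Real.exp (-((k₀ : ℝ) + 1)))|)) with hε
    obtain ⟨k, hk, hkε⟩ := ((eventually_ge_atTop k₀).and
      (h0.eventually_lt_const (Real.exp_pos _ : 0 < ε))).exists
    refine hkε.not_ge (Real.exp_le_exp.2 (neg_le_neg ?_))
    refine hmon (hmem k hk) (hmem k₀ le_rfl) (Real.exp_le_exp.2 ?_)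
    have : (k₀ : ℝ) ≤ k := by exact_mod_cast hk
    linarith
  · set f : ℕ → ℝ := fun k => Real.exp (-(φ (Real.exp (-((k : ℝ) + 1))) *
      |Real.log (Real.exp (-((k : ℝ) + 1)))|)) with hf
    have hfpos : ∀ k, 0 < f k := fun k => Real.exp_pos _
    set S := ∑' k, f k with hS
    have hS0 : 0 < S := hsum.tsum_pos (fun k => (hfpos k).le) 0 (hfpos 0)
    refine ⟨S, k₀ + 1, hS0, ?_⟩
    filter_upwards [Ioo_mem_nhdsGT hx₀,
      tendsto_log_inv_nhdsGT_zero.eventually_ge_atTop ((k₀ : ℝ) + 3)] with x hx hxL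
    set Lx := Real.log x⁻¹ with hLx
    have hfl := Nat.floor_le (by linarith [Nat.cast_nonneg (α := ℝ) k₀] : 0 ≤ Lx)
    have hfl' := Nat.lt_floor_add_one Lx
    -- The term of index `n` belongs to the scale `exp (-(n + 1))`, the last one of the sequence not
    -- below `x`.
    obtain ⟨n, hn⟩ : ∃ n, ⌊Lx⌋₊ = n + 1 := Nat.exists_eq_succ_of_ne_zero (by
      have : 1 ≤ ⌊Lx⌋₊ := Nat.le_floor (by push_cast; linarith [Nat.cast_nonneg (α := ℝ) k₀])
      omega)
    rw [hn] at hfl hfl'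
    push_cast at hfl hfl'
    have hnk : k₀ ≤ n := by
      have : (k₀ : ℝ) < n + 1 := by linarith
      have : k₀ < n + 1 := by exact_mod_cast this
      omega
    have hxn : x ≤ Real.exp (-((n : ℝ) + 1)) := by
      rw [← Real.exp_log hx.1, Real.exp_le_exp]
      rw [hLx, Real.log_inv] at hfl
      linarith
    have hgx := hanti hx (hmem n hnk) hxn
    simp only at hgx
    rw [abs_log_eq_log_inv hx.1 (hx.2.trans hx₁), ← hLx] at hgx
    refine le_trans ?_ hgx
    -- The terms decrease, so the last one is at most the total sum divided by their number.
    have hpart : ((n : ℝ) + 1 - k₀) * f n ≤ S := by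
      have h1 : ∑ k ∈ Finset.Ico k₀ (n + 1), f n ≤ ∑ k ∈ Finset.Ico k₀ (n + 1), f k := by
        refine Finset.sum_le_sum fun k hk => Real.exp_le_exp.2 (neg_le_neg ?_)
        obtain ⟨hk1, hk2⟩ := Finset.mem_Ico.1 hk
        refine hanti (hmem n hnk) (hmem k hk1) (Real.exp_le_exp.2 ?_)
        have : (k : ℝ) ≤ n := by exact_mod_cast Nat.lt_succ_iff.1 hk2
        linarith
      have h2 := hsum.sum_le_tsum (Finset.Ico k₀ (n + 1)) fun k _ => (hfpos k).le
      rw [Finset.sum_const, Nat.card_Ico, nsmul_eq_mul, Nat.cast_sub (by omega)] at h1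
      push_cast at h1
      exact h1.trans h2
    have hlt : (Lx - (k₀ + 1)) / S ≤ Real.exp (φ (Real.exp (-((n : ℝ) + 1))) *
        |Real.log (Real.exp (-((n : ℝ) + 1)))|) := by
      rw [div_le_iff₀ hS0]
      have hfn : f n * Real.exp (φ (Real.exp (-((n : ℝ) + 1))) *
        |Real.log (Real.exp (-((n : ℝ) + 1)))|) = 1 := by
        rw [hf, ← Real.exp_add, neg_add_cancel, Real.exp_zero]
      set e := Real.exp (φ (Real.exp (-((n : ℝ) + 1))) *
        |Real.log (Real.exp (-((n : ℝ) + 1)))|) with he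
      have he0 : 0 < e := Real.exp_pos _
      calc Lx - (k₀ + 1) ≤ ((n : ℝ) + 1 - k₀) * (f n * e) := by rw [hfn]; linarith
        _ = ((n : ℝ) + 1 - k₀) * f n * e := by ring
        _ ≤ e * S := by rw [mul_comm e]; gcongr
    have hpos : 0 < (Lx - (k₀ + 1)) / S := div_pos (by linarith) hS0
    calc Real.log ((Lx - (k₀ + 1)) / S) ≤ Real.log (Real.exp _) := Real.log_le_log hpos hlt
      _ = _ := Real.log_exp _

lemma eventually_logLog_le_two_mul {S c : ℝ} (hS : 0 < S) : ∀ᶠ L : ℝ in atTop,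
    1 + Real.log (1 + L) ≤ 2 * Real.log ((L - c) / S) := by
  have h1 : Tendsto (fun L : ℝ => Real.log (1 + L)) atTop atTop :=
    Real.tendsto_log_atTop.comp (tendsto_atTop_add_const_left _ _ tendsto_id)
  filter_upwards [h1.eventually_ge_atTop (1 + 2 * Real.log (2 * S)),
    eventually_ge_atTop (2 * c + 1), eventually_ge_atTop (0 : ℝ)] with L hL hLc hL0
  have h2 : Real.log ((1 + L) / (2 * S)) ≤ Real.log ((L - c) / S) := by
    refine Real.log_le_log (by positivity) ?_
    rw [div_le_div_iff₀ (by positivity) hS]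
    nlinarith
  rw [Real.log_div (by positivity) (by positivity)] at h2
  linarith

/-- Summability bounds `φ(R) |log R|` below by half the iterated logarithm; passing to `ψ` with `φ =
o(ψ)` gains an arbitrary factor `M`. -/
lemma eventually_mul_logLog_le_of_isLittleO (hφ : IsDimensionFunction φ)
    (hsum : Summable fun k : ℕ => Real.exp (-(φ (Real.exp (-((k : ℝ) + 1))) * ((k : ℝ) + 1))))
    (hψ : IsDimensionFunction ψ) (ho : φ =o[𝓝[>] 0] ψ) (M : ℝ) :
    ∀ᶠ R in 𝓝[>] (0 : ℝ), M * logLog R⁻¹ ≤ ψ R * Real.log R⁻¹ := by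
  obtain ⟨S, c, hS, hlow⟩ := hφ.exists_log_le hsum
  obtain ⟨x₀, hx₀, -, hφpos, -⟩ := hφ
  obtain ⟨x₁, hx₁, -, hψpos, -⟩ := hψ
  set M' := max M 1 with hM'
  have hM'0 : 0 < M' := lt_of_lt_of_le one_pos (le_max_right _ _)
  filter_upwards [hlow, tendsto_log_inv_nhdsGT_zero.eventually (eventually_logLog_le_two_mul
    (c := c) hS), Ioo_mem_nhdsGT hx₀, Ioo_mem_nhdsGT hx₁, Ioo_mem_nhdsGT one_pos,
    ho.bound (by positivity : 0 < 1 / (2 * M'))] with R h1 h2 h3 h4 h5 h6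
  have hR1 : 1 ≤ R⁻¹ := (one_le_inv₀ h5.1).2 h5.2.le
  have hL0 := Real.log_nonneg hR1
  rw [Real.norm_of_nonneg (hφpos R h3).le, Real.norm_of_nonneg (hψpos R h4).le,
    div_mul_eq_mul_div, one_mul, le_div_iff₀ (by positivity)] at h6
  have hH : logLog R⁻¹ ≤ 2 * (φ R * Real.log R⁻¹) := h2.trans (by linarith)
  calc M * logLog R⁻¹ ≤ M' * logLog R⁻¹ := by
        gcongr
        · linarith [one_le_logLog hR1]
        · exact le_max_left _ _
    _ ≤ M' * (2 * (φ R * Real.log R⁻¹)) := by gcongr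
    _ = φ R * (2 * M') * Real.log R⁻¹ := by ring
    _ ≤ ψ R * Real.log R⁻¹ := by gcongr

lemma eventually_mul_logLog_le_const {p : ℝ} (hp : 0 < p) (M : ℝ) :
    ∀ᶠ R in 𝓝[>] (0 : ℝ), M * logLog R⁻¹ ≤ p * Real.log R⁻¹ := by
  have hlo : (fun x : ℝ => Real.log x) =o[atTop] (fun x : ℝ => x) := Real.isLittleO_log_id_atTop
  have h1 : Tendsto (fun L : ℝ => 1 + L) atTop atTop :=
    tendsto_atTop_add_const_left _ _ tendsto_id
  have hε : 0 < p / (2 * (|M| + 1)) := by positivity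
  have h2 := h1.eventually (hlo.bound hε)
  filter_upwards [tendsto_log_inv_nhdsGT_zero.eventually h2,
    tendsto_log_inv_nhdsGT_zero.eventually_ge_atTop 0,
    tendsto_log_inv_nhdsGT_zero.eventually_ge_atTop (2 * (|M| + 1) / p + 1),
    Ioo_mem_nhdsGT one_pos] with R h2 h3 h4 h5
  have hR1 : 1 ≤ R⁻¹ := (one_le_inv₀ h5.1).2 h5.2.le
  rw [Real.norm_of_nonneg (Real.log_nonneg (by linarith)), Real.norm_of_nonneg (by linarith),
    div_mul_eq_mul_div, le_div_iff₀ (by positivity)] at h2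
  have h6 : 2 * (|M| + 1) + p ≤ p * Real.log R⁻¹ := by
    have : 2 * (|M| + 1) ≤ (Real.log R⁻¹ - 1) * p := (div_le_iff₀ hp).1 (by linarith)
    linarith
  calc M * logLog R⁻¹ ≤ (|M| + 1) * logLog R⁻¹ := by
        gcongr
        · linarith [one_le_logLog hR1]
        · linarith [le_abs_self M]
    _ ≤ p * Real.log R⁻¹ := by
        unfold logLog
        nlinarith [abs_nonneg M]

/-- If the series diverges then the dimension function is small on long ranges of scales. -/
lemma IsDimensionFunction.exists_frequently_le (hφ : IsDimensionFunction φ)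
    (hsum : ¬ Summable fun k : ℕ => Real.exp (-(φ (Real.exp (-((k : ℝ) + 1))) * ((k : ℝ) + 1))))
    {c : ℝ} (hc : 0 < c) : ∃ x₁ : ℝ, 0 < x₁ ∧ ∃ᶠ K : ℕ in atTop, ∀ x : ℝ, 0 < x → x < x₁ →
      Real.exp (-(c * K)) ≤ x → φ x * Real.log x⁻¹ ≤ 3 * Real.log K := by
  obtain ⟨x₀, hx₀, hx₁, -, -, hmon⟩ := hφ
  simp_rw [mul_eq_mul_abs_log] at hsum
  have hlogK : Tendsto (fun K : ℕ => Real.log K) atTop atTop :=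
    Real.tendsto_log_atTop.comp tendsto_natCast_atTop_atTop
  rcases hmon with hmon | hanti
  -- In this case `φ(x) |log x|` is bounded near `0`, and every large `K` will do.
  · refine ⟨x₀ / 2, by positivity, Eventually.frequently ?_⟩
    filter_upwards [hlogK.eventually_ge_atTop (φ (x₀ / 2) * |Real.log (x₀ / 2)| / 3)] with K hK
    intro x hx hxx _
    have := hmon (a := x) (b := x₀ / 2) ⟨hx, by linarith⟩ ⟨by positivity, by linarith⟩ hxx.le
    simp only at this
    rw [abs_log_eq_log_inv hx (by linarith)] at this
    linarith
  · refine ⟨x₀, hx₀, ?_⟩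
    -- Otherwise the series would eventually be dominated by the sum of `1 / (n + 1)²`.
    have hfreq : ∃ᶠ n : ℕ in atTop, φ (Real.exp (-((n : ℝ) + 1))) *
        |Real.log (Real.exp (-((n : ℝ) + 1)))| < 2 * Real.log ((n : ℝ) + 1) := by
      by_contra hcon
      refine hsum ?_
      have h2 : Summable fun n : ℕ => 1 / ((n : ℝ) + 1) ^ 2 := by
        have := (summable_nat_add_iff 1).2 (Real.summable_one_div_nat_pow.2 one_lt_two)
        simpa using this
      refine Summable.of_norm_bounded_eventually_nat h2 ?_
      filter_upwards [not_frequently.1 hcon] with n hn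
      push Not at hn
      rw [Real.norm_of_nonneg (Real.exp_pos _).le]
      calc _ ≤ Real.exp (-(2 * Real.log ((n : ℝ) + 1))) := Real.exp_le_exp.2 (neg_le_neg hn)
        _ = 1 / ((n : ℝ) + 1) ^ 2 := by
          rw [Real.exp_neg, mul_comm, Real.exp_mul, Real.exp_log (by positivity), one_div]
          norm_cast
    -- Take `K = ⌊(n + 1) / c⌋`: then `exp (-cK) ≥ exp (-(n + 1))`, and monotonicity carries the
    -- bound at the latter scale to all larger `x`. The factor `3` instead of `2` absorbs the change
    -- from `n + 1` to `K` once `K ≥ 4c²`.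
    have hfloor : Tendsto (fun n : ℕ => ⌊((n : ℝ) + 1) / c⌋₊) atTop atTop :=
      tendsto_nat_floor_atTop.comp
        ((tendsto_atTop_add_const_right _ _ tendsto_natCast_atTop_atTop).atTop_div_const hc)
    refine hfloor.frequently ?_
    obtain ⟨K₁, hK₁⟩ := exists_nat_ge (4 * c ^ 2)
    refine (hfreq.and_eventually ((eventually_exp_neg_lt hx₀).and
      (hfloor.eventually_ge_atTop (K₁ + 1)))).mono ?_
    rintro n ⟨hn, hnx, hnK⟩ x hx hxx hxK
    set K := ⌊((n : ℝ) + 1) / c⌋₊ with hK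
    have hK1 : c * K ≤ (n : ℝ) + 1 := by
      have := Nat.floor_le (by positivity : 0 ≤ ((n : ℝ) + 1) / c)
      rw [le_div_iff₀ hc] at this
      linarith
    have hK2 : (n : ℝ) + 1 < c * (K + 1) := by
      have := Nat.lt_floor_add_one (((n : ℝ) + 1) / c)
      rw [div_lt_iff₀ hc] at this
      linarith
    have hK3 : 4 * c ^ 2 ≤ K := hK₁.trans (by exact_mod_cast (Nat.le_succ _).trans hnK)
    have hK4 : (1 : ℝ) ≤ K := by exact_mod_cast (Nat.le_add_left 1 K₁).trans hnK
    have := hanti (a := Real.exp (-((n : ℝ) + 1))) (b := x) ⟨Real.exp_pos _, hnx⟩ ⟨hx, hxx⟩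
      ((Real.exp_le_exp.2 (by linarith)).trans hxK)
    simp only at this
    rw [abs_log_eq_log_inv hx (hxx.trans hx₁)] at this
    refine this.trans (hn.le.trans ?_)
    have e2 : 2 * Real.log ((n : ℝ) + 1) = Real.log (((n : ℝ) + 1) ^ 2) := by
      rw [Real.log_pow]; norm_num
    have e3 : 3 * Real.log (K : ℝ) = Real.log ((K : ℝ) ^ 3) := by rw [Real.log_pow]; norm_num
    rw [e2, e3]
    refine Real.log_le_log (by positivity) ?_
    calc ((n : ℝ) + 1) ^ 2 ≤ (c * (K + 1)) ^ 2 := by gcongr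
      _ ≤ (c * (2 * K)) ^ 2 := by gcongr; linarith
      _ = 4 * c ^ 2 * K ^ 2 := by ring
      _ ≤ K * K ^ 2 := by gcongr
      _ = (K : ℝ) ^ 3 := by ring

end DimensionFunctions

/-! ## The summable case -/

section Summable

variable {Λ : Type*} [Fintype Λ] {I : Λ → BMSystem} {ω : ℕ → Λ} {a c ρ : ℝ}

lemma IsTypical.genAssouadDim_eq (h : IsTypical I ω a c ρ) (hρ0 : 0 < ρ) (hρ1 : ρ < 1)
    (hd : 0 ≤ a + c) {ψ : ℝ → ℝ}
    (hY : ∀ M : ℝ, ∀ᶠ R in 𝓝[>] (0 : ℝ), M * logLog R⁻¹ ≤ ψ R * Real.log R⁻¹)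
    (hψ : ∀ᶠ R in 𝓝[>] (0 : ℝ), ψ R ≤ ρ⁻¹ - 1) :
    genAssouadDim ψ (carpet I ω) = a + c := by
  refine RandomCarpet.genAssouadDim_eq hd (fun ε hε => ?_) (fun ε hε => ?_) hY
  · obtain ⟨A, hA0, hA⟩ := h.coveringNum_le hε
    exact ⟨A, hA0, fun r R hr hrR hR x _ => hA r R hr hrR hR x⟩
  · obtain ⟨A, hA0, x, hx, hA⟩ := h.exists_le_coveringNum hρ1 hε
    refine ⟨A, hA0, ?_⟩
    filter_upwards [hψ, hY 1, Ioo_mem_nhdsGT one_pos] with R hR1 hR2 hR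
    have hRinv : 1 ≤ R⁻¹ := (one_le_inv₀ hR.1).2 hR.2.le
    have hr : 0 < R ^ (1 + ψ R) := Real.rpow_pos_of_pos hR.1 _
    have hlog := log_div_rpow (p := ψ R) hR.1
    refine ⟨x, hx, ?_⟩
    rw [← hlog]
    refine hA _ R hr ?_ hR.2 ?_
    · rw [← le_div_iff₀ hr, ← Real.log_le_log_iff two_pos (by have := hR.1; positivity), hlog]
      linarith [one_le_logLog hRinv, Real.log_two_lt_d9]
    · have e : Real.log (R ^ (1 + ψ R))⁻¹ = (1 + ψ R) * Real.log R⁻¹ := by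
        rw [Real.log_inv, Real.log_rpow hR.1, Real.log_inv]
        ring
      rw [e, ← mul_assoc]
      refine mul_le_of_le_one_left (Real.log_nonneg hRinv) ?_
      calc ρ * (1 + ψ R) ≤ ρ * ρ⁻¹ := by gcongr; linarith
        _ = 1 := mul_inv_cancel₀ hρ0.ne'

/-- For `ρ < θ < 1` the constant `1/θ - 1` is an admissible `ψ`, so the spectrum is already constant
near `1`. -/
lemma IsTypical.isQuasiAssouadDim (h : IsTypical I ω a c ρ) (hρ0 : 0 < ρ) (hρ1 : ρ < 1)
    (hd : 0 ≤ a + c) : IsQuasiAssouadDim (carpet I ω) (a + c) := by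
  refine Tendsto.congr' (f₁ := fun _ => a + c) ?_ tendsto_const_nhds
  filter_upwards [Ioo_mem_nhdsLT hρ1] with θ hθ
  have hθ0 : 0 < θ := hρ0.trans hθ.1
  have hpos : 0 < 1 / θ - 1 := by
    rw [sub_pos, lt_div_iff₀ hθ0]
    linarith [hθ.2]
  refine (h.genAssouadDim_eq hρ0 hρ1 hd (eventually_mul_logLog_le_const hpos)
    (Eventually.of_forall fun R => ?_)).symm
  rw [one_div]
  exact sub_le_sub_right (inv_anti₀ hρ0 hθ.1.le) 1

variable [MeasurableSpace Λ] [MeasurableSingletonClass Λ]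
  (μ : Measure Λ) [IsProbabilityMeasure μ]

lemma integral_sub_mul_eq_zero (X W : Λ → ℝ) (hW : ∫ l, W l ∂μ ≠ 0) :
    ∫ l, (X l - (∫ l, X l ∂μ) / (∫ l, W l ∂μ) * W l) ∂μ = 0 := by
  rw [integral_sub .of_finite .of_finite, integral_const_mul, div_mul_cancel₀ _ hW, sub_self]

theorem ae_isTypical (I : Λ → BMSystem) (hm : ∫ l, Real.log ((I l).m : ℝ) ∂μ ≠ 0)
    (hn : ∫ l, Real.log ((I l).n : ℝ) ∂μ ≠ 0) : ∀ᵐ ω ∂(iidLaw μ), IsTypical I ω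
      ((∫ l, Real.log ((I l).B : ℝ) ∂μ) / ∫ l, Real.log ((I l).m : ℝ) ∂μ)
      ((∫ l, Real.log ((I l).C : ℝ) ∂μ) / ∫ l, Real.log ((I l).n : ℝ) ∂μ)
      ((∫ l, Real.log ((I l).m : ℝ) ∂μ) / ∫ l, Real.log ((I l).n : ℝ) ∂μ) := by
  filter_upwards [ae_hasSmallWindowSums μ (integral_sub_mul_eq_zero μ
      (fun l => Real.log ((I l).B : ℝ)) (fun l => Real.log ((I l).m : ℝ)) hm),
    ae_hasSmallWindowSums μ (integral_sub_mul_eq_zero μ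
      (fun l => Real.log ((I l).C : ℝ)) (fun l => Real.log ((I l).n : ℝ)) hn),
    ae_hasSmallWindowSums μ (integral_sub_mul_eq_zero μ
      (fun l => Real.log ((I l).m : ℝ)) (fun l => Real.log ((I l).n : ℝ)) hn)] with ω h1 h2 h3
  exact ⟨h1, h2, h3⟩

lemma integral_log_m_pos (I : Λ → BMSystem) : 0 < ∫ l, Real.log ((I l).m : ℝ) ∂μ := by
  have h : ∫ _ : Λ, Real.log 2 ∂μ ≤ ∫ l, Real.log ((I l).m : ℝ) ∂μ :=
    integral_mono .of_finite .of_finite fun l =>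
      Real.log_le_log two_pos (by exact_mod_cast (I l).two_le_m)
  rw [integral_const, probReal_univ, one_smul] at h
  linarith [half_lt_log_two]

lemma integral_log_m_lt_integral_log_n (I : Λ → BMSystem) :
    ∫ l, Real.log ((I l).m : ℝ) ∂μ < ∫ l, Real.log ((I l).n : ℝ) ∂μ := by
  have hpos : ∀ l, 0 < Real.log ((I l).n : ℝ) - Real.log ((I l).m : ℝ) := fun l =>
    sub_pos.2 (Real.log_lt_log (by have := (I l).two_le_m; positivity)
      (by exact_mod_cast (I l).m_lt_n))
  rw [← sub_pos, ← integral_sub .of_finite .of_finite,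
    integral_pos_iff_support_of_nonneg (fun l => (hpos l).le) .of_finite]
  have : Function.support (fun l => Real.log ((I l).n : ℝ) - Real.log ((I l).m : ℝ)) = univ :=
    eq_univ_of_forall fun l => (hpos l).ne'
  rw [this, measure_univ]
  exact one_pos

/-- The first part of the theorem: below the critical rate, the generalised Assouad spectra of
typical carpets are equal to the quasi-Assouad dimension. -/
theorem isQuasiAssouadDim_genAssouadDim (I : Λ → BMSystem) {φ : ℝ → ℝ}
    (hφ : IsDimensionFunction φ)
    (hsum : Summable fun k : ℕ => Real.exp (-(φ (Real.exp (-((k : ℝ) + 1))) * ((k : ℝ) + 1)))) :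
    ∀ᵐ ω ∂(iidLaw μ), ∀ ψ : ℝ → ℝ, IsDimensionFunction ψ → φ =o[𝓝[>] 0] ψ →
      (∀ᶠ x in 𝓝[>] (0 : ℝ), ψ x ≤ Real.log (geomMean μ fun l => ((I l).n : ℝ)) /
        Real.log (geomMean μ fun l => ((I l).m : ℝ)) - 1) →
      IsQuasiAssouadDim (carpet I ω) (genAssouadDim ψ (carpet I ω)) := by
  have hm := integral_log_m_pos μ I
  have hmn := integral_log_m_lt_integral_log_n μ I
  have hn := hm.trans hmn
  filter_upwards [ae_isTypical μ I hm.ne' hn.ne'] with ω hω ψ hψ ho hle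
  have hd : 0 ≤ (∫ l, Real.log ((I l).B : ℝ) ∂μ) / (∫ l, Real.log ((I l).m : ℝ) ∂μ) +
      (∫ l, Real.log ((I l).C : ℝ) ∂μ) / ∫ l, Real.log ((I l).n : ℝ) ∂μ :=
    add_nonneg
      (div_nonneg (integral_nonneg fun l => Real.log_natCast_nonneg _) hm.le)
      (div_nonneg (integral_nonneg fun l => Real.log_natCast_nonneg _) hn.le)
  have hρ1 := (div_lt_one hn).2 hmn
  have hρ0 := div_pos hm hn
  have hgen := hω.genAssouadDim_eq hρ0 hρ1 hd
    (eventually_mul_logLog_le_of_isLittleO hφ hsum hψ ho) (by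
      simpa only [geomMean, Real.log_exp, inv_div] using hle)
  rw [hgen]
  exact hω.isQuasiAssouadDim hρ0 hρ1 hd

end Summable

/-! ## The divergent case -/

section Divergent

variable {Λ : Type*} [Fintype Λ] {I : Λ → BMSystem} {ω : ℕ → Λ} {a c : ℝ}

/-- The deterministic upper bound for the covering numbers of a carpet. -/
lemma coveringNum_carpet_le_of_forall_le
    (ha : ∀ l, Real.log ((I l).B : ℝ) ≤ a * Real.log ((I l).m : ℝ))
    (hc : ∀ l, Real.log ((I l).C : ℝ) ≤ c * Real.log ((I l).n : ℝ)) (ha0 : 0 ≤ a) (hc0 : 0 ≤ c) :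
    ∃ K : ℝ, 0 < K ∧ ∀ r R : ℝ, 0 < r → r ≤ R → R < 1 → ∀ x ∈ carpet I ω,
      coveringNum r (carpet I ω ∩ Metric.closedBall x R) ≤
        ENNReal.ofReal (K * (R / r) ^ (a + c)) := by
  refine ⟨Real.exp (logConst I + (a + c) * Real.log (maxBase I)), Real.exp_pos _,
    fun r R hr hrR hR x _ => ?_⟩
  have hR0 := hr.trans_le hrR
  refine (coveringNum_carpet_le_exp I ω hr hrR hR x).trans (ENNReal.ofReal_le_ofReal ?_)
  rw [rpow_eq_exp_mul_log hR0 hr, ← Real.exp_add, Real.exp_le_exp]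
  have hinv : R⁻¹ ≤ r⁻¹ := inv_anti₀ hr hrR
  have hR1 : 1 ≤ R⁻¹ := (one_le_inv₀ hR0).2 hR.le
  have hlog : Real.log (R / r) = Real.log r⁻¹ - Real.log R⁻¹ := by
    rw [Real.log_inv, Real.log_inv, Real.log_div hR0.ne' hr.ne']
    ring
  have key : ∀ (b : ℕ → ℕ) (X : Λ → ℝ) (s : ℝ), (∀ j, 2 ≤ b j) → (∀ j, b j ≤ maxBase I) →
      0 ≤ s → (∀ j, X (ω j) ≤ s * Real.log (b j)) →
      ∑ j ∈ Finset.Ico (level b R⁻¹) (level b r⁻¹), X (ω j) ≤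
        s * (Real.log (maxBase I) + Real.log (R / r)) := by
    intro b X s hb hβ hs hX
    have h1 := Finset.sum_le_sum (s := Finset.Ico (level b R⁻¹) (level b r⁻¹)) fun j _ => hX j
    rw [← Finset.mul_sum, ← log_place_sub hb (level_mono hb hinv)] at h1
    refine h1.trans (mul_le_mul_of_nonneg_left ?_ hs)
    have h2 := (log_place_level_mem hb hβ hR1).1
    have h3 := (log_place_level_mem hb hβ (hR1.trans hinv)).2
    linarith
  have h1 := key _ (fun l => Real.log ((I l).B : ℝ)) a (two_le_cols I ω) (cols_le_maxBase I ω) ha0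
    fun j => ha (ω j)
  have h2 := key _ (fun l => Real.log ((I l).C : ℝ)) c (two_le_rows I ω) (rows_le_maxBase I ω) hc0
    fun j => hc (ω j)
  linarith

/-- Along long runs of extremal systems, the covering numbers are as large as possible. -/
lemma exists_le_coveringNum_of_isRun (I : Λ → BMSystem) (ω : ℕ → Λ) {b b' : Λ}
    (ha : Real.log ((I b).B : ℝ) = a * Real.log ((I b).m : ℝ))
    (hc : Real.log ((I b').C : ℝ) = c * Real.log ((I b').n : ℝ)) (ha0 : 0 ≤ a) (hc0 : 0 ≤ c) :
    ∃ x ∈ carpet I ω, ∀ k L : ℕ, k + L ≤ columnLevel I k ω → IsRun b' k L ω →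
      IsRun b (columnLevel I k ω) L ω → ∀ r R : ℝ, 0 < r → R = 2 / place (rows I ω) k →
      2 * r ≤ R → Real.log (R / r) ≤ L * Real.log 2 →
      ENNReal.ofReal (Real.exp ((a + c) * Real.log (R / r) -
        (logConst I + (a + c) * (1 + Real.log (maxBase I))))) ≤
          coveringNum r (carpet I ω ∩ Metric.closedBall x R) := by
  obtain ⟨x, hx, hlow⟩ := exists_exp_le_coveringNum_carpet I ω
  refine ⟨x, hx, fun k L hkL hrun hrun' r R hr hR hrR hL => ?_⟩
  have hN := place_cast_pos (two_le_rows I ω) k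
  have hN1 : (1 : ℝ) ≤ place (rows I ω) k := by exact_mod_cast place_pos (two_le_rows I ω) k
  have hR0 : 0 < R := by rw [hR]; positivity
  set T : ℝ := ((place (rows I ω) k : ℕ) : ℝ) with hT
  have hTR : T = 2 * R⁻¹ := by rw [hR]; field_simp
  have hTr : T ≤ r⁻¹ := by
    rw [hTR, ← div_eq_mul_inv, div_le_iff₀ hR0, inv_mul_eq_div, le_div_iff₀ hr]
    exact hrR
  have hr1 : 1 ≤ r⁻¹ := hN1.trans hTr
  have hβ1 : (1 : ℝ) ≤ maxBase I := by
    exact_mod_cast (one_le_two.trans (two_le_cols I ω 0)).trans (cols_le_maxBase I ω 0)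
  have hlβ := Real.log_nonneg hβ1
  have hrL : r⁻¹ ≤ T * 2 ^ L := by
    have h1 : R / r ≤ 2 ^ L := by
      rw [← Real.log_le_log_iff (by positivity) (by positivity), Real.log_pow]
      exact hL
    have h2 : r⁻¹ = R / r * (T / 2) := by rw [hTR]; field_simp
    rw [h2]
    nlinarith [pow_pos (two_pos (α := ℝ)) L]
  set k₁ := columnLevel I k ω with hk₁
  set l₁ := level (cols I ω) r⁻¹ with hl₁
  set l₂ := level (rows I ω) r⁻¹ with hl₂
  have hkl₁ : k₁ ≤ l₁ := level_mono (two_le_cols I ω) hTr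
  have hkl₂ : k ≤ l₂ := by
    have := level_mono (two_le_rows I ω) hTr
    rwa [hT, level_place (two_le_rows I ω)] at this
  have hTk₁ : T ≤ place (cols I ω) k₁ := le_place_level (two_le_cols I ω) T
  -- All bases are at least `2`, so `L` levels suffice to pass from scale `R` to scale `r`; both
  -- windows stay inside the runs.
  have hl₂L : l₂ ≤ k + L := level_le (hrL.trans (by
    rw [hT]
    exact_mod_cast le_place_add (two_le_rows I ω) k L))
  have hl₁L : l₁ ≤ k₁ + L := by
    refine level_le (hrL.trans ?_)
    calc T * 2 ^ L ≤ place (cols I ω) k₁ * 2 ^ L := by gcongr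
      _ ≤ _ := by exact_mod_cast le_place_add (two_le_cols I ω) k₁ L
  have hsmall : ∀ b : ℕ → ℕ, (∀ j, 2 ≤ b j) → (∀ j, b j ≤ maxBase I) →
      r * place b (level b r⁻¹) ≤ maxBase I := by
    intro b hb hβ
    have := mul_le_mul_of_nonneg_left (place_level_le hb hβ hr1) hr.le
    rwa [mul_left_comm, mul_inv_cancel₀ hr.ne', mul_one] at this
  have hRT : R * T = 2 := by rw [hTR]; field_simp
  refine le_trans (ENNReal.ofReal_le_ofReal (Real.exp_le_exp.2 ?_))
    (hlow hkl₂ (hl₂L.trans hkL) hkl₁ (by rw [← hRT]; gcongr) hRT.ge hr.le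
      (hsmall _ (two_le_cols I ω) (cols_le_maxBase I ω))
      (hsmall _ (two_le_rows I ω) (rows_le_maxBase I ω)))
  have hB : ∑ j ∈ Finset.Ico k₁ l₁, Real.log ((I (ω j)).B : ℝ) =
      a * (Real.log (place (cols I ω) l₁) - Real.log (place (cols I ω) k₁)) := by
    rw [log_place_sub (two_le_cols I ω) hkl₁, Finset.mul_sum]
    refine Finset.sum_congr rfl fun j hj => ?_
    obtain ⟨h1, h2⟩ := Finset.mem_Ico.1 hj
    rw [cols, hrun' j h1 (by omega), ha]
  have hC : ∑ j ∈ Finset.Ico k l₂, Real.log ((I (ω j)).C : ℝ) =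
      c * (Real.log (place (rows I ω) l₂) - Real.log (place (rows I ω) k)) := by
    rw [log_place_sub (two_le_rows I ω) hkl₂, Finset.mul_sum]
    refine Finset.sum_congr rfl fun j hj => ?_
    obtain ⟨h1, h2⟩ := Finset.mem_Ico.1 hj
    rw [rows, hrun j h1 (by omega), hc]
  have e1 := (log_place_level_mem (two_le_cols I ω) (cols_le_maxBase I ω) hr1).1
  have e2 := (log_place_level_mem (two_le_rows I ω) (rows_le_maxBase I ω) hr1).1
  have e3 : Real.log (place (cols I ω) k₁) ≤ Real.log (maxBase I) + Real.log T :=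
    (log_place_level_mem (two_le_cols I ω) (cols_le_maxBase I ω) hN1).2
  have hlog : Real.log r⁻¹ - Real.log T = Real.log (R / r) - Real.log 2 := by
    rw [hTR, Real.log_mul two_ne_zero (by positivity), Real.log_inv, Real.log_inv,
      Real.log_div hR0.ne' hr.ne']
    ring
  have hlog2 : Real.log 2 ≤ 1 := by linarith [Real.log_two_lt_d9]
  have f1 : a * (Real.log (R / r) - 1 - Real.log (maxBase I)) ≤
      a * (Real.log (place (cols I ω) l₁) - Real.log (place (cols I ω) k₁)) :=
    mul_le_mul_of_nonneg_left (by linarith) ha0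
  have f2 : c * (Real.log (R / r) - 1 - Real.log (maxBase I)) ≤
      c * (Real.log (place (rows I ω) l₂) - Real.log (place (rows I ω) k)) :=
    mul_le_mul_of_nonneg_left (by linarith) hc0
  rw [hB, hC]
  linarith

lemma le_of_unbounded_scales {E : Type*} [PseudoMetricSpace E] {F : Set E} {d s C K : ℝ}
    (hC : 0 < C) (h : ∀ M : ℝ, ∃ r R : ℝ, 0 < r ∧ 0 < R ∧ M ≤ Real.log (R / r) ∧ ∃ x ∈ F,
      ENNReal.ofReal (Real.exp (d * Real.log (R / r) - K)) ≤
        coveringNum r (F ∩ Metric.closedBall x R) ∧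
      coveringNum r (F ∩ Metric.closedBall x R) ≤ ENNReal.ofReal (C * (R / r) ^ s)) :
    d ≤ s := by
  by_contra hcon
  push Not at hcon
  obtain ⟨r, R, hr, hR, hM, x, -, h1, h2⟩ := h ((Real.log C + K + 1) / (d - s))
  have h3 := (ENNReal.ofReal_le_ofReal_iff (by positivity)).1 (h1.trans h2)
  rw [rpow_eq_exp_mul_log hR hr, ← Real.exp_log hC, ← Real.exp_add, Real.exp_le_exp] at h3
  rw [div_le_iff₀ (by linarith)] at hM
  linarith

omit [Fintype Λ] in
lemma eventually_two_div_place_lt (I : Λ → BMSystem) (ω : ℕ → Λ) {η : ℝ} (hη : 0 < η) :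
    ∀ᶠ K : ℕ in atTop, ∀ k : ℕ, K ≤ 2 * k → 2 / (place (rows I ω) k : ℝ) < η := by
  have h : Tendsto (fun k : ℕ => 2 / (2 : ℝ) ^ k) atTop (𝓝 0) :=
    tendsto_const_nhds.div_atTop (tendsto_pow_atTop_atTop_of_one_lt one_lt_two)
  obtain ⟨k₀, hk₀⟩ := eventually_atTop.1 (h.eventually_lt_const hη)
  filter_upwards [eventually_ge_atTop (2 * k₀)] with K hK k hk
  refine lt_of_le_of_lt ?_ (hk₀ k (by omega))
  gcongr
  exact_mod_cast two_pow_le_place (two_le_rows I ω) k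

variable {b b' : Λ} {δ : ℝ}

/-- The scales `R = 2 / place (rows I ω) k` and `r = R / 2^L` exploit a whole run, and the lengths
`L` are unbounded. -/
lemma HasLongRuns.assouadDim_eq (hω : HasLongRuns I b b' δ ω) (hδ : 0 < δ)
    (ha : ∀ l, Real.log ((I l).B : ℝ) ≤ a * Real.log ((I l).m : ℝ))
    (hc : ∀ l, Real.log ((I l).C : ℝ) ≤ c * Real.log ((I l).n : ℝ)) (ha0 : 0 ≤ a) (hc0 : 0 ≤ c)
    (hab : Real.log ((I b).B : ℝ) = a * Real.log ((I b).m : ℝ))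
    (hcb : Real.log ((I b').C : ℝ) = c * Real.log ((I b').n : ℝ)) :
    assouadDim (carpet I ω) = a + c := by
  have hmem : a + c ∈ {s : ℝ | 0 ≤ s ∧ ∃ C : ℝ, 0 < C ∧ ∀ r R : ℝ, 0 < r → r ≤ R → R < 1 →
      ∀ x ∈ carpet I ω, coveringNum r (carpet I ω ∩ Metric.closedBall x R) ≤
        ENNReal.ofReal (C * (R / r) ^ s)} :=
    ⟨add_nonneg ha0 hc0, coveringNum_carpet_le_of_forall_le ha hc ha0 hc0⟩
  refine le_antisymm (csInf_le ⟨0, fun s hs => hs.1⟩ hmem) (le_csInf ⟨_, hmem⟩ ?_)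
  rintro s ⟨-, C, hC, hs⟩
  obtain ⟨x, hx, hlow⟩ := exists_le_coveringNum_of_isRun I ω hab hcb ha0 hc0
  refine le_of_unbounded_scales (F := carpet I ω) hC
    (K := logConst I + (a + c) * (1 + Real.log (maxBase I))) fun M => ?_
  have hlogK : Tendsto (fun K : ℕ => Real.log K) atTop atTop :=
    Real.tendsto_log_atTop.comp tendsto_natCast_atTop_atTop
  obtain ⟨K, ⟨k, L, hL, hk, hkL, hKτ, hrun, hrun'⟩, hKM, hsmall⟩ := (hω.and
    ((hlogK.eventually_ge_atTop ((2 * |M| + 1) / δ)).and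
      (eventually_two_div_place_lt I ω one_pos))).exists
  have hR1 := hsmall k hk
  have hN := place_cast_pos (two_le_rows I ω) k
  set R : ℝ := 2 / place (rows I ω) k with hR
  have hR0 : 0 < R := by positivity
  rw [div_le_iff₀ hδ] at hKM
  have hLM : 2 * |M| + 1 ≤ L := by linarith
  have hL1 : 1 ≤ L := by
    have : (1 : ℝ) ≤ L := by linarith [abs_nonneg M]
    exact_mod_cast this
  have hlog : Real.log (R / (R / 2 ^ L)) = L * Real.log 2 := by
    rw [div_div_cancel₀ hR0.ne', Real.log_pow]
  have h2L : (2 : ℝ) ≤ 2 ^ L := by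
    calc (2 : ℝ) = 2 ^ 1 := (pow_one _).symm
      _ ≤ 2 ^ L := pow_le_pow_right₀ one_le_two hL1
  have hr0 : 0 < R / 2 ^ L := by positivity
  have hrR : 2 * (R / 2 ^ L) ≤ R := by
    rw [mul_div_assoc', div_le_iff₀ (by positivity)]
    nlinarith
  refine ⟨R / 2 ^ L, R, hr0, hR0, ?_, x, hx, ?_, ?_⟩
  · rw [hlog]
    nlinarith [half_lt_log_two, le_abs_self M, abs_nonneg M]
  · exact hlow k L (hkL.trans hKτ) hrun hrun' _ R hr0 rfl hrR hlog.le
  · exact hs _ R hr0 (by linarith) hR1 x hx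

/-- Runs exist for all large `K` and `φ` is small for infinitely many `K`, so both occur together.
As `k ≤ K`, the scale `R` lies in the range where `φ(R) |log R| ≤ 3 log K`; the factor `δ log 2 / 3`
then gives `log (R/r) ≤ L log 2`. Divergence of `ψ(x) |log x|` makes `log (R/r)` unbounded. -/
lemma HasLongRuns.genAssouadDim_eq (hω : HasLongRuns I b b' δ ω) (hδ : 0 < δ)
    (ha : ∀ l, Real.log ((I l).B : ℝ) ≤ a * Real.log ((I l).m : ℝ))
    (hc : ∀ l, Real.log ((I l).C : ℝ) ≤ c * Real.log ((I l).n : ℝ)) (ha0 : 0 ≤ a) (hc0 : 0 ≤ c)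
    (hab : Real.log ((I b).B : ℝ) = a * Real.log ((I b).m : ℝ))
    (hcb : Real.log ((I b').C : ℝ) = c * Real.log ((I b').n : ℝ)) {φ ψ : ℝ → ℝ}
    (hφ : IsDimensionFunction φ)
    (hsum : ¬ Summable fun k : ℕ => Real.exp (-(φ (Real.exp (-((k : ℝ) + 1))) * ((k : ℝ) + 1))))
    (hψ : Tendsto (fun x => ψ x * |Real.log x|) (𝓝[>] 0) atTop)
    (hle : ∀ᶠ x in 𝓝[>] (0 : ℝ), ψ x ≤ δ * Real.log 2 / 3 * φ x) :
    genAssouadDim ψ (carpet I ω) = a + c := by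
  have hmem : a + c ∈ {s : ℝ | 0 ≤ s ∧ ∃ C : ℝ, 0 < C ∧ ∀ r R : ℝ, 0 < r → r = R ^ (1 + ψ R) →
      r < R → 0 < R → R < 1 →
      ∀ x ∈ carpet I ω, coveringNum r (carpet I ω ∩ Metric.closedBall x R) ≤
        ENNReal.ofReal (C * (R / r) ^ s)} := by
    obtain ⟨K, hK, hcov⟩ := coveringNum_carpet_le_of_forall_le (ω := ω) ha hc ha0 hc0
    exact ⟨add_nonneg ha0 hc0, K, hK, fun r R hr _ hrR _ hR => hcov r R hr hrR.le hR⟩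
  refine le_antisymm (csInf_le ⟨0, fun s hs => hs.1⟩ hmem) (le_csInf ⟨_, hmem⟩ ?_)
  rintro s ⟨-, C, hC, hs⟩
  obtain ⟨x, hx, hlow⟩ := exists_le_coveringNum_of_isRun I ω hab hcb ha0 hc0
  refine le_of_unbounded_scales (F := carpet I ω) hC
    (K := logConst I + (a + c) * (1 + Real.log (maxBase I))) fun M => ?_
  have hβ2 : (2 : ℝ) ≤ maxBase I := by
    exact_mod_cast (two_le_cols I ω 0).trans (cols_le_maxBase I ω 0)
  obtain ⟨x₁, hx₁, hfreq⟩ := hφ.exists_frequently_le hsum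
    (Real.log_pos (by linarith : (1 : ℝ) < maxBase I))
  obtain ⟨η, hη0, hη⟩ := (mem_nhdsGT_iff_exists_Ioo_subset' (zero_lt_one (α := ℝ))).1
    ((hψ.eventually_ge_atTop (max M 1)).and hle)
  have hη0 : 0 < η := hη0
  obtain ⟨K, hKφ, ⟨k, L, hL, hk, hkL, hKτ, hrun, hrun'⟩, hsmall⟩ := (hfreq.and_eventually
    (hω.and (eventually_two_div_place_lt I ω (lt_min (lt_min hx₁ hη0) one_pos)))).exists
  have hRsmall := hsmall k hk
  have hN := place_cast_pos (two_le_rows I ω) k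
  set R : ℝ := 2 / place (rows I ω) k with hR
  have hR0 : 0 < R := by positivity
  have hR1 : R < 1 := hRsmall.trans_le (min_le_right _ _)
  have hRη : R < η := hRsmall.trans_le ((min_le_left _ _).trans (min_le_right _ _))
  have hRx : R < x₁ := hRsmall.trans_le ((min_le_left _ _).trans (min_le_left _ _))
  have hRK : Real.exp (-(Real.log (maxBase I) * K)) ≤ R := by
    have h1 : (place (rows I ω) k : ℝ) ≤ (maxBase I : ℝ) ^ K := by
      have h2 : place (rows I ω) k ≤ maxBase I ^ k := by
        simpa using place_add_le (rows_le_maxBase I ω) 0 k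
      calc (place (rows I ω) k : ℝ) ≤ (maxBase I : ℝ) ^ k := by exact_mod_cast h2
        _ ≤ _ := pow_le_pow_right₀ (by linarith) (by omega)
    rw [Real.exp_neg, mul_comm, Real.exp_nat_mul, Real.exp_log (by linarith), hR,
      ← one_div, div_le_div_iff₀ (by positivity) hN]
    linarith [pow_pos (by linarith : (0 : ℝ) < maxBase I) K]
  have hφR := hKφ R hR0 hRx hRK
  obtain ⟨hψR, hψφ⟩ := hη ⟨hR0, hRη⟩
  rw [abs_log_eq_log_inv hR0 hR1] at hψR
  have hlR : 0 ≤ Real.log R⁻¹ := Real.log_nonneg ((one_le_inv₀ hR0).2 hR1.le)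
  have hlog : Real.log (R / R ^ (1 + ψ R)) = ψ R * Real.log R⁻¹ := log_div_rpow hR0
  have hr : 0 < R ^ (1 + ψ R) := Real.rpow_pos_of_pos hR0 _
  have hrR : 2 * R ^ (1 + ψ R) ≤ R := by
    rw [← le_div_iff₀ hr, ← Real.log_le_log_iff two_pos (by positivity), hlog]
    linarith [le_max_right M 1, Real.log_two_lt_d9]
  have hYL : Real.log (R / R ^ (1 + ψ R)) ≤ L * Real.log 2 := by
    rw [hlog]
    have hl2 := half_lt_log_two
    calc ψ R * Real.log R⁻¹ ≤ δ * Real.log 2 / 3 * φ R * Real.log R⁻¹ := by gcongr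
      _ = δ * Real.log 2 / 3 * (φ R * Real.log R⁻¹) := by ring
      _ ≤ δ * Real.log 2 / 3 * (3 * Real.log K) := by gcongr
      _ = δ * Real.log K * Real.log 2 := by ring
      _ ≤ L * Real.log 2 := by gcongr
  refine ⟨R ^ (1 + ψ R), R, hr, hR0, ?_, x, hx, ?_, ?_⟩
  · rw [hlog]
    exact (le_max_left _ _).trans hψR
  · exact hlow k L (hkL.trans hKτ) hrun hrun' _ R hr rfl hrR hYL
  · exact hs _ R hr rfl (by linarith) hR0 hR1 x hx

lemma exists_isMax_ratio [Nonempty Λ] (X W : Λ → ℝ) (hX : ∀ l, 0 ≤ X l) (hW : ∀ l, 0 < W l) :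
    ∃ l₀, 0 ≤ (⨆ l, X l / W l) ∧ X l₀ = (⨆ l, X l / W l) * W l₀ ∧
      ∀ l, X l ≤ (⨆ l, X l / W l) * W l := by
  obtain ⟨l₀, hl₀⟩ := exists_eq_ciSup_of_finite (f := fun l => X l / W l)
  refine ⟨l₀, ?_, ?_, fun l => ?_⟩
  · rw [← hl₀]
    exact div_nonneg (hX l₀) (hW l₀).le
  · rw [← hl₀, div_mul_cancel₀ _ (hW l₀).ne']
  · rw [← div_le_iff₀ (hW l)]
    exact le_ciSup (f := fun l => X l / W l) (Set.finite_range _).bddAbove l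

end Divergent

end RandomCarpet

end

theorem mainTheorem2 {Λ : Type*} [Fintype Λ] [MeasurableSpace Λ] [MeasurableSingletonClass Λ]
    (μ : MeasureTheory.Measure Λ) [MeasureTheory.IsProbabilityMeasure μ]
    (hμ : ∀ l : Λ, 0 < μ {l}) (I : Λ → RandomCarpet.BMSystem) :
    (∀ φ : ℝ → ℝ, RandomCarpet.IsDimensionFunction φ →
      Summable (fun k : ℕ =>
        Real.exp (-(φ (Real.exp (-((k : ℝ) + 1))) * ((k : ℝ) + 1)))) →
      ∀ᵐ ω ∂(RandomCarpet.iidLaw μ),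
        ∀ ψ : ℝ → ℝ, RandomCarpet.IsDimensionFunction ψ →
          φ =o[𝓝[>] 0] ψ →
          (∀ᶠ x in 𝓝[>] (0 : ℝ), ψ x ≤
            Real.log (RandomCarpet.geomMean μ fun l => ((I l).n : ℝ)) /
              Real.log (RandomCarpet.geomMean μ fun l => ((I l).m : ℝ)) - 1) →
          RandomCarpet.IsQuasiAssouadDim (RandomCarpet.carpet I ω)
            (RandomCarpet.genAssouadDim ψ (RandomCarpet.carpet I ω))) ∧
    (∀ φ : ℝ → ℝ, RandomCarpet.IsDimensionFunction φ →
      ¬ Summable (fun k : ℕ =>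
        Real.exp (-(φ (Real.exp (-((k : ℝ) + 1))) * ((k : ℝ) + 1)))) →
      ∃ C : ℝ, 0 < C ∧ ∀ᵐ ω ∂(RandomCarpet.iidLaw μ),
        RandomCarpet.assouadDim (RandomCarpet.carpet I ω) =
          (⨆ l : Λ, Real.log ((I l).B : ℝ) / Real.log ((I l).m : ℝ)) +
            (⨆ l : Λ, Real.log ((I l).C : ℝ) / Real.log ((I l).n : ℝ)) ∧
        ∀ ψ : ℝ → ℝ, RandomCarpet.IsDimensionFunction ψ →
          Tendsto (fun x => ψ x * |Real.log x|) (𝓝[>] 0) atTop →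
          (∀ᶠ x in 𝓝[>] (0 : ℝ), ψ x ≤ C * φ x) →
          RandomCarpet.genAssouadDim ψ (RandomCarpet.carpet I ω) =
            RandomCarpet.assouadDim (RandomCarpet.carpet I ω)) := by
  refine ⟨fun φ hφ hsum => RandomCarpet.isQuasiAssouadDim_genAssouadDim μ I hφ hsum,
    fun φ hφ hsum => ?_⟩
  have : Nonempty Λ := nonempty_of_isProbabilityMeasure μ
  obtain ⟨b, ha0, hab, ha⟩ := RandomCarpet.exists_isMax_ratio
    (fun l => Real.log ((I l).B : ℝ)) (fun l => Real.log ((I l).m : ℝ))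
    (fun l => Real.log_natCast_nonneg _)
    (fun l => Real.log_pos (by exact_mod_cast (I l).two_le_m))
  obtain ⟨c, hc0, hcb, hc⟩ := RandomCarpet.exists_isMax_ratio
    (fun l => Real.log ((I l).C : ℝ)) (fun l => Real.log ((I l).n : ℝ))
    (fun l => Real.log_natCast_nonneg _)
    (fun l => Real.log_pos (by exact_mod_cast (I l).two_le_m.trans (I l).m_lt_n.le))
  obtain ⟨δ, hδ, hruns⟩ := RandomCarpet.exists_ae_hasLongRuns μ hμ I b c
  -- Neither this constant nor the null set depends on `φ`: both come from the runs alone.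
  refine ⟨δ * Real.log 2 / 3, by positivity, ?_⟩
  filter_upwards [hruns] with ω hω
  have hdim := hω.assouadDim_eq hδ ha hc ha0 hc0 hab hcb
  refine ⟨hdim, fun ψ _ hψ hle => ?_⟩
  rw [hdim]
  exact hω.genAssouadDim_eq hδ ha hc ha0 hc0 hab hcb hφ hsum hψ hle
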